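/- Let $d\in\mathbb N$, $T>0$, and let $\mathcal P_2(\mathbb R^d)$ be the set of Borel probability measures on $\mathbb R^d$ with finite second moment, endowed with the Wasserstein distance $W_2$, $W_2^2(\mu,\nu)=\inf_{\gamma\in\Pi(\mu,\nu)}\int|x-y|^2\,d\gamma$. For $\mu\in\mathcal P_2(\mathbb R^d)$ let $\bar\mu=\int x\,d\mu(x)$ be its barycenter. Let $b(t,x,\mu)\in\mathbb R^d$ be a vector field, defined for $t\in(0,T)$, $x\in\mathbb R^d$, $\mu\in\mathcal P_2(\mathbb R^d)$, continuous in $t$, such that for some constants $L,C$ and all $t,x,y,\mu,\nu$ $$|b(t,x,\mu)-b(t,y,\nu)|\le L\,(W_2(\mu,\nu)+|x-y|),\qquad |b(t,x,\mu)|\le C\Big(1+|x|+\int|y|\,d\mu(y)\Big).$$ Let $\mu_0$ be a probability measure on $\mathbb R^d$ that is absolutely continuous with respect to Lebesgue measure and has compact support. Given $\varepsilon\ge0$, a solution of $$\partial_t\mu_t+\operatorname{div}(b(t,x,\mu_t)\mu_t)=\varepsilon\Delta\mu_t,\qquad \mu_t|_{t=0}=\mu_0 \tag{1}$$ is a curve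 $\mu\in C([0,T];\mathcal P_2(\mathbb R^d))$ that starts at $\mu_0$ and satisfies, for all $\varphi\in C_c^\infty(\mathbb R^d)$ and $t\in(0,T)$, $$\frac{d}{dt}\int\varphi\,d\mu_t=\int\big(b(t,x,\mu_t)\cdot\nabla\varphi(x)+\varepsilon\Delta\varphi(x)\big)\,d\mu_t(x).$$ Fix a control $u\in L^1((0,T);\mathrm{Lip}(\mathbb R^d))$, where $\mathrm{Lip}(\mathbb R^d)$ is the space of Lipschitz maps $\mathbb R^d\to\mathbb R^d$, with $|u(t,x)|\le k(t)(1+|x|)$ for a.e. $t$ and all $x$, for some $k\in L^2(0,T)$. Let $Q,R,S,\bar Q$ be $d\times d$ matrices depending continuously on $t\in[0,T]$, let $Q_T,S_T,\bar Q_T$ be constant $d\times d$ matrices, and set $$J(\mu,u)=\int_0^T\!\!\int f(t,x,\mu_t,u(t,x))\,d\mu_t(x)\,dt+\int g(x,\mu_T)\,d\mu_T(x),$$ $$f(t,x,\mu,v)=\tfrac12\big[x'Q(t)x+v'R(t)v+(x-S(t)\bar\mu)'\bar Q(t)(x-S(t)\bar\mu)\big],$$ $$g(x,\mu)=\tfrac12\big[x'Q_Tx+(x-S_T\bar\mu)'\bar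 Q_T(x-S_T\bar\mu)\big].$$ Let $\mu$ be a solution of (1) with $\varepsilon=0$ and, for every $\varepsilon>0$, let $\mu^\varepsilon$ be a solution of (1). Then $$\lim_{\varepsilon\to0^+}\ \sup_{t\in[0,T]}W_2(\mu^\varepsilon_t,\mu_t)=0 .$$ Moreover $\bar\mu^\varepsilon_t\to\bar\mu_t$ as $\varepsilon\to0^+$, uniformly in $t\in[0,T]$; all integrals in $J(\mu,u)$ and $J(\mu^\varepsilon,u)$ converge absolutely, and $J(\mu^\varepsilon,u)\to J(\mu,u)$ as $\varepsilon\to0^+$. -/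

import Mathlib

open MeasureTheory Filter Topology Set
open scoped ENNReal ContDiff Gradient Laplacian

noncomputable section

namespace VanishingViscosity

/-- The Euclidean space `ℝ^d`. -/
abbrev Eucl (d : ℕ) : Type := EuclideanSpace ℝ (Fin d)

/-- `𝒫₂(ℝ^d)`: Borel probability measures with finite second moment. -/
def P2 (d : ℕ) : Type :=
  {μ : ProbabilityMeasure (Eucl d) // ∫⁻ x, ‖x‖ₑ ^ 2 ∂(μ : Measure (Eucl d)) < ⊤}

/-- The underlying measure of an element of `𝒫₂(ℝ^d)`. -/
def P2.meas {d : ℕ} (μ : P2 d) : Measure (Eucl d) := (μ.1 : Measure (Eucl d))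

/-- `𝒫_c^{ac}(ℝ^d)`: absolutely continuous with respect to Lebesgue measure, with compact
support. -/
def P2.IsCompactAC {d : ℕ} (μ : P2 d) : Prop :=
  μ.meas ≪ volume ∧ ∃ K : Set (Eucl d), IsCompact K ∧ μ.meas Kᶜ = 0

/-- The transport plans between `μ` and `ν`. -/
def couplings {d : ℕ} (μ ν : P2 d) : Set (Measure (Eucl d × Eucl d)) :=
  {γ | γ.map Prod.fst = μ.meas ∧ γ.map Prod.snd = ν.meas}

/-- The Wasserstein distance `W₂`. (The infimum is finite on `𝒫₂(ℝ^d)`.) -/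
def W2 {d : ℕ} (μ ν : P2 d) : ℝ :=
  Real.sqrt (⨅ γ ∈ couplings μ ν, ∫⁻ p, ‖p.1 - p.2‖ₑ ^ 2 ∂γ).toReal

/-- The barycenter of a measure. -/
def barycenter {d : ℕ} (μ : P2 d) : Eucl d := ∫ x, x ∂μ.meas

/-- A curve `μ ∈ C([0,T]; 𝒫₂(ℝ^d))` that is a weak solution of
`∂ₜ μₜ + div (b(t,x,μₜ) μₜ) = ε Δ μₜ` with initial datum `μ₀`; the case `ε = 0` is the continuity
equation. -/
structure IsWeakSolution {d : ℕ} (T ε : ℝ) (b : ℝ → Eucl d → P2 d → Eucl d) (μ₀ : P2 d)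
    (μ : ℝ → P2 d) : Prop where
  continuous : ∀ s ∈ Icc 0 T, Tendsto (fun t => W2 (μ t) (μ s)) (𝓝[Icc 0 T] s) (𝓝 0)
  initial : μ 0 = μ₀
  equation : ∀ φ : Eucl d → ℝ, ContDiff ℝ ∞ φ → HasCompactSupport φ → ∀ t ∈ Ioo 0 T,
    HasDerivAt (fun s => ∫ x, φ x ∂(μ s).meas)
      (∫ x, (inner ℝ (b t x (μ t)) (∇ φ x) + ε * Δ φ x) ∂(μ t).meas) t

/-- The control class `𝒰 = L¹((0,T); Lip(ℝ^d))`, where `Lip(ℝ^d)` carries the norm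
`|v(0)| + Lip(v)`. -/
structure IsControl {d : ℕ} (T : ℝ) (u : ℝ → Eucl d → Eucl d) : Prop where
  measurable : ∀ x, AEStronglyMeasurable (fun t => u t x) (volume.restrict (Ioo 0 T))
  integrable_zero : IntegrableOn (fun t => u t 0) (Ioo 0 T)
  lipschitz : ∃ l : ℝ → ℝ, IntegrableOn l (Ioo 0 T) ∧
    ∀ᵐ t ∂volume.restrict (Ioo 0 T), ∀ x y, ‖u t x - u t y‖ ≤ l t * ‖x - y‖

/-- The matrices of a quadratic cost on `[0,T]`. -/
structure QuadraticCost (d : ℕ) (T : ℝ) where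
  Q : ℝ → Eucl d →L[ℝ] Eucl d
  R : ℝ → Eucl d →L[ℝ] Eucl d
  S : ℝ → Eucl d →L[ℝ] Eucl d
  Qbar : ℝ → Eucl d →L[ℝ] Eucl d
  QT : Eucl d →L[ℝ] Eucl d
  ST : Eucl d →L[ℝ] Eucl d
  QbarT : Eucl d →L[ℝ] Eucl d
  continuous_Q : ContinuousOn Q (Icc 0 T)
  continuous_R : ContinuousOn R (Icc 0 T)
  continuous_S : ContinuousOn S (Icc 0 T)
  continuous_Qbar : ContinuousOn Qbar (Icc 0 T)

namespace QuadraticCost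

variable {d : ℕ} {T : ℝ} (c : QuadraticCost d T)

/-- The running cost
`f(t,x,μ,u) = (x'Q(t)x + u'R(t)u + (x - S(t)μ̄)'Q̄(t)(x - S(t)μ̄)) / 2`. -/
def running (t : ℝ) (x : Eucl d) (μ : P2 d) (u : Eucl d) : ℝ :=
  (1 / 2) * (inner ℝ x (c.Q t x) + inner ℝ u (c.R t u) +
    inner ℝ (x - c.S t (barycenter μ)) (c.Qbar t (x - c.S t (barycenter μ))))

/-- The final cost `g(x,μ) = (x'Q_T x + (x - S_T μ̄)'Q̄_T(x - S_T μ̄)) / 2`. -/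
def final (x : Eucl d) (μ : P2 d) : ℝ :=
  (1 / 2) * (inner ℝ x (c.QT x) +
    inner ℝ (x - c.ST (barycenter μ)) (c.QbarT (x - c.ST (barycenter μ))))

/-- The cost `J(μ,u) = ∫₀ᵀ ∫ f(t,x,μₜ,u(t,x)) dμₜ(x) dt + ∫ g(x,μ_T) dμ_T(x)`. -/
def J (μ : ℝ → P2 d) (u : ℝ → Eucl d → Eucl d) : ℝ :=
  (∫ t in (0 : ℝ)..T, ∫ x, c.running t x (μ t) (u t x) ∂(μ t).meas) +
    ∫ x, c.final x (μ T) ∂(μ T).meas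

/-- All the integrals in `J(μ,u)` converge absolutely. -/
structure IsFinite (μ : ℝ → P2 d) (u : ℝ → Eucl d → Eucl d) : Prop where
  inner_integrable : ∀ᵐ t ∂volume.restrict (Ioo 0 T),
    Integrable (fun x => c.running t x (μ t) (u t x)) (μ t).meas
  time_integrable :
    IntervalIntegrable (fun t => ∫ x, c.running t x (μ t) (u t x) ∂(μ t).meas) volume 0 T
  final_integrable : Integrable (fun x => c.final x (μ T)) (μ T).meas

end QuadraticCost

end VanishingViscosity

end

open VanishingViscosity

open MeasureTheory Filter Topology Set
open scoped ENNReal ContDiff Gradient Laplacian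

noncomputable section

namespace VanishingViscosity

/-! ### Couplings, second moments and continuity of integrals in `W2`. -/

section Wasserstein

variable {d : ℕ}

/-! Once the measure argument is frozen, a solution ρ solves a linear equation driven by the field
`b t x (ρ t)`. This field is Lipschitz and of linear growth, with constants that do not depend on ε
≤ 1 (`isLipField_of_solution`, fed by the moment bounds of `exists_uniform_moments`). Let X^ε and Z
be the flows from time 0 of the frozen fields of μ^ε and of μ.

Duality. A test function φ carried backwards along the flow is constant on trajectories. Mollified
at radius δ, it may be inserted into the weak equation, and ∫φ dμ^ε_t then differs from ∫φ∘X^ε_t dμ₀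
by at most a multiple of δ + ε c(δ) (`abs_integral_sub_integral_flow_le`). For ε = 0 and δ → 0 this
identifies μ_t with the image of μ₀ under Z_t (`meas_eq_map_flow`). For ε > 0 one fixes δ first and
then takes ε small.

From test functions to `W2`. Finitely many Lipschitz bumps cut a large ball into small cells. The
mass that two measures share in a cell is coupled inside that cell, and a fourth moment bound makes
the leftover mass cheap (`exists_coupling_of_test`). Hence μ^ε_t and μ₀ have a coupling with small
∫|x − X^ε_t(y)|².

Closing the loop. Following that coupling by Z_t gives W₂(μ^ε_t, μ_t) ≤ κ + 2 sup|X^ε_t − Z_t|, the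
supremum over a ball carrying μ₀, while the two flows separate at rate at most L(W₂ + |X^ε − Z|). A
Gronwall argument (`norm_flow_sub_flow_le`) makes both quantities small uniformly in time
(`eventually_forall_W2_le`).

Costs. The integrand is locally Lipschitz in x with a linearly growing constant, so its integrals
are continuous in `W2`. It sees the measure only through the barycenter, which is 1-Lipschitz for
`W2`. In time, 1 + k² dominates (`QuadraticCost.tendsto_J`). -/

instance P2.isProbabilityMeasure_meas (μ : P2 d) : IsProbabilityMeasure μ.meas := by
  unfold P2.meas; infer_instance

lemma P2.integrable_norm_sq (μ : P2 d) : Integrable (fun x => ‖x‖ ^ 2) μ.meas := by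
  refine ⟨by fun_prop, ?_⟩
  have h := μ.2
  simpa [HasFiniteIntegral, P2.meas, enorm_pow] using h

lemma integrable_norm_of_sq {μ : Measure (Eucl d)} [IsFiniteMeasure μ]
    (h : Integrable (fun x => ‖x‖ ^ 2) μ) : Integrable (fun x => ‖x‖) μ := by
  refine ((integrable_const (1 : ℝ)).add h).mono' (by fun_prop) (.of_forall fun x => ?_)
  simp only [norm_norm, Pi.add_apply]
  nlinarith [sq_nonneg (‖x‖ - 1), norm_nonneg x]

lemma P2.integrable_norm (μ : P2 d) : Integrable (fun x => ‖x‖) μ.meas :=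
  integrable_norm_of_sq μ.integrable_norm_sq

lemma P2.integrable_of_le_sq {F : Type*} [NormedAddCommGroup F] (μ : P2 d) {f : Eucl d → F}
    (hf : AEStronglyMeasurable f μ.meas) {K : ℝ} (h : ∀ x, ‖f x‖ ≤ K * (1 + ‖x‖ ^ 2)) :
    Integrable f μ.meas :=
  (((integrable_const (1 : ℝ)).add μ.integrable_norm_sq).const_mul K).mono' hf
    (.of_forall fun x => h x)

lemma P2.sq_integral_norm_le (μ : P2 d) :
    (∫ x, ‖x‖ ∂μ.meas) ^ 2 ≤ ∫ x, ‖x‖ ^ 2 ∂μ.meas := by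
  set m := ∫ x, ‖x‖ ∂μ.meas with hm
  have h : 0 ≤ ∫ x, (‖x‖ - m) ^ 2 ∂μ.meas := integral_nonneg fun x => sq_nonneg _
  have h2 : ∫ x, (‖x‖ - m) ^ 2 ∂μ.meas = ∫ x, ‖x‖ ^ 2 ∂μ.meas - m ^ 2 := by
    have : ∀ x : Eucl d, (‖x‖ - m) ^ 2 = ‖x‖ ^ 2 - 2 * m * ‖x‖ + m ^ 2 := fun x => by ring
    simp_rw [this]
    rw [integral_add (by exact (μ.integrable_norm_sq).sub (μ.integrable_norm.const_mul _))
      (integrable_const _), integral_sub μ.integrable_norm_sq (μ.integrable_norm.const_mul _),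
      integral_const_mul, ← hm]
    simp; ring
  linarith

lemma isProbabilityMeasure_of_coupling {μ ν : P2 d} {γ : Measure (Eucl d × Eucl d)}
    (hγ : γ ∈ couplings μ ν) : IsProbabilityMeasure γ := by
  have h : IsProbabilityMeasure (γ.map Prod.fst) := by rw [hγ.1]; infer_instance
  exact (Measure.isProbabilityMeasure_map_iff measurable_fst.aemeasurable).1 h

lemma coupling_integrable_fst {F : Type*} [NormedAddCommGroup F] {μ ν : P2 d}
    {γ : Measure (Eucl d × Eucl d)} (hγ : γ ∈ couplings μ ν) {f : Eucl d → F}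
    (hf : Integrable f μ.meas) : Integrable (fun p => f p.1) γ := by
  rw [← hγ.1] at hf
  exact hf.comp_measurable measurable_fst

lemma coupling_integrable_snd {F : Type*} [NormedAddCommGroup F] {μ ν : P2 d}
    {γ : Measure (Eucl d × Eucl d)} (hγ : γ ∈ couplings μ ν) {f : Eucl d → F}
    (hf : Integrable f ν.meas) : Integrable (fun p => f p.2) γ := by
  rw [← hγ.2] at hf
  exact hf.comp_measurable measurable_snd

lemma coupling_integral_fst {F : Type*} [NormedAddCommGroup F] [NormedSpace ℝ F] {μ ν : P2 d}
    {γ : Measure (Eucl d × Eucl d)} (hγ : γ ∈ couplings μ ν) {f : Eucl d → F}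
    (hf : Integrable f μ.meas) : ∫ p, f p.1 ∂γ = ∫ x, f x ∂μ.meas := by
  have h := hγ.1
  rw [← h] at hf ⊢
  exact (integral_map measurable_fst.aemeasurable hf.1).symm

lemma coupling_integral_snd {F : Type*} [NormedAddCommGroup F] [NormedSpace ℝ F] {μ ν : P2 d}
    {γ : Measure (Eucl d × Eucl d)} (hγ : γ ∈ couplings μ ν) {f : Eucl d → F}
    (hf : Integrable f ν.meas) : ∫ p, f p.2 ∂γ = ∫ x, f x ∂ν.meas := by
  have h := hγ.2
  rw [← h] at hf ⊢
  exact (integral_map measurable_snd.aemeasurable hf.1).symm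

lemma coupling_integrable_dist_sq {μ ν : P2 d} {γ : Measure (Eucl d × Eucl d)}
    (hγ : γ ∈ couplings μ ν) : Integrable (fun p : Eucl d × Eucl d => ‖p.1 - p.2‖ ^ 2) γ := by
  refine (((coupling_integrable_fst hγ μ.integrable_norm_sq).add
    (coupling_integrable_snd hγ ν.integrable_norm_sq)).const_mul 2).mono'
    (by fun_prop) (.of_forall fun p => ?_)
  have h := norm_sub_le p.1 p.2
  simp only [Pi.add_apply, norm_pow, norm_norm]
  nlinarith [sq_nonneg (‖p.1‖ - ‖p.2‖), norm_nonneg (p.1 - p.2)]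

lemma coupling_lintegral_eq {μ ν : P2 d} {γ : Measure (Eucl d × Eucl d)}
    (hγ : γ ∈ couplings μ ν) :
    ∫⁻ p, ‖p.1 - p.2‖ₑ ^ 2 ∂γ = ENNReal.ofReal (∫ p, ‖p.1 - p.2‖ ^ 2 ∂γ) := by
  rw [ofReal_integral_eq_lintegral_ofReal (coupling_integrable_dist_sq hγ)
    (.of_forall fun p => by positivity)]
  refine lintegral_congr fun p => ?_
  rw [ENNReal.ofReal_pow (norm_nonneg _), ofReal_norm]

lemma W2_nonneg (μ ν : P2 d) : 0 ≤ W2 μ ν := Real.sqrt_nonneg _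

lemma W2_sq_le {μ ν : P2 d} {γ : Measure (Eucl d × Eucl d)} (hγ : γ ∈ couplings μ ν) :
    W2 μ ν ^ 2 ≤ ∫ p, ‖p.1 - p.2‖ ^ 2 ∂γ := by
  unfold W2
  rw [Real.sq_sqrt ENNReal.toReal_nonneg]
  refine ENNReal.toReal_le_of_le_ofReal (integral_nonneg fun p => by positivity) ?_
  rw [← coupling_lintegral_eq hγ]
  exact iInf₂_le γ hγ

/-- The product plan has finite cost, so `toReal` loses nothing. Nearly optimal plans obtained this
way replace optimal ones throughout. -/
lemma exists_coupling_lt {μ ν : P2 d} {c : ℝ} (hc : W2 μ ν ^ 2 < c) :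
    ∃ γ ∈ couplings μ ν, ∫ p, ‖p.1 - p.2‖ ^ 2 ∂γ < c := by
  unfold W2 at hc
  rw [Real.sq_sqrt ENNReal.toReal_nonneg] at hc
  have hprod : μ.meas.prod ν.meas ∈ couplings μ ν := by
    constructor <;> simp
  have htop : (⨅ γ ∈ couplings μ ν, ∫⁻ p, ‖p.1 - p.2‖ₑ ^ 2 ∂γ) ≠ ⊤ := by
    refine ne_top_of_le_ne_top ?_ (iInf₂_le _ hprod)
    rw [coupling_lintegral_eq hprod]
    exact ENNReal.ofReal_ne_top
  have h := (ENNReal.lt_ofReal_iff_toReal_lt htop).2 hc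
  simp only [iInf_lt_iff] at h
  obtain ⟨γ, hγ, h⟩ := h
  refine ⟨γ, hγ, ?_⟩
  rw [coupling_lintegral_eq hγ] at h
  exact (ENNReal.ofReal_lt_ofReal_iff_of_nonneg (integral_nonneg fun p => by positivity)).1 h

/-- Maps whose local Lipschitz constant grows at most linearly. -/
def QuadLip {F : Type*} [NormedAddCommGroup F] (K : ℝ) (f : Eucl d → F) : Prop :=
  ∀ x y, ‖f x - f y‖ ≤ K * (1 + ‖x‖ + ‖y‖) * ‖x - y‖

lemma QuadLip.continuous {F : Type*} [NormedAddCommGroup F] {K : ℝ} {f : Eucl d → F}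
    (hf : QuadLip K f) : Continuous f := by
  refine continuous_iff_continuousAt.2 fun x => ?_
  rw [ContinuousAt, tendsto_iff_norm_sub_tendsto_zero]
  refine squeeze_zero (fun _ => norm_nonneg _) (fun y => hf y x) ?_
  have : Continuous fun y : Eucl d => K * (1 + ‖y‖ + ‖x‖) * ‖y - x‖ := by fun_prop
  simpa using this.tendsto x

lemma QuadLip.norm_le {F : Type*} [NormedAddCommGroup F] {K : ℝ} {f : Eucl d → F}
    (hf : QuadLip K f) (hK : 0 ≤ K) (x : Eucl d) : ‖f x‖ ≤ (‖f 0‖ + 2 * K) * (1 + ‖x‖ ^ 2) := by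
  have h := hf x 0
  simp only [norm_zero, add_zero, sub_zero] at h
  have h2 := norm_sub_norm_le (f x) (f 0)
  have h0 := norm_nonneg (f 0)
  have hx := norm_nonneg x
  have : K * (1 + ‖x‖) * ‖x‖ ≤ 2 * K * (1 + ‖x‖ ^ 2) := by
    have : (1 + ‖x‖) * ‖x‖ ≤ 2 * (1 + ‖x‖ ^ 2) := by nlinarith [sq_nonneg (‖x‖ - 1)]
    nlinarith
  nlinarith [mul_nonneg h0 (sq_nonneg ‖x‖)]

lemma QuadLip.integrable {F : Type*} [NormedAddCommGroup F] {K : ℝ} {f : Eucl d → F}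
    (hf : QuadLip K f) (hK : 0 ≤ K) (μ : P2 d) : Integrable f μ.meas :=
  μ.integrable_of_le_sq hf.continuous.aestronglyMeasurable (hf.norm_le hK)

lemma QuadLip.of_lipschitz {F : Type*} [NormedAddCommGroup F] {K : ℝ} {f : Eucl d → F}
    (hK : 0 ≤ K) (hf : ∀ x y, ‖f x - f y‖ ≤ K * ‖x - y‖) : QuadLip K f := fun x y => by
  refine (hf x y).trans (mul_le_mul_of_nonneg_right ?_ (norm_nonneg _))
  nlinarith [norm_nonneg x, norm_nonneg y]

lemma coupling_integral_mul_dist_le {μ ν : P2 d} {γ : Measure (Eucl d × Eucl d)}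
    (hγ : γ ∈ couplings μ ν) {g : Eucl d × Eucl d → ℝ} (hg0 : ∀ p, 0 ≤ g p)
    (hg : MemLp g 2 γ) :
    ∫ p, g p * ‖p.1 - p.2‖ ∂γ ≤ √(∫ p, g p ^ 2 ∂γ) * √(∫ p, ‖p.1 - p.2‖ ^ 2 ∂γ) := by
  have h2 : MemLp (fun p : Eucl d × Eucl d => ‖p.1 - p.2‖) 2 γ :=
    (memLp_two_iff_integrable_sq (by fun_prop)).2 (coupling_integrable_dist_sq hγ)
  have h := integral_mul_le_Lp_mul_Lq_of_nonneg (μ := γ) (f := g)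
    (g := fun p : Eucl d × Eucl d => ‖p.1 - p.2‖) (p := 2) (q := 2)
    Real.HolderConjugate.two_two (.of_forall hg0) (.of_forall fun p => norm_nonneg _)
    (by simpa using hg) (by simpa using h2)
  simpa only [Real.rpow_two, ← Real.sqrt_eq_rpow] using h

/-- Cauchy–Schwarz along a plan of cost below c, then c ↓ W₂². The plan changes with c, so G has to
bound ∫g² for all plans; in the applications it depends on the marginals only. -/
lemma norm_integral_sub_le_of_coupling {F : Type*} [NormedAddCommGroup F] [NormedSpace ℝ F]
    {μ ν : P2 d} {f : Eucl d → F} (hμ : Integrable f μ.meas) (hν : Integrable f ν.meas)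
    {g : Eucl d × Eucl d → ℝ} (hg0 : ∀ p, 0 ≤ g p) {G : ℝ}
    (hfg : ∀ x y, ‖f x - f y‖ ≤ g (x, y) * ‖x - y‖)
    (hg : ∀ γ ∈ couplings μ ν, MemLp g 2 γ ∧ ∫ p, g p ^ 2 ∂γ ≤ G) :
    ‖∫ x, f x ∂μ.meas - ∫ x, f x ∂ν.meas‖ ≤ √G * W2 μ ν := by
  have key : ∀ c, W2 μ ν ^ 2 < c →
      ‖∫ x, f x ∂μ.meas - ∫ x, f x ∂ν.meas‖ ≤ √G * √c := by
    intro c hc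
    obtain ⟨γ, hγ, hlt⟩ := exists_coupling_lt hc
    obtain ⟨hgL, hgG⟩ := hg γ hγ
    have h2 : MemLp (fun p : Eucl d × Eucl d => ‖p.1 - p.2‖) 2 γ :=
      (memLp_two_iff_integrable_sq (by fun_prop)).2 (coupling_integrable_dist_sq hγ)
    rw [← coupling_integral_fst hγ hμ, ← coupling_integral_snd hγ hν,
      ← integral_sub (coupling_integrable_fst hγ hμ) (coupling_integrable_snd hγ hν)]
    refine (norm_integral_le_of_norm_le (g := fun p => g p * ‖p.1 - p.2‖)
      (hgL.integrable_mul h2) (.of_forall fun p => hfg p.1 p.2)).trans ?_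
    refine (coupling_integral_mul_dist_le hγ hg0 hgL).trans ?_
    gcongr
  have hlim : Tendsto (fun c => √G * √c) (𝓝[>] (W2 μ ν ^ 2)) (𝓝 (√G * √(W2 μ ν ^ 2))) :=
    ((continuous_const.mul Real.continuous_sqrt).tendsto _).mono_left nhdsWithin_le_nhds
  rw [Real.sqrt_sq (W2_nonneg μ ν)] at hlim
  exact ge_of_tendsto hlim (eventually_nhdsWithin_of_forall key)

/-- Second moment. -/
def P2.m2 (μ : P2 d) : ℝ := ∫ x, ‖x‖ ^ 2 ∂μ.meas

lemma P2.m2_nonneg (μ : P2 d) : 0 ≤ μ.m2 := integral_nonneg fun x => by positivity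

lemma QuadLip.norm_integral_sub_le {F : Type*} [NormedAddCommGroup F] [NormedSpace ℝ F]
    {K : ℝ} {f : Eucl d → F} (hf : QuadLip K f) (hK : 0 ≤ K) (μ ν : P2 d) :
    ‖∫ x, f x ∂μ.meas - ∫ x, f x ∂ν.meas‖ ≤ K * √(3 * (1 + μ.m2 + ν.m2)) * W2 μ ν := by
  have h := norm_integral_sub_le_of_coupling (hf.integrable hK μ) (hf.integrable hK ν)
    (g := fun p => K * (1 + ‖p.1‖ + ‖p.2‖)) (fun p => by positivity) hf
    (G := K ^ 2 * (3 * (1 + μ.m2 + ν.m2))) ?_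
  · rwa [Real.sqrt_mul (sq_nonneg K), Real.sqrt_sq hK] at h
  intro γ hγ
  have := isProbabilityMeasure_of_coupling hγ
  have i1 := coupling_integrable_fst hγ μ.integrable_norm_sq
  have i2 := coupling_integrable_snd hγ ν.integrable_norm_sq
  have i3 : Integrable (fun p : Eucl d × Eucl d => K ^ 2 * (3 * (1 + ‖p.1‖ ^ 2 + ‖p.2‖ ^ 2))) γ :=
    ((((integrable_const 1).add i1).add i2).const_mul 3).const_mul _
  have hle : ∀ p : Eucl d × Eucl d, (K * (1 + ‖p.1‖ + ‖p.2‖)) ^ 2 ≤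
      K ^ 2 * (3 * (1 + ‖p.1‖ ^ 2 + ‖p.2‖ ^ 2)) := fun p => by
    rw [mul_pow]
    gcongr
    nlinarith [sq_nonneg (‖p.1‖ - 1), sq_nonneg (‖p.2‖ - 1), sq_nonneg (‖p.1‖ - ‖p.2‖)]
  have i4 : Integrable (fun p : Eucl d × Eucl d => (K * (1 + ‖p.1‖ + ‖p.2‖)) ^ 2) γ :=
    i3.mono' (by fun_prop) (.of_forall fun p => by
      rw [Real.norm_of_nonneg (sq_nonneg _)]; exact hle p)
  refine ⟨(memLp_two_iff_integrable_sq (by fun_prop)).2 i4, ?_⟩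
  refine (integral_mono i4 i3 hle).trans (le_of_eq ?_)
  have e1 : Integrable (fun p : Eucl d × Eucl d => 1 + ‖p.1‖ ^ 2) γ := (integrable_const 1).add i1
  rw [integral_const_mul, integral_const_mul, integral_add e1 i2,
    integral_add (integrable_const 1) i1, coupling_integral_fst hγ μ.integrable_norm_sq,
    coupling_integral_snd hγ ν.integrable_norm_sq]
  simp [P2.m2]

lemma norm_integral_sub_le_of_lipschitz {F : Type*} [NormedAddCommGroup F] [NormedSpace ℝ F]
    {K : ℝ} {f : Eucl d → F} (hK : 0 ≤ K) (hf : ∀ x y, ‖f x - f y‖ ≤ K * ‖x - y‖) (μ ν : P2 d) :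
    ‖∫ x, f x ∂μ.meas - ∫ x, f x ∂ν.meas‖ ≤ K * W2 μ ν := by
  have hq := QuadLip.of_lipschitz hK hf
  have h := norm_integral_sub_le_of_coupling (hq.integrable hK μ) (hq.integrable hK ν)
    (g := fun _ => K) (fun p => hK) hf (G := K ^ 2) ?_
  · rwa [Real.sqrt_sq hK] at h
  intro γ hγ
  have := isProbabilityMeasure_of_coupling hγ
  exact ⟨memLp_const K, by simp⟩

lemma P2.m2_le (μ ν : P2 d) : μ.m2 ≤ 2 * ν.m2 + 2 * W2 μ ν ^ 2 := by
  have key : ∀ c, W2 μ ν ^ 2 < c → (μ.m2 - 2 * ν.m2) / 2 ≤ c := by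
    intro c hc
    obtain ⟨γ, hγ, hlt⟩ := exists_coupling_lt hc
    have i1 := coupling_integrable_fst hγ μ.integrable_norm_sq
    have i2 := coupling_integrable_snd hγ ν.integrable_norm_sq
    have i3 := coupling_integrable_dist_sq hγ
    have h : ∫ p, ‖p.1‖ ^ 2 ∂γ ≤ ∫ p, (2 * ‖p.2‖ ^ 2 + 2 * ‖p.1 - p.2‖ ^ 2) ∂γ := by
      refine integral_mono i1 ((i2.const_mul 2).add (i3.const_mul 2)) fun p => ?_
      have h := norm_le_norm_add_norm_sub' p.1 p.2
      show ‖p.1‖ ^ 2 ≤ 2 * ‖p.2‖ ^ 2 + 2 * ‖p.1 - p.2‖ ^ 2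
      nlinarith [sq_nonneg (‖p.2‖ - ‖p.1 - p.2‖), norm_nonneg p.1]
    rw [integral_add (i2.const_mul 2) (i3.const_mul 2), integral_const_mul, integral_const_mul,
      coupling_integral_fst hγ μ.integrable_norm_sq,
      coupling_integral_snd hγ ν.integrable_norm_sq] at h
    unfold P2.m2
    linarith
  have := le_of_forall_gt_imp_ge_of_dense key
  linarith

/-- Near each time s the curve stays at `W2` distance less than 1 from its value at s, which bounds
the moment locally by `P2.m2_le`; compactness of [0,T] does the rest. -/
lemma exists_m2_le {T : ℝ} {μ : ℝ → P2 d}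
    (hμ : ∀ s ∈ Icc 0 T, Tendsto (fun t => W2 (μ t) (μ s)) (𝓝[Icc 0 T] s) (𝓝 0)) :
    ∃ M, ∀ t ∈ Icc 0 T, (μ t).m2 ≤ M := by
  refine isCompact_Icc.induction_on (p := fun s => ∃ M, ∀ t ∈ s, (μ t).m2 ≤ M) ⟨0, by simp⟩
    (fun s t hst ⟨M, hM⟩ => ⟨M, fun x hx => hM x (hst hx)⟩) ?_ ?_
  · rintro s t ⟨M, hM⟩ ⟨N, hN⟩
    exact ⟨max M N, fun x hx => hx.elim (fun h => (hM x h).trans (le_max_left _ _))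
      (fun h => (hN x h).trans (le_max_right _ _))⟩
  · intro s hs
    refine ⟨_, (hμ s hs).eventually (Iio_mem_nhds one_pos), 2 * (μ s).m2 + 2, fun t ht => ?_⟩
    have h1 := (μ t).m2_le (μ s)
    have h2 := W2_nonneg (μ t) (μ s)
    have h3 : W2 (μ t) (μ s) < 1 := ht
    nlinarith

lemma QuadLip.tendsto_integral {F : Type*} [NormedAddCommGroup F] [NormedSpace ℝ F]
    {K : ℝ} {f : Eucl d → F} (hf : QuadLip K f) (hK : 0 ≤ K) {T : ℝ} {μ : ℝ → P2 d}
    (hμ : ∀ s ∈ Icc 0 T, Tendsto (fun t => W2 (μ t) (μ s)) (𝓝[Icc 0 T] s) (𝓝 0))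
    {s : ℝ} (hs : s ∈ Icc 0 T) :
    Tendsto (fun t => ∫ x, f x ∂(μ t).meas) (𝓝[Icc 0 T] s) (𝓝 (∫ x, f x ∂(μ s).meas)) := by
  obtain ⟨M, hM⟩ := exists_m2_le hμ
  rw [tendsto_iff_norm_sub_tendsto_zero]
  have hlim := (hμ s hs).const_mul (K * √(3 * (1 + M + M)))
  rw [mul_zero] at hlim
  refine squeeze_zero' (.of_forall fun _ => norm_nonneg _) ?_ hlim
  filter_upwards [self_mem_nhdsWithin] with t ht
  refine (hf.norm_integral_sub_le hK (μ t) (μ s)).trans ?_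
  have := hM t ht
  have := hM s hs
  have := W2_nonneg (μ t) (μ s)
  gcongr

end Wasserstein

/-! ### Mean value and Gronwall inequalities with derivatives known only in the open interval. -/

section MeanValue

variable {F : Type*} [NormedAddCommGroup F] [NormedSpace ℝ F]

/-- The weak equation and the trajectories have no derivative at the endpoint a, so the inequality
is applied on [a',t] and a' ↓ a by continuity. -/
lemma norm_image_sub_le_of_interior {f f' : ℝ → F} {a b : ℝ} {B B' : ℝ → ℝ}
    (hf : ContinuousOn f (Icc a b)) (hf' : ∀ t ∈ Ioo a b, HasDerivAt f (f' t) t)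
    (hB : ∀ t, HasDerivAt B (B' t) t) (bound : ∀ t ∈ Ioo a b, ‖f' t‖ ≤ B' t) :
    ∀ t ∈ Icc a b, ‖f t - f a‖ ≤ B t - B a := by
  intro t ht
  rcases ht.1.eq_or_lt with rfl | hat
  · simp
  have key : ∀ a' ∈ Ioo a t, ‖f t - f a'‖ ≤ B t - B a' := by
    intro a' ha'
    have h := image_norm_le_of_norm_deriv_right_le_deriv_boundary (a := a') (b := t)
      (f := fun r => f r - f a') (f' := f') (B := fun r => B r - B a') (B' := B')
      ((hf.mono (Icc_subset_Icc ha'.1.le ht.2)).sub continuousOn_const)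
      (fun r hr => ((hf' r ⟨ha'.1.trans_le hr.1, hr.2.trans_le ht.2⟩).sub_const _).hasDerivWithinAt)
      (by simp) (fun r => (hB r).sub_const _)
      (fun r hr => bound r ⟨ha'.1.trans_le hr.1, hr.2.trans_le ht.2⟩)
    exact h (right_mem_Icc.2 ha'.2.le)
  have hne : (𝓝[Ioo a t] a).NeBot := by
    rw [← mem_closure_iff_nhdsWithin_neBot, closure_Ioo hat.ne]; exact left_mem_Icc.2 hat.le
  have hfa : Tendsto f (𝓝[Ioo a t] a) (𝓝 (f a)) :=
    (hf a (left_mem_Icc.2 (ht.1.trans ht.2))).mono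
      (Ioo_subset_Icc_self.trans (Icc_subset_Icc_right ht.2))
  have hBa : Tendsto B (𝓝[Ioo a t] a) (𝓝 (B a)) := (hB a).continuousAt.continuousWithinAt
  exact le_of_tendsto_of_tendsto (tendsto_const_nhds.sub hfa).norm (tendsto_const_nhds.sub hBa)
    (eventually_nhdsWithin_of_forall key)

lemma norm_image_sub_le_of_interior_const {f f' : ℝ → F} {a b C : ℝ}
    (hf : ContinuousOn f (Icc a b)) (hf' : ∀ t ∈ Ioo a b, HasDerivAt f (f' t) t)
    (bound : ∀ t ∈ Ioo a b, ‖f' t‖ ≤ C) : ∀ t ∈ Icc a b, ‖f t - f a‖ ≤ C * (t - a) := by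
  intro t ht
  have h := norm_image_sub_le_of_interior hf hf' (B := fun t => C * t) (B' := fun _ => C)
    (fun t => by simpa using (hasDerivAt_id t).const_mul C) bound t ht
  linarith

/-- The form κ + ‖f‖ serves two purposes: κ = 0 for the distance of two trajectories, κ = 1 for
fields of linear growth. -/
lemma gronwall_interior {f f' : ℝ → F} {a b K κ : ℝ}
    (hf : ContinuousOn f (Icc a b)) (hf' : ∀ t ∈ Ioo a b, HasDerivAt f (f' t) t)
    (bound : ∀ t ∈ Ioo a b, ‖f' t‖ ≤ K * (κ + ‖f t‖)) :
    ∀ t ∈ Icc a b, κ + ‖f t‖ ≤ (κ + ‖f a‖) * Real.exp (K * (t - a)) := by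
  intro t ht
  rcases ht.1.eq_or_lt with rfl | hat
  · simp
  have key : ∀ a' ∈ Ioo a t, κ + ‖f t‖ ≤ (κ + ‖f a'‖) * Real.exp (K * (t - a')) := by
    intro a' ha'
    have h := norm_le_gronwallBound_of_norm_deriv_right_le (a := a') (b := t)
      (f := f) (f' := f') (δ := ‖f a'‖) (K := K) (ε := K * κ)
      (hf.mono (Icc_subset_Icc ha'.1.le ht.2))
      (fun r hr => (hf' r ⟨ha'.1.trans_le hr.1, hr.2.trans_le ht.2⟩).hasDerivWithinAt) le_rfl
      (fun r hr => (bound r ⟨ha'.1.trans_le hr.1, hr.2.trans_le ht.2⟩).trans (by linarith))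
      t (right_mem_Icc.2 ha'.2.le)
    unfold gronwallBound at h
    split_ifs at h with hK
    · subst hK; simp at h ⊢; linarith
    · rw [mul_div_cancel_left₀ _ hK] at h; linarith
  have hne : (𝓝[Ioo a t] a).NeBot := by
    rw [← mem_closure_iff_nhdsWithin_neBot, closure_Ioo hat.ne]; exact left_mem_Icc.2 hat.le
  have hfa : Tendsto f (𝓝[Ioo a t] a) (𝓝 (f a)) :=
    (hf a (left_mem_Icc.2 (ht.1.trans ht.2))).mono
      (Ioo_subset_Icc_self.trans (Icc_subset_Icc_right ht.2))
  have hE : Tendsto (fun a' => Real.exp (K * (t - a'))) (𝓝[Ioo a t] a)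
      (𝓝 (Real.exp (K * (t - a)))) :=
    (Continuous.tendsto (by fun_prop) a).mono_left nhdsWithin_le_nhds
  exact ge_of_tendsto ((hfa.norm.const_add κ).mul hE) (eventually_nhdsWithin_of_forall key)

lemma gronwall_interior_backward {f f' : ℝ → F} {a b K κ : ℝ} (hab : a ≤ b)
    (hf : ContinuousOn f (Icc a b)) (hf' : ∀ t ∈ Ioo a b, HasDerivAt f (f' t) t)
    (bound : ∀ t ∈ Ioo a b, ‖f' t‖ ≤ K * (κ + ‖f t‖)) :
    κ + ‖f a‖ ≤ (κ + ‖f b‖) * Real.exp (K * (b - a)) := by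
  have hmem : ∀ t ∈ Ioo a b, a + b - t ∈ Ioo a b := fun t ht =>
    ⟨by linarith [ht.2], by linarith [ht.1]⟩
  have h := gronwall_interior (f := fun t => f (a + b - t)) (f' := fun t => -f' (a + b - t))
    (a := a) (b := b) (K := K) (κ := κ)
    (hf.comp (by fun_prop) fun t ht => ⟨by linarith [ht.2], by linarith [ht.1]⟩)
    (fun t ht => by
      simpa [Function.comp_def] using
        (hf' _ (hmem t ht)).scomp t ((hasDerivAt_id t).const_sub (a + b)))
    (fun t ht => by simpa using bound _ (hmem t ht)) b (right_mem_Icc.2 hab)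
  simpa using h

end MeanValue

/-! ### The flow of a Lipschitz field of linear growth. -/

section Flow

variable {d : ℕ} {T L C : ℝ} {v : ℝ → Eucl d → Eucl d}

/-- A time dependent vector field on `(0,T)`, continuous in time, `L`-Lipschitz in space and of
linear growth. -/
structure IsLipField (T L C : ℝ) (v : ℝ → Eucl d → Eucl d) : Prop where
  L_nonneg : 0 ≤ L
  C_nonneg : 0 ≤ C
  time : ∀ x, ContinuousOn (fun t => v t x) (Ioo 0 T)
  lip : ∀ t ∈ Ioo 0 T, ∀ x y, ‖v t x - v t y‖ ≤ L * ‖x - y‖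
  growth : ∀ t ∈ Ioo 0 T, ∀ x, ‖v t x‖ ≤ C * (1 + ‖x‖)

/-- `y` is an integral curve of `v` on `[s,T]` starting at `x`. -/
def IsTrajectory (T : ℝ) (v : ℝ → Eucl d → Eucl d) (s : ℝ) (x : Eucl d) (y : ℝ → Eucl d) : Prop :=
  y s = x ∧ ContinuousOn y (Icc s T) ∧ ∀ t ∈ Ioo s T, HasDerivAt y (v t (y t)) t

lemma IsLipField.continuousOn_comp (hv : IsLipField T L C v) {y : ℝ → Eucl d} {s : ℝ}
    (hs : 0 ≤ s) (hy : ContinuousOn y (Ioo s T)) :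
    ContinuousOn (fun r => v r (y r)) (Ioo s T) := by
  intro r hr
  have hr0 : r ∈ Ioo 0 T := ⟨hs.trans_lt hr.1, hr.2⟩
  have hsub : Ioo s T ⊆ Ioo 0 T := Ioo_subset_Ioo_left hs
  rw [ContinuousWithinAt, tendsto_iff_norm_sub_tendsto_zero]
  have h1 : Tendsto (fun q => L * ‖y q - y r‖ + ‖v q (y r) - v r (y r)‖) (𝓝[Ioo s T] r)
      (𝓝 0) := by
    have a1 := (tendsto_iff_norm_sub_tendsto_zero.1 (hy r hr)).const_mul L
    have a2 := tendsto_iff_norm_sub_tendsto_zero.1 ((hv.time (y r) r hr0).mono hsub)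
    simpa using a1.add a2
  refine squeeze_zero' (.of_forall fun _ => norm_nonneg _) ?_ h1
  filter_upwards [self_mem_nhdsWithin] with q hq
  calc ‖v q (y q) - v r (y r)‖ = ‖(v q (y q) - v q (y r)) + (v q (y r) - v r (y r))‖ := by
        congr 1; abel
    _ ≤ _ := (norm_add_le _ _).trans (add_le_add_left (hv.lip q (hsub hq) _ _) _)

lemma IsLipField.integrableOn_comp (hv : IsLipField T L C v) {y : ℝ → Eucl d} {s : ℝ}
    (hs : 0 ≤ s) (hy : Continuous y) : IntegrableOn (fun r => v r (y r)) (Ioo s T) := by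
  obtain ⟨M, hM⟩ := (isCompact_Icc (a := s) (b := T)).exists_bound_of_continuousOn hy.continuousOn
  refine (integrable_const (C * (1 + M))).mono'
    ((hv.continuousOn_comp hs hy.continuousOn).aestronglyMeasurable measurableSet_Ioo) ?_
  filter_upwards [ae_restrict_mem measurableSet_Ioo] with r hr
  refine (hv.growth r ⟨hs.trans_lt hr.1, hr.2⟩ _).trans ?_
  have := hM r (Ioo_subset_Icc_self hr)
  have := hv.C_nonneg
  gcongr

/-- Picard iteration in the exponentially weighted supremum norm, which is a contraction on the
whole of [s,T] at once, so no local solutions have to be glued. -/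
lemma IsLipField.exists_trajectory (hv : IsLipField T L C v) {s : ℝ} (hs : s ∈ Icc 0 T)
    (x : Eucl d) : ∃ y, IsTrajectory T v s x y := by
  -- This makes L / l ≤ 1/2, the contraction factor; the added 1 keeps l positive when L = 0.
  set l : ℝ := 2 * L + 1 with hl
  have hL := hv.L_nonneg
  have hl0 : 0 < l := by positivity
  -- The unknown z is the curve multiplied by e^{-lr}; `ext` removes the weight and is defined on
  -- all of ℝ.
  let ext (z : C(Icc s T, Eucl d)) : ℝ → Eucl d :=
    fun r => Real.exp (l * r) • z (projIcc s T hs.2 r)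
  have hext (z) : Continuous (ext z) := by
    have : Continuous fun r => z (projIcc s T hs.2 r) := z.continuous.comp continuous_projIcc
    fun_prop
  have h_integrable (z) : IntegrableOn (fun r => v r (ext z r)) (Ioo s T) :=
    hv.integrableOn_comp hs.1 (hext z)
  have hii (z) {t : ℝ} (ht : t ∈ Icc s T) :
      IntervalIntegrable (fun r => v r (ext z r)) volume s t := by
    rw [intervalIntegrable_iff_integrableOn_Ioo_of_le ht.1]
    exact (h_integrable z).mono_set (Ioo_subset_Ioo_right ht.2)
  let prim (z : C(Icc s T, Eucl d)) : ℝ → Eucl d := fun t => x + ∫ r in s..t, v r (ext z r)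
  have hprim (z) : ContinuousOn (prim z) (Icc s T) := by
    refine continuousOn_const.add ?_
    have := intervalIntegral.continuousOn_primitive_interval
      (μ := volume) (f := fun r => v r (ext z r)) (a := s) (b := T) ?_
    · rwa [uIcc_of_le hs.2] at this
    · rw [uIcc_of_le hs.2, integrableOn_Icc_iff_integrableOn_Ioo]; exact h_integrable z
  let N (z : C(Icc s T, Eucl d)) : C(Icc s T, Eucl d) :=
    ⟨fun t => Real.exp (-(l * t)) • prim z t, by
      have : Continuous fun t : Icc s T => prim z t := (hprim z).domRestrict
      have hE : Continuous fun t : Icc s T => Real.exp (-(l * (t : ℝ))) := by fun_prop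
      exact hE.smul this⟩
  have hN : ContractingWith (1 / 2) N := by
    refine ⟨by norm_num, LipschitzWith.of_dist_le_mul fun z z' => ?_⟩
    rw [ContinuousMap.dist_le (by positivity)]
    intro t
    have hd : ∀ r ∈ Ioo s T, ‖v r (ext z r) - v r (ext z' r)‖ ≤
        L * dist z z' * Real.exp (l * r) := by
      intro r hr
      refine (hv.lip r ⟨hs.1.trans_lt hr.1, hr.2⟩ _ _).trans ?_
      simp only [ext]
      rw [← smul_sub, norm_smul, Real.norm_of_nonneg (Real.exp_pos _).le]
      have : ‖z (projIcc s T hs.2 r) - z' (projIcc s T hs.2 r)‖ ≤ dist z z' := by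
        rw [← dist_eq_norm]; exact ContinuousMap.dist_apply_le_dist _
      calc _ ≤ L * (Real.exp (l * r) * dist z z') := by gcongr
        _ = _ := by ring
    have hexp : ∫ r in s..t, L * dist z z' * Real.exp (l * r) ≤
        L * dist z z' * (Real.exp (l * t) / l) := by
      rw [intervalIntegral.integral_const_mul]
      have : ∫ r in s..t, Real.exp (l * r) = (Real.exp (l * t) - Real.exp (l * s)) / l := by
        rw [intervalIntegral.integral_comp_mul_left (fun r => Real.exp r) hl0.ne', integral_exp]
        simp [div_eq_inv_mul]
      rw [this]
      gcongr
      linarith [Real.exp_pos (l * s)]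
    have hI : ‖∫ r in s..t, (v r (ext z r) - v r (ext z' r))‖ ≤
        L * dist z z' * (Real.exp (l * t) / l) := by
      refine le_trans ?_ hexp
      refine intervalIntegral.norm_integral_le_of_norm_le t.2.1 ?_
        ((by fun_prop : Continuous fun r => L * dist z z' * Real.exp (l * r)).intervalIntegrable _ _)
      rw [← ae_restrict_iff' measurableSet_Ioc, ← Measure.restrict_congr_set Ioo_ae_eq_Ioc]
      filter_upwards [ae_restrict_mem measurableSet_Ioo] with r hr
      exact hd r ⟨hr.1, hr.2.trans_le t.2.2⟩
    rw [dist_eq_norm]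
    simp only [N, ContinuousMap.coe_mk, prim]
    rw [← smul_sub, add_sub_add_left_eq_sub, ← intervalIntegral.integral_sub (hii z t.2)
      (hii z' t.2), norm_smul, Real.norm_of_nonneg (Real.exp_pos _).le]
    calc Real.exp (-(l * t)) * ‖∫ r in s..t, (v r (ext z r) - v r (ext z' r))‖
        ≤ Real.exp (-(l * t)) * (L * dist z z' * (Real.exp (l * t) / l)) := by gcongr
      _ = (L / l) * dist z z' := by
        rw [Real.exp_neg]; field_simp
      _ ≤ _ := by
        refine mul_le_mul_of_nonneg_right ?_ dist_nonneg
        push_cast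
        rw [div_le_div_iff₀ hl0 two_pos]; linarith
  have : Nonempty (C(Icc s T, Eucl d)) := ⟨0⟩
  set z := hN.fixedPoint N
  have hz : N z = z := hN.fixedPoint_isFixedPt
  have heq : ∀ t ∈ Icc s T, ext z t = prim z t := by
    intro t ht
    simp only [ext]
    rw [projIcc_of_mem hs.2 ht]
    nth_rewrite 1 [← hz]
    simp only [N, ContinuousMap.coe_mk]
    rw [smul_smul, ← Real.exp_add]; simp
  refine ⟨ext z, ?_, (hext z).continuousOn, fun t ht => ?_⟩
  · rw [heq s ⟨le_rfl, hs.2⟩]; simp [prim]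
  · have hc := hv.continuousOn_comp hs.1 (hext z).continuousOn
    have hca : ContinuousAt (fun r => v r (ext z r)) t :=
      (hc t ht).continuousAt (Ioo_mem_nhds ht.1 ht.2)
    have hd : HasDerivAt (prim z) (v t (ext z t)) t := by
      refine HasDerivAt.const_add x (intervalIntegral.integral_hasDerivAt_right
        (hii z (Ioo_subset_Icc_self ht)) ?_ hca)
      exact hc.stronglyMeasurableAtFilter isOpen_Ioo t ht
    refine hd.congr_of_eventuallyEq ?_
    filter_upwards [Ioo_mem_nhds ht.1 ht.2] with r hr
    exact heq r (Ioo_subset_Icc_self hr)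

open Classical in
/-- The flow of `v`: `flow T v s t x` is the value at time `t` of the integral curve that is at `x`
at time `s`. -/
def flow (T : ℝ) (v : ℝ → Eucl d → Eucl d) (s t : ℝ) (x : Eucl d) : Eucl d :=
  if h : ∃ y, IsTrajectory T v s x y then h.choose t else x

lemma IsLipField.flow_trajectory (hv : IsLipField T L C v) {s : ℝ} (hs : s ∈ Icc 0 T)
    (x : Eucl d) : IsTrajectory T v s x (fun t => flow T v s t x) := by
  have h := hv.exists_trajectory hs x
  have : (fun t => flow T v s t x) = h.choose := by
    funext t; simp only [flow]; rw [dif_pos h]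
  rw [this]
  exact h.choose_spec

lemma IsLipField.flow_self (hv : IsLipField T L C v) {s : ℝ} (hs : s ∈ Icc 0 T)
    (x : Eucl d) : flow T v s s x = x := (hv.flow_trajectory hs x).1

lemma IsLipField.dist_trajectory_le (hv : IsLipField T L C v) {s : ℝ} (hs : 0 ≤ s)
    {y z : ℝ → Eucl d} (hy : ContinuousOn y (Icc s T)) (hz : ContinuousOn z (Icc s T))
    (hy' : ∀ t ∈ Ioo s T, HasDerivAt y (v t (y t)) t)
    (hz' : ∀ t ∈ Ioo s T, HasDerivAt z (v t (z t)) t) {t : ℝ} (ht : t ∈ Icc s T) :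
    ‖y t - z t‖ ≤ ‖y s - z s‖ * Real.exp (L * (t - s)) := by
  have h := gronwall_interior (f := fun t => y t - z t) (κ := 0) (K := L)
    (hy.sub hz) (fun t ht => (hy' t ht).sub (hz' t ht))
    (fun t ht => by simpa using hv.lip t ⟨hs.trans_lt ht.1, ht.2⟩ _ _) t ht
  simpa using h

lemma IsLipField.flow_lipschitz (hv : IsLipField T L C v) {s t : ℝ} (hs : 0 ≤ s)
    (ht : t ∈ Icc s T) (x y : Eucl d) :
    ‖flow T v s t x - flow T v s t y‖ ≤ Real.exp (L * T) * ‖x - y‖ := by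
  have hs' : s ∈ Icc 0 T := ⟨hs, ht.1.trans ht.2⟩
  have hx := hv.flow_trajectory hs' x
  have hy := hv.flow_trajectory hs' y
  have h := hv.dist_trajectory_le hs hx.2.1 hy.2.1 hx.2.2 hy.2.2 ht
  simp only [hv.flow_self hs'] at h
  refine h.trans ?_
  rw [mul_comm]
  have := hv.L_nonneg
  gcongr
  linarith [ht.2]

lemma IsLipField.continuous_flow (hv : IsLipField T L C v) {s t : ℝ} (hs : 0 ≤ s)
    (ht : t ∈ Icc s T) : Continuous (flow T v s t) :=
  (LipschitzWith.of_dist_le_mul (K := (Real.exp (L * T)).toNNReal) fun x y => by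
    rw [dist_eq_norm, dist_eq_norm, Real.coe_toNNReal _ (Real.exp_pos _).le]
    exact hv.flow_lipschitz hs ht x y).continuous

/-- Uniqueness: two trajectories with the same value at r agree on [r,T]. -/
lemma IsLipField.flow_flow (hv : IsLipField T L C v) {s r t : ℝ} (hs : 0 ≤ s)
    (hsr : s ≤ r) (hrt : r ≤ t) (htT : t ≤ T) (x : Eucl d) :
    flow T v r t (flow T v s r x) = flow T v s t x := by
  have hr' : r ∈ Icc 0 T := ⟨hs.trans hsr, hrt.trans htT⟩
  have hx := hv.flow_trajectory (⟨hs, hsr.trans hr'.2⟩ : s ∈ Icc 0 T) x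
  have hy := hv.flow_trajectory hr' (flow T v s r x)
  have h := hv.dist_trajectory_le hr'.1 hy.2.1 (hx.2.1.mono (Icc_subset_Icc_left hsr)) hy.2.2
    (fun q hq => hx.2.2 q ⟨hsr.trans_lt hq.1, hq.2⟩) (⟨hrt, htT⟩ : t ∈ Icc r T)
  rw [hv.flow_self hr'] at h
  simpa [sub_eq_zero] using h

lemma IsLipField.flow_growth (hv : IsLipField T L C v) {s t : ℝ} (hs : 0 ≤ s)
    (ht : t ∈ Icc s T) (x : Eucl d) :
    1 + ‖flow T v s t x‖ ≤ Real.exp (C * T) * (1 + ‖x‖) := by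
  have hs' : s ∈ Icc 0 T := ⟨hs, ht.1.trans ht.2⟩
  have hx := hv.flow_trajectory hs' x
  have h := gronwall_interior (κ := 1) (K := C) hx.2.1 hx.2.2
    (fun t ht => hv.growth t ⟨hs.trans_lt ht.1, ht.2⟩ _) t ht
  simp only [hv.flow_self hs'] at h
  refine h.trans ?_
  rw [mul_comm]
  have := hv.C_nonneg
  gcongr
  linarith [ht.2]

/-- Points ending in a ball must have started in a larger fixed ball; this is what keeps the
backward transport of a test function compactly supported. -/
lemma IsLipField.flow_growth_backward (hv : IsLipField T L C v) {s t : ℝ} (hs : 0 ≤ s)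
    (ht : t ∈ Icc s T) (x : Eucl d) :
    1 + ‖x‖ ≤ Real.exp (C * T) * (1 + ‖flow T v s t x‖) := by
  have hs' : s ∈ Icc 0 T := ⟨hs, ht.1.trans ht.2⟩
  have hx := hv.flow_trajectory hs' x
  have h := gronwall_interior_backward (κ := 1) (K := C) ht.1
    (hx.2.1.mono (Icc_subset_Icc_right ht.2)) (fun r hr => hx.2.2 r ⟨hr.1, hr.2.trans_le ht.2⟩)
    (fun r hr => hv.growth r ⟨hs.trans_lt hr.1, hr.2.trans_le ht.2⟩ _)
  simp only [hv.flow_self hs'] at h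
  refine h.trans ?_
  rw [mul_comm]
  have := hv.C_nonneg
  gcongr
  linarith [ht.2]

lemma IsLipField.norm_flow_sub_le (hv : IsLipField T L C v) {s t : ℝ} (hs : 0 ≤ s)
    (ht : t ∈ Icc s T) (x : Eucl d) :
    ‖flow T v s t x - x‖ ≤ C * Real.exp (C * T) * (1 + ‖x‖) * (t - s) := by
  have hs' : s ∈ Icc 0 T := ⟨hs, ht.1.trans ht.2⟩
  have hx := hv.flow_trajectory hs' x
  have h := norm_image_sub_le_of_interior_const hx.2.1 hx.2.2
    (C := C * (Real.exp (C * T) * (1 + ‖x‖))) (fun r hr => ?_) t ht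
  · simp only [hv.flow_self hs'] at h
    rwa [← mul_assoc] at h
  · refine (hv.growth r ⟨hs.trans_lt hr.1, hr.2⟩ _).trans ?_
    exact mul_le_mul_of_nonneg_left (hv.flow_growth hs (Ioo_subset_Icc_self hr) x) hv.C_nonneg

end Flow

/-! ### Radial test functions and cutoffs. -/

section TestFunctions

variable {d : ℕ}

lemma norm_gradient_eq (φ : Eucl d → ℝ) (x : Eucl d) : ‖∇ φ x‖ = ‖fderiv ℝ φ x‖ := by
  simp [gradient]

lemma inner_gradient (φ : Eucl d → ℝ) (x y : Eucl d) : inner ℝ y (∇ φ x) = fderiv ℝ φ x y := by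
  rw [real_inner_comm]; simp [gradient]

lemma abs_laplacian_le (φ : Eucl d → ℝ) (x : Eucl d) :
    |Δ φ x| ≤ d * ‖fderiv ℝ (fderiv ℝ φ) x‖ := by
  rw [InnerProductSpace.laplacian_eq_iteratedFDeriv_orthonormalBasis φ
    (EuclideanSpace.basisFun (Fin d) ℝ)]
  refine (Finset.abs_sum_le_sum_abs _ _).trans ?_
  refine (Finset.sum_le_card_nsmul _ _ (‖fderiv ℝ (fderiv ℝ φ) x‖) fun i _ => ?_).trans ?_
  · rw [iteratedFDeriv_two_apply]
    simp only [Matrix.cons_val_zero, Matrix.cons_val_one]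
    refine ((fderiv ℝ (fderiv ℝ φ) x _).le_opNorm _).trans ?_
    refine (mul_le_mul_of_nonneg_right (ContinuousLinearMap.le_opNorm _ _) (norm_nonneg _)).trans ?_
    simp
  · simp

lemma contDiff_radial {G : ℝ → ℝ} (hG : ContDiff ℝ ∞ G) :
    ContDiff ℝ ∞ (fun x : Eucl d => G (‖x‖ ^ 2)) :=
  hG.comp (contDiff_norm_sq ℝ)

lemma fderiv_radial {G : ℝ → ℝ} (hG : ContDiff ℝ ∞ G) :
    fderiv ℝ (fun x : Eucl d => G (‖x‖ ^ 2)) =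
      fun x => (2 * deriv G (‖x‖ ^ 2)) • innerSL ℝ x := by
  funext x
  have h1 : HasFDerivAt (fun x : Eucl d => ‖x‖ ^ 2) (2 • innerSL ℝ x) x :=
    (hasStrictFDerivAt_norm_sq x).hasFDerivAt
  have h2 : HasDerivAt G (deriv G (‖x‖ ^ 2)) (‖x‖ ^ 2) :=
    (hG.differentiable (by simp) _).hasDerivAt
  have h3 : HasFDerivAt (fun x : Eucl d => G (‖x‖ ^ 2)) _ x := h2.comp_hasFDerivAt x h1
  rw [h3.fderiv]
  ext y; simp; ring

lemma norm_fderiv_radial {G : ℝ → ℝ} (hG : ContDiff ℝ ∞ G) (x : Eucl d) :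
    ‖fderiv ℝ (fun x : Eucl d => G (‖x‖ ^ 2)) x‖ = 2 * |deriv G (‖x‖ ^ 2)| * ‖x‖ := by
  rw [fderiv_radial hG]
  simp [norm_smul]

/-- The Hessian of G(|x|²) is 4G''(|x|²) x⊗x + 2G'(|x|²) Id. -/
lemma norm_fderiv_fderiv_radial_le {G : ℝ → ℝ} (hG : ContDiff ℝ ∞ G) (x : Eucl d) :
    ‖fderiv ℝ (fderiv ℝ (fun x : Eucl d => G (‖x‖ ^ 2))) x‖ ≤
      4 * |deriv (deriv G) (‖x‖ ^ 2)| * ‖x‖ ^ 2 + 2 * |deriv G (‖x‖ ^ 2)| := by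
  rw [fderiv_radial hG]
  have hG' : ContDiff ℝ ∞ (deriv G) := (contDiff_infty_iff_deriv.1 hG).2
  have h1 : HasFDerivAt (fun x : Eucl d => ‖x‖ ^ 2) (2 • innerSL ℝ x) x :=
    (hasStrictFDerivAt_norm_sq x).hasFDerivAt
  have h2 : HasDerivAt (deriv G) (deriv (deriv G) (‖x‖ ^ 2)) (‖x‖ ^ 2) :=
    (hG'.differentiable (by simp) _).hasDerivAt
  have h3 := (h2.comp_hasFDerivAt x h1).const_mul 2
  have h4 : HasFDerivAt (fun x : Eucl d => innerSL ℝ x) (innerSL ℝ : Eucl d →L[ℝ] _) x :=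
    (innerSL ℝ : Eucl d →L[ℝ] _).hasFDerivAt
  have h5 : HasFDerivAt (fun x : Eucl d => (2 * deriv G (‖x‖ ^ 2)) • innerSL ℝ x) _ x :=
    h3.smul h4
  rw [h5.fderiv]
  refine (norm_add_le (_ : Eucl d →L[ℝ] Eucl d →L[ℝ] ℝ) _).trans ?_
  rw [add_comm]
  gcongr
  · refine ContinuousLinearMap.opNorm_le_bound _ (by positivity) fun y => ?_
    simp only [ContinuousLinearMap.smulRight_apply, norm_smul, innerSL_apply_norm]
    simp only [smul_apply, innerSL_apply_apply, smul_eq_mul, nsmul_eq_mul,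
      norm_mul, Real.norm_eq_abs]
    have h := abs_real_inner_le_norm x y
    norm_num
    calc _ = 4 * |deriv (deriv G) (‖x‖ ^ 2)| * ‖x‖ * |inner ℝ x y| := by ring
      _ ≤ 4 * |deriv (deriv G) (‖x‖ ^ 2)| * ‖x‖ * (‖x‖ * ‖y‖) := by gcongr
      _ = _ := by ring
  · refine ContinuousLinearMap.opNorm_le_bound _ (by positivity) fun y => ?_
    show ‖(2 * deriv G (‖x‖ ^ 2)) • innerSL ℝ y‖ ≤ _
    rw [norm_smul, innerSL_apply_norm]
    simp

/-- Take ζ(s/(m+1)) for a fixed bump ζ. Its derivatives vanish for s > 2(m+1), and elsewhere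
(1+s)/(m+1) ≤ 3, so each derivative pays for one factor 1+s uniformly in m. -/
lemma exists_cutoff : ∃ c : ℝ, 0 ≤ c ∧ ∃ ζ : ℕ → ℝ → ℝ, ∀ m, ContDiff ℝ ∞ (ζ m) ∧
    (∀ s, 2 * ((m : ℝ) + 1) < s → ζ m s = 0) ∧ (∀ s, 0 ≤ ζ m s ∧ ζ m s ≤ 1) ∧
    (∀ s : ℝ, 0 ≤ s → s ≤ m → ζ m s = 1) ∧
    (∀ s, 0 ≤ s → (1 + s) * |deriv (ζ m) s| ≤ c) ∧
    (∀ s, 0 ≤ s → (1 + s) ^ 2 * |deriv (deriv (ζ m)) s| ≤ c) := by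
  let f : ContDiffBump (0 : ℝ) := ⟨1, 2, one_pos, one_lt_two⟩
  have hf : ContDiff ℝ ∞ f := f.contDiff
  have hf1 : ContDiff ℝ ∞ (deriv f) := (contDiff_infty_iff_deriv.1 hf).2
  have hf2 : Continuous (deriv (deriv f)) := (contDiff_infty_iff_deriv.1 hf1).2.continuous
  have hs1 : HasCompactSupport (deriv f) := f.hasCompactSupport.deriv
  have hs2 : HasCompactSupport (deriv (deriv f)) := hs1.deriv
  obtain ⟨c1, hc1⟩ := hs1.exists_bound_of_continuous hf1.continuous
  obtain ⟨c2, hc2⟩ := hs2.exists_bound_of_continuous hf2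
  have hz : ∀ y : ℝ, 2 < y → deriv f y = 0 ∧ deriv (deriv f) y = 0 := by
    intro y hy
    have h0 : (f : ℝ → ℝ) =ᶠ[𝓝 y] fun _ => 0 := by
      filter_upwards [Ioi_mem_nhds hy] with z hz
      exact f.zero_of_le_dist (by
        have : (2 : ℝ) ≤ |z| := hz.le.trans (le_abs_self z)
        simpa [Real.dist_eq] using this)
    have h1 : deriv f =ᶠ[𝓝 y] fun _ => 0 := by
      have := h0.deriv
      simpa using this
    refine ⟨h1.eq_of_nhds, ?_⟩
    rw [h1.deriv_eq]; simp
  have d1 : ∀ k : ℝ, deriv (fun s => f (k * s)) = fun s => k * deriv f (k * s) := by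
    intro k; funext s
    rw [deriv_comp_mul_left k f s]; simp
  have d2 : ∀ k : ℝ, deriv (deriv (fun s => f (k * s))) =
      fun s => k ^ 2 * deriv (deriv f) (k * s) := by
    intro k
    rw [d1]; funext s
    rw [deriv_const_mul_field, deriv_comp_mul_left k (deriv f) s]; simp; ring
  have hc1' : 0 ≤ c1 := (norm_nonneg _).trans (hc1 0)
  have hc2' : 0 ≤ c2 := (norm_nonneg _).trans (hc2 0)
  refine ⟨3 * c1 + 9 * c2, by positivity, fun m s => f (((m : ℝ) + 1)⁻¹ * s), fun m => ?_⟩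
  have hm : (0 : ℝ) < m + 1 := by positivity
  have hk : ∀ s, 0 ≤ s → ((m : ℝ) + 1)⁻¹ * s ≤ 2 → (1 + s) * ((m : ℝ) + 1)⁻¹ ≤ 3 := by
    intro s hs h
    have : ((m : ℝ) + 1)⁻¹ ≤ 1 := inv_le_one_of_one_le₀ (by linarith [Nat.cast_nonneg (α := ℝ) m])
    linarith
  refine ⟨hf.comp (contDiff_const.mul contDiff_id), fun s hs => ?_, fun s => ⟨f.nonneg, f.le_one⟩,
    fun s h0 hs => ?_, fun s hs => ?_, fun s hs => ?_⟩
  · refine f.zero_of_le_dist ?_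
    rw [dist_zero_right]
    refine le_trans ?_ (le_abs_self _)
    show (2 : ℝ) ≤ _
    rw [inv_mul_eq_div, le_div_iff₀ hm]; exact hs.le
  · refine f.one_of_mem_closedBall ?_
    rw [mem_closedBall_zero_iff, Real.norm_of_nonneg (by positivity), inv_mul_eq_div,
      div_le_iff₀ hm]
    show s ≤ 1 * ((m : ℝ) + 1)
    linarith
  · rw [d1]
    by_cases h : ((m : ℝ) + 1)⁻¹ * s ≤ 2
    · rw [abs_mul, abs_of_pos (inv_pos.2 hm), ← mul_assoc]
      have := hc1 (((m : ℝ) + 1)⁻¹ * s)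
      rw [Real.norm_eq_abs] at this
      calc _ ≤ 3 * c1 := mul_le_mul (hk s hs h) this (abs_nonneg _) (by norm_num)
        _ ≤ _ := by linarith
    · simp only [(hz _ (not_le.1 h)).1]; simp; positivity
  · rw [d2]
    by_cases h : ((m : ℝ) + 1)⁻¹ * s ≤ 2
    · rw [abs_mul, abs_of_nonneg (by positivity), ← mul_assoc, ← mul_pow]
      have := hc2 (((m : ℝ) + 1)⁻¹ * s)
      rw [Real.norm_eq_abs] at this
      have h3 := hk s hs h
      have h9 : ((1 + s) * ((m : ℝ) + 1)⁻¹) ^ 2 ≤ 9 := by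
        have : 0 ≤ (1 + s) * ((m : ℝ) + 1)⁻¹ := by positivity
        nlinarith
      calc _ ≤ 9 * c2 := mul_le_mul h9 this (abs_nonneg _) (by norm_num)
        _ ≤ _ := by linarith
    · simp only [(hz _ (not_le.1 h)).2]; simp; positivity

end TestFunctions

/-! ### Uniform moment bounds. -/

section Moments

variable {d : ℕ}

/-- Apply the improvement to the supremum S: S ≤ q + S/2. This plays the role of Gronwall for
quantities, such as moments or `W2` distances, that need not be differentiable in time; the a priori
bound ensures S is finite. -/
lemma le_two_mul_of_self_improving {ι : Type*} {f : ι → ℝ} (hf : ∃ M, ∀ i, f i ≤ M) {q : ℝ}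
    (hq : 0 ≤ q) (h : ∀ B, 0 ≤ B → (∀ i, f i ≤ B) → ∀ i, f i ≤ q + B / 2) (i : ι) :
    f i ≤ 2 * q := by
  obtain ⟨M, hM⟩ := hf
  have : Nonempty ι := ⟨i⟩
  have hbdd : BddAbove (range f) := ⟨M, by rintro _ ⟨j, rfl⟩; exact hM j⟩
  set S := max 0 (⨆ j, f j) with hS
  have h1 : ∀ j, f j ≤ S := fun j => (le_ciSup hbdd j).trans (le_max_right _ _)
  have h2 := h S (le_max_left _ _) h1
  have h3 : S ≤ q + S / 2 :=
    max_le (by have := le_max_left 0 (⨆ j, f j); linarith) (ciSup_le h2)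
  linarith [h1 i]

lemma exists_lipschitz_of_compactSupport {φ : Eucl d → ℝ} (hφ : ContDiff ℝ ∞ φ)
    (hc : HasCompactSupport φ) : ∃ K, 0 ≤ K ∧ ∀ x y, ‖φ x - φ y‖ ≤ K * ‖x - y‖ := by
  obtain ⟨K, hK⟩ := hφ.lipschitzWith_of_hasCompactSupport hc (by simp)
  exact ⟨K, K.2, fun x y => by simpa [dist_eq_norm] using hK.dist_le_mul x y⟩

lemma IsWeakSolution.continuousOn_integral {T ε : ℝ} {b : ℝ → Eucl d → P2 d → Eucl d} {μ₀ : P2 d}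
    {ρ : ℝ → P2 d} (h : IsWeakSolution T ε b μ₀ ρ) {φ : Eucl d → ℝ} (hφ : ContDiff ℝ ∞ φ)
    (hc : HasCompactSupport φ) : ContinuousOn (fun s => ∫ x, φ x ∂(ρ s).meas) (Icc 0 T) := by
  obtain ⟨K, hK, hL⟩ := exists_lipschitz_of_compactSupport hφ hc
  exact fun s hs => (QuadLip.of_lipschitz hK hL).tendsto_integral hK h.continuous hs

lemma deriv_mul_bounds {g ζ : ℝ → ℝ} (hg : ContDiff ℝ ∞ g) (hζ : ContDiff ℝ ∞ ζ) {a c s : ℝ}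
    (hs : 0 ≤ s) (ha : 0 ≤ a) (hc : 0 ≤ c) (hg0 : 0 ≤ g s) (hζ01 : 0 ≤ ζ s ∧ ζ s ≤ 1)
    (hg1 : (1 + s) * |deriv g s| ≤ a * g s) (hg2 : (1 + s) ^ 2 * |deriv (deriv g) s| ≤ a * g s)
    (hζ1 : (1 + s) * |deriv ζ s| ≤ c) (hζ2 : (1 + s) ^ 2 * |deriv (deriv ζ) s| ≤ c) :
    (1 + s) * |deriv (fun s => g s * ζ s) s| ≤ (a + c + 2 * a * c) * g s ∧
    (1 + s) ^ 2 * |deriv (deriv (fun s => g s * ζ s)) s| ≤ (a + c + 2 * a * c) * g s := by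
  have hg' : ContDiff ℝ ∞ (deriv g) := (contDiff_infty_iff_deriv.1 hg).2
  have hζ' : ContDiff ℝ ∞ (deriv ζ) := (contDiff_infty_iff_deriv.1 hζ).2
  have Dg := hg.differentiable (by simp)
  have Dζ := hζ.differentiable (by simp)
  have Dg' := hg'.differentiable (by simp)
  have Dζ' := hζ'.differentiable (by simp)
  have e1 : deriv (fun s => g s * ζ s) = fun s => deriv g s * ζ s + g s * deriv ζ s := by
    funext s; exact deriv_fun_mul (Dg s) (Dζ s)
  have e2 : deriv (deriv (fun s => g s * ζ s)) s =
      (deriv (deriv g) s * ζ s + deriv g s * deriv ζ s) +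
        (deriv g s * deriv ζ s + g s * deriv (deriv ζ) s) := by
    rw [e1]
    exact ((Dg' s).hasDerivAt.mul (Dζ s).hasDerivAt |>.add
      ((Dg s).hasDerivAt.mul (Dζ' s).hasDerivAt)).deriv
  have h1s : 0 < 1 + s := by linarith
  have A1 : (1 + s) * |deriv g s * ζ s| ≤ a * g s := by
    rw [abs_mul, abs_of_nonneg hζ01.1]
    calc _ ≤ (1 + s) * (|deriv g s| * 1) := by gcongr; exact hζ01.2
      _ ≤ _ := by simpa using hg1
  have A2 : (1 + s) * |g s * deriv ζ s| ≤ c * g s := by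
    rw [abs_mul, abs_of_nonneg hg0]
    calc _ = g s * ((1 + s) * |deriv ζ s|) := by ring
      _ ≤ g s * c := by gcongr
      _ = _ := by ring
  have B1 : (1 + s) ^ 2 * |deriv (deriv g) s * ζ s| ≤ a * g s := by
    rw [abs_mul, abs_of_nonneg hζ01.1]
    calc _ ≤ (1 + s) ^ 2 * (|deriv (deriv g) s| * 1) := by gcongr; exact hζ01.2
      _ ≤ _ := by simpa using hg2
  have B2 : (1 + s) ^ 2 * |g s * deriv (deriv ζ) s| ≤ c * g s := by
    rw [abs_mul, abs_of_nonneg hg0]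
    calc _ = g s * ((1 + s) ^ 2 * |deriv (deriv ζ) s|) := by ring
      _ ≤ g s * c := by gcongr
      _ = _ := by ring
  have B3 : (1 + s) ^ 2 * |deriv g s * deriv ζ s| ≤ a * c * g s := by
    rw [abs_mul]
    calc _ = ((1 + s) * |deriv g s|) * ((1 + s) * |deriv ζ s|) := by ring
      _ ≤ (a * g s) * c := by gcongr
      _ = _ := by ring
  have hac : 0 ≤ a * c * g s := by positivity
  constructor
  · rw [e1]
    calc _ ≤ (1 + s) * (|deriv g s * ζ s| + |g s * deriv ζ s|) := by gcongr; exact abs_add_le _ _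
      _ ≤ _ := by linarith
  · rw [e2]
    calc _ ≤ (1 + s) ^ 2 * ((|deriv (deriv g) s * ζ s| + |deriv g s * deriv ζ s|) +
          (|deriv g s * deriv ζ s| + |g s * deriv (deriv ζ) s|)) := by
            gcongr
            exact (abs_add_le _ _).trans (add_le_add (abs_add_le _ _) (abs_add_le _ _))
      _ ≤ _ := by linarith

/-- Propagation of the moment `∫ g(|x|²) dρ_t` along a weak solution, uniformly in the viscosity. -/
lemma exists_moment_growth (d : ℕ) {a : ℝ} (ha : 0 ≤ a) : ∃ A, 0 ≤ A ∧
    ∀ {T ε H : ℝ} {b : ℝ → Eucl d → P2 d → Eucl d} {μ₀ : P2 d} {ρ : ℝ → P2 d} {g : ℝ → ℝ},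
    0 ≤ ε → ε ≤ 1 → 0 ≤ H → IsWeakSolution T ε b μ₀ ρ → ContDiff ℝ ∞ g → (∀ s, 0 ≤ s → 0 ≤ g s) →
    (∀ s, 0 ≤ s → (1 + s) * |deriv g s| ≤ a * g s) →
    (∀ s, 0 ≤ s → (1 + s) ^ 2 * |deriv (deriv g) s| ≤ a * g s) →
    (∀ t ∈ Icc 0 T, Integrable (fun x => g (‖x‖ ^ 2)) (ρ t).meas) →
    (∃ M, ∀ t ∈ Icc 0 T, ∫ x, g (‖x‖ ^ 2) ∂(ρ t).meas ≤ M) →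
    (∀ t ∈ Ioo 0 T, ∃ h : Eucl d → ℝ, Integrable h (ρ t).meas ∧
      (∀ x, ‖b t x (ρ t)‖ * (‖x‖ / (1 + ‖x‖ ^ 2) * g (‖x‖ ^ 2)) ≤ h x) ∧
      ∫ x, h x ∂(ρ t).meas ≤ H * ∫ x, g (‖x‖ ^ 2) ∂(ρ t).meas) →
    ∀ t ∈ Icc 0 T, ∫ x, g (‖x‖ ^ 2) ∂(ρ t).meas ≤
      2 * Real.exp (A * (H + 1) * T) * ∫ x, g (‖x‖ ^ 2) ∂μ₀.meas := by
  obtain ⟨c, hc, ζ, hζ⟩ := exists_cutoff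
  set A₁ := a + c + 2 * a * c with hA₁
  have hA₁0 : 0 ≤ A₁ := by positivity
  refine ⟨2 * (2 * A₁ + 6 * d * A₁ + 1), by positivity, ?_⟩
  intro T ε H b μ₀ ρ g hε0 hε1 hH hρ hg hg0 hg1 hg2 h_integrable hbdd hh
  set Λ := (2 * A₁ + 6 * d * A₁ + 1) * (H + 1) with hΛ
  have hΛ0 : 0 < Λ := by positivity
  set I : ℝ → ℝ := fun t => ∫ x, g (‖x‖ ^ 2) ∂(ρ t).meas with hI
  have hI0 : ∀ t, 0 ≤ I t := fun t => integral_nonneg fun x => hg0 _ (by positivity)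
  let φ : ℕ → Eucl d → ℝ := fun m x => (fun s => g s * ζ m s) (‖x‖ ^ 2)
  have hGs : ∀ m, ContDiff ℝ ∞ (fun s => g s * ζ m s) := fun m => hg.mul (hζ m).1
  have hφs : ∀ m, ContDiff ℝ ∞ (φ m) := fun m => contDiff_radial (hGs m)
  have hφc : ∀ m, HasCompactSupport (φ m) := by
    intro m
    refine HasCompactSupport.intro (isCompact_closedBall (0 : Eucl d) (2 * ((m : ℝ) + 1) + 1))
      fun x hx => ?_
    have hx' : 2 * ((m : ℝ) + 1) + 1 < ‖x‖ := by simpa using hx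
    have : 2 * ((m : ℝ) + 1) < ‖x‖ ^ 2 := by nlinarith [Nat.cast_nonneg (α := ℝ) m]
    simp only [φ]
    rw [(hζ m).2.1 _ this, mul_zero]
  have hφle : ∀ m x, φ m x ≤ g (‖x‖ ^ 2) ∧ 0 ≤ φ m x := fun m x => by
    have h := (hζ m).2.2.1 (‖x‖ ^ 2)
    have h0 := hg0 (‖x‖ ^ 2) (by positivity)
    exact ⟨mul_le_of_le_one_right h0 h.2, mul_nonneg h0 h.1⟩
  -- The weights 1+s and (1+s)² on the derivatives of g ζ_m turn the gradient into |x|/(1+|x|²)·g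
  -- and the Laplacian into a multiple of g, with constants free of m; ε ≤ 1 removes the viscosity.
  have hpt : ∀ m, ∀ t ∈ Ioo 0 T, ∀ x, ‖inner ℝ (b t x (ρ t)) (∇ (φ m) x) + ε * Δ (φ m) x‖ ≤
      2 * A₁ * (‖b t x (ρ t)‖ * (‖x‖ / (1 + ‖x‖ ^ 2) * g (‖x‖ ^ 2))) +
        6 * d * A₁ * g (‖x‖ ^ 2) := by
    intro m t ht x
    have hs : (0 : ℝ) ≤ ‖x‖ ^ 2 := by positivity
    have h1s : (0 : ℝ) < 1 + ‖x‖ ^ 2 := by positivity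
    obtain ⟨b1, b2⟩ := deriv_mul_bounds hg (hζ m).1 hs ha hc (hg0 _ hs) ((hζ m).2.2.1 _)
      (hg1 _ hs) (hg2 _ hs) ((hζ m).2.2.2.2.1 _ hs) ((hζ m).2.2.2.2.2 _ hs)
    have hgx := hg0 _ hs
    have hgrad : ‖∇ (φ m) x‖ ≤ 2 * A₁ * (‖x‖ / (1 + ‖x‖ ^ 2) * g (‖x‖ ^ 2)) := by
      rw [norm_gradient_eq, norm_fderiv_radial (hGs m)]
      have : |deriv (fun s => g s * ζ m s) (‖x‖ ^ 2)| ≤ A₁ * g (‖x‖ ^ 2) / (1 + ‖x‖ ^ 2) := by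
        rw [le_div_iff₀ h1s]; linarith
      calc _ ≤ 2 * (A₁ * g (‖x‖ ^ 2) / (1 + ‖x‖ ^ 2)) * ‖x‖ := by gcongr
        _ = _ := by ring
    have hlap : |Δ (φ m) x| ≤ 6 * d * A₁ * g (‖x‖ ^ 2) := by
      refine (abs_laplacian_le (φ m) x).trans ?_
      have h6 : ‖fderiv ℝ (fderiv ℝ (φ m)) x‖ ≤ 6 * (A₁ * g (‖x‖ ^ 2)) := by
        refine (norm_fderiv_fderiv_radial_le (hGs m) x).trans ?_
        set p := |deriv (deriv (fun s => g s * ζ m s)) (‖x‖ ^ 2)|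
        set q := |deriv (fun s => g s * ζ m s) (‖x‖ ^ 2)|
        have hp : 0 ≤ p := abs_nonneg _
        have hq : 0 ≤ q := abs_nonneg _
        have c1 : p * ‖x‖ ^ 2 ≤ (1 + ‖x‖ ^ 2) ^ 2 * p := by
          nlinarith [mul_nonneg hp hs, mul_nonneg hp (mul_nonneg hs hs)]
        have c2 : q ≤ (1 + ‖x‖ ^ 2) * q := by nlinarith [mul_nonneg hq hs]
        linarith
      calc _ ≤ d * (6 * (A₁ * g (‖x‖ ^ 2))) := by gcongr
        _ = _ := by ring
    refine (norm_add_le _ _).trans (add_le_add ?_ ?_)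
    · refine (norm_inner_le_norm _ _).trans ?_
      calc _ ≤ ‖b t x (ρ t)‖ * (2 * A₁ * (‖x‖ / (1 + ‖x‖ ^ 2) * g (‖x‖ ^ 2))) := by gcongr
        _ = _ := by ring
    · rw [norm_mul, Real.norm_of_nonneg hε0, Real.norm_eq_abs]
      calc _ ≤ 1 * |Δ (φ m) x| := by gcongr
        _ ≤ _ := by simpa using hlap
  have hD : ∀ m, ∀ t ∈ Ioo 0 T,
      ‖∫ x, (inner ℝ (b t x (ρ t)) (∇ (φ m) x) + ε * Δ (φ m) x) ∂(ρ t).meas‖ ≤ Λ * I t := by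
    intro m t ht
    obtain ⟨h, hhi, hhx, hhI⟩ := hh t ht
    have hti := h_integrable t (Ioo_subset_Icc_self ht)
    refine (norm_integral_le_of_norm_le (g := fun x => 2 * A₁ * h x + 6 * d * A₁ * g (‖x‖ ^ 2))
      ((hhi.const_mul _).add (hti.const_mul _))
      (.of_forall fun x => (hpt m t ht x).trans ?_)).trans ?_
    · have := hhx x
      gcongr
    · rw [integral_add (hhi.const_mul _) (hti.const_mul _), integral_const_mul, integral_const_mul]
      have hIt := hI0 t
      calc _ ≤ 2 * A₁ * (H * I t) + 6 * d * A₁ * I t := by gcongr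
        _ ≤ Λ * I t := by
          rw [hΛ]
          have : 2 * A₁ * H + 6 * d * A₁ ≤ (2 * A₁ + 6 * d * A₁ + 1) * (H + 1) := by
            have : 0 ≤ d * A₁ * H := by positivity
            nlinarith
          nlinarith
  -- With this rate the integral of Λ B e^{lr} over [0,s] is at most (B/2)e^{ls}, which yields the
  -- factor 1/2 of the self-improvement.
  set l := 2 * Λ with hl
  have hl0 : 0 < l := by positivity
  intro t ht
  have key := le_two_mul_of_self_improving (ι := Icc 0 T)
    (f := fun t => Real.exp (-(l * t)) * I t) (q := I 0) ?_ (hI0 0) ?_ ⟨t, ht⟩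
  · simp only at key
    rw [Real.exp_neg, inv_mul_le_iff₀ (Real.exp_pos _)] at key
    have hT : 0 ≤ T := ht.1.trans ht.2
    have hIz : I 0 = ∫ x, g (‖x‖ ^ 2) ∂μ₀.meas := by simp only [hI, hρ.initial]
    rw [← hIz]
    refine key.trans ?_
    have he : Real.exp (l * t) ≤ Real.exp (2 * (2 * A₁ + 6 * d * A₁ + 1) * (H + 1) * T) := by
      apply Real.exp_le_exp.2
      have : 2 * (2 * A₁ + 6 * d * A₁ + 1) * (H + 1) * T = l * T := by rw [hl, hΛ]; ring
      rw [this]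
      exact mul_le_mul_of_nonneg_left ht.2 hl0.le
    have h0 := hI0 0
    nlinarith
  · obtain ⟨M, hM⟩ := hbdd
    refine ⟨M, fun s => ?_⟩
    have h1 := hM s s.2
    have h2 : Real.exp (-(l * s)) ≤ 1 := Real.exp_le_one_iff.2 (by
      have := s.2.1; nlinarith)
    exact (mul_le_of_le_one_left (hI0 _) h2).trans h1
  · intro B hB hBs s
    have hT : 0 ≤ T := s.2.1.trans s.2.2
    have hBr : ∀ r ∈ Icc 0 T, I r ≤ B * Real.exp (l * r) := by
      intro r hr
      have := hBs ⟨r, hr⟩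
      simp only at this
      rw [Real.exp_neg, inv_mul_le_iff₀ (Real.exp_pos _)] at this
      linarith
    have hm : ∀ m, ∫ x, φ m x ∂(ρ s).meas ≤ I 0 + B / 2 * Real.exp (l * s) := by
      intro m
      have h := norm_image_sub_le_of_interior (hρ.continuousOn_integral (hφs m) (hφc m))
        (hρ.equation (φ m) (hφs m) (hφc m)) (B := fun r => B / 2 * Real.exp (l * r))
        (B' := fun r => Λ * (B * Real.exp (l * r))) (fun r => by
          have h : HasDerivAt (fun r => B / 2 * Real.exp (l * r))
              (B / 2 * (Real.exp (l * r) * l)) r := by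
            simpa using (((hasDerivAt_id r).const_mul l).exp).const_mul (B / 2)
          convert h using 1
          rw [hl]; ring)
        (fun r hr => (hD m r hr).trans (mul_le_mul_of_nonneg_left
          (hBr r (Ioo_subset_Icc_self hr)) hΛ0.le)) s s.2
      have h0 : ∫ x, φ m x ∂(ρ 0).meas ≤ I 0 :=
        integral_mono_of_nonneg (.of_forall fun x => (hφle m x).2)
          (h_integrable 0 (left_mem_Icc.2 hT)) (.of_forall fun x => (hφle m x).1)
      have h1 := (le_abs_self _).trans h
      simp only [mul_zero, Real.exp_zero, mul_one] at h1
      linarith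
    -- The bounds are uniform in m, so the cutoff is removed by dominated convergence at each fixed
    -- time.
    have hlim : Tendsto (fun m => ∫ x, φ m x ∂(ρ s).meas) atTop (𝓝 (I s)) := by
      refine tendsto_integral_of_dominated_convergence (fun x => g (‖x‖ ^ 2))
        (fun m => (hφs m).continuous.aestronglyMeasurable) (h_integrable s s.2)
        (fun m => .of_forall fun x => ?_) (.of_forall fun x => ?_)
      · rw [Real.norm_of_nonneg (hφle m x).2]; exact (hφle m x).1
      · refine tendsto_const_nhds.congr' ?_
        obtain ⟨N, hN⟩ := exists_nat_ge (‖x‖ ^ 2)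
        filter_upwards [eventually_ge_atTop N] with m hm
        simp only [φ]
        rw [(hζ m).2.2.2.1 _ (by positivity) (hN.trans (by exact_mod_cast hm)), mul_one]
    have hfin := le_of_tendsto' hlim hm
    rw [Real.exp_neg, inv_mul_le_iff₀ (Real.exp_pos _)]
    have : 1 ≤ Real.exp (l * s) := Real.one_le_exp (by have := s.2.1; positivity)
    nlinarith [hI0 0]

/-- Uniform second and fourth moments of weak solutions with viscosity at most one. -/
lemma exists_uniform_moments {T C : ℝ} (hC : 0 ≤ C) {b : ℝ → Eucl d → P2 d → Eucl d}
    (hb : ∀ t ∈ Ioo 0 T, ∀ (x : Eucl d) (μ : P2 d),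
      ‖b t x μ‖ ≤ C * (1 + ‖x‖ + ∫ y, ‖y‖ ∂μ.meas))
    {μ₀ : P2 d} (hμ₀ : ∃ K : Set (Eucl d), IsCompact K ∧ μ₀.meas Kᶜ = 0) :
    ∃ M, 0 ≤ M ∧ ∀ ε, 0 ≤ ε → ε ≤ 1 → ∀ ρ, IsWeakSolution T ε b μ₀ ρ → ∀ t ∈ Icc 0 T,
      (ρ t).m2 ≤ M ∧ Integrable (fun x => ‖x‖ ^ 4) (ρ t).meas ∧
        ∫ x, ‖x‖ ^ 4 ∂(ρ t).meas ≤ M := by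
  obtain ⟨K, hK, hK0⟩ := hμ₀
  obtain ⟨R, hR⟩ := hK.isBounded.exists_norm_le
  have hae : ∀ᵐ x ∂μ₀.meas, ‖x‖ ≤ R := by
    refine measure_mono_null (fun x hx => ?_) hK0
    exact fun hxK => hx (hR x hxK)
  -- The weight 1+s needs only a = 1; the value 6 comes from the second derivative of the truncated
  -- weights used for the fourth moment.
  obtain ⟨A, hA, hmom⟩ := exists_moment_growth d (a := 6) (by norm_num)
  set M₂ := 2 * Real.exp (A * (3 * C + 1) * T) * ∫ x, (1 + ‖x‖ ^ 2) ∂μ₀.meas with hM₂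
  have hM₂0 : 0 ≤ M₂ := by
    have : 0 ≤ ∫ x, (1 + ‖x‖ ^ 2) ∂μ₀.meas := integral_nonneg fun x => by positivity
    positivity
  have second : ∀ ε, 0 ≤ ε → ε ≤ 1 → ∀ ρ, IsWeakSolution T ε b μ₀ ρ → ∀ t ∈ Icc 0 T,
      (ρ t).m2 ≤ M₂ := by
    intro ε hε0 hε1 ρ hρ t ht
    have hi : ∀ t, Integrable (fun x => 1 + ‖x‖ ^ 2) (ρ t).meas := fun t =>
      (integrable_const 1).add (ρ t).integrable_norm_sq
    have hI : ∀ t, ∫ x, (1 + ‖x‖ ^ 2) ∂(ρ t).meas = 1 + (ρ t).m2 := fun t => by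
      rw [integral_add (integrable_const 1) (ρ t).integrable_norm_sq]; simp [P2.m2]
    have d1 : deriv (fun s : ℝ => 1 + s) = fun _ => 1 := by
      funext s; simp
    have h := hmom (g := fun s => 1 + s) (H := 3 * C) hε0 hε1 (by positivity) hρ
      (contDiff_const.add contDiff_id) (fun s hs => by positivity)
      (fun s hs => by rw [d1]; simp; linarith) (fun s hs => by rw [d1]; simp; positivity)
      (fun t _ => hi t) ?_ ?_ t ht
    · rw [hI] at h
      linarith
    · obtain ⟨M, hM⟩ := exists_m2_le hρ.continuous
      exact ⟨1 + M, fun t ht => by rw [hI]; linarith [hM t ht]⟩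
    · intro t ht
      set m := ∫ y, ‖y‖ ∂(ρ t).meas with hm
      have i1 := (ρ t).integrable_norm
      have i2 := (ρ t).integrable_norm_sq
      have i3 : Integrable (fun x : Eucl d => (1 + m) * ‖x‖ + ‖x‖ ^ 2) (ρ t).meas :=
        (i1.const_mul _).add i2
      refine ⟨fun x => C * ((1 + m) * ‖x‖ + ‖x‖ ^ 2), i3.const_mul C, fun x => ?_, ?_⟩
      · rw [div_mul_cancel₀ _ (by positivity : (1 : ℝ) + ‖x‖ ^ 2 ≠ 0)]
        calc _ ≤ C * (1 + ‖x‖ + m) * ‖x‖ := by gcongr; exact hb t ht x (ρ t)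
          _ = _ := by ring
      · rw [integral_const_mul, integral_add (i1.const_mul _) i2, integral_const_mul, hI, ← hm]
        have hsq : m ^ 2 ≤ (ρ t).m2 := (ρ t).sq_integral_norm_le
        -- The mean-field term of the growth bound contributes m = ∫|y|, and m² ≤ ∫|y|² lets the
        -- second moment absorb it; this is where H = 3C comes from.
        have : (1 + m) * m + ∫ x, ‖x‖ ^ 2 ∂(ρ t).meas ≤ 3 * (1 + (ρ t).m2) := by
          have h2 : ∫ x, ‖x‖ ^ 2 ∂(ρ t).meas = (ρ t).m2 := rfl
          rw [h2]
          nlinarith [sq_nonneg (m - 1)]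
        calc _ ≤ C * (3 * (1 + (ρ t).m2)) := by gcongr
          _ = _ := by ring
  set H := 2 * C * (2 + M₂) with hH
  have hH0 : 0 ≤ H := by positivity
  set M₄ := 2 * Real.exp (A * (H + 1) * T) * (1 + R ^ 2) ^ 2 with hM₄
  refine ⟨max M₂ M₄, le_max_of_le_left hM₂0, fun ε hε0 hε1 ρ hρ t ht =>
    ⟨(second ε hε0 hε1 ρ hρ t ht).trans (le_max_left _ _), ?_⟩⟩
  -- The fourth moment is not known to be finite, so (1+s)² is replaced by a smooth truncation below
  -- both (n+1)² and (1+s)². Its logarithmic derivative bounds do not depend on n.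
  let g : ℕ → ℝ → ℝ := fun n s => (n + 1) ^ 2 * (1 + s) ^ 2 / ((n + 1) ^ 2 + (1 + s) ^ 2)
  have hden : ∀ (n : ℕ) (s : ℝ), 0 < ((n : ℝ) + 1) ^ 2 + (1 + s) ^ 2 := fun n s => by positivity
  have hgc : ∀ n, ContDiff ℝ ∞ (g n) := fun n => by
    refine ContDiff.div (by fun_prop) (by fun_prop) fun s => (hden n s).ne'
  have hg0 : ∀ n s, 0 ≤ g n s := fun n s => by positivity
  have hgle : ∀ n s, g n s ≤ (1 + s) ^ 2 ∧ g n s ≤ ((n : ℝ) + 1) ^ 2 := fun n s => by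
    constructor
    · rw [div_le_iff₀ (hden n s)]
      nlinarith [sq_nonneg ((1 + s) ^ 2)]
    · rw [div_le_iff₀ (hden n s)]
      nlinarith [sq_nonneg (((n : ℝ) + 1) ^ 2)]
  have e1 : ∀ n, deriv (g n) =
      fun s => 2 * ((n : ℝ) + 1) ^ 4 * (1 + s) / (((n : ℝ) + 1) ^ 2 + (1 + s) ^ 2) ^ 2 := by
    intro n; funext s
    have a0 : HasDerivAt (fun s : ℝ => (1 + s) ^ 2) (2 * (1 + s)) s := by
      simpa using ((hasDerivAt_id s).const_add 1).fun_pow 2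
    have a1 := (a0.const_mul (((n : ℝ) + 1) ^ 2)).div (a0.const_add (((n : ℝ) + 1) ^ 2))
      (hden n s).ne'
    refine Eq.trans a1.deriv ?_
    have := (hden n s).ne'
    field_simp
    ring
  have e2 : ∀ n, deriv (deriv (g n)) = fun s => 2 * ((n : ℝ) + 1) ^ 4 *
      (((n : ℝ) + 1) ^ 2 - 3 * (1 + s) ^ 2) / (((n : ℝ) + 1) ^ 2 + (1 + s) ^ 2) ^ 3 := by
    intro n; rw [e1]; funext s
    have a0 : HasDerivAt (fun s : ℝ => (1 + s) ^ 2) (2 * (1 + s)) s := by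
      simpa using ((hasDerivAt_id s).const_add 1).fun_pow 2
    have a1 := (((hasDerivAt_id s).const_add 1).const_mul (2 * ((n : ℝ) + 1) ^ 4)).div
      ((a0.const_add (((n : ℝ) + 1) ^ 2)).pow 2) (pow_ne_zero 2 (hden n s).ne')
    refine Eq.trans a1.deriv ?_
    have := (hden n s).ne'
    simp
    field_simp
    ring
  have hbound : ∀ n, ∫ x, g n (‖x‖ ^ 2) ∂(ρ t).meas ≤ M₄ := by
    intro n
    have hi : ∀ r, Integrable (fun x => g n (‖x‖ ^ 2)) (ρ r).meas := fun r =>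
      (integrable_const (((n : ℝ) + 1) ^ 2)).mono'
        (contDiff_radial (hgc n)).continuous.aestronglyMeasurable
        (.of_forall fun x => by rw [Real.norm_of_nonneg (hg0 _ _)]; exact (hgle n _).2)
    refine (hmom (g := g n) (H := H) hε0 hε1 hH0 hρ (hgc n) (fun s _ => hg0 n s)
      (fun s hs => ?_) (fun s hs => ?_) (fun r _ => hi r) ?_ ?_ t ht).trans ?_
    · rw [e1, abs_of_nonneg (by positivity)]
      simp only [g]
      rw [← mul_div_assoc, ← mul_div_assoc, div_le_div_iff₀ (by positivity) (hden n s)]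
      have : 0 ≤ ((n : ℝ) + 1) ^ 2 * (1 + s) ^ 2 * (((n : ℝ) + 1) ^ 2 + (1 + s) ^ 2) *
        (4 * ((n : ℝ) + 1) ^ 2 + 6 * (1 + s) ^ 2) := by positivity
      nlinarith
    · rw [e2, abs_div, abs_of_pos (pow_pos (hden n s) 3), abs_mul,
        abs_of_nonneg (by positivity : 0 ≤ 2 * ((n : ℝ) + 1) ^ 4)]
      simp only [g]
      have habs : |((n : ℝ) + 1) ^ 2 - 3 * (1 + s) ^ 2| ≤
          3 * (((n : ℝ) + 1) ^ 2 + (1 + s) ^ 2) := by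
        rw [abs_le]; constructor <;> nlinarith [sq_nonneg ((n : ℝ) + 1), sq_nonneg (1 + s)]
      rw [← mul_div_assoc, ← mul_div_assoc, div_le_div_iff₀ (pow_pos (hden n s) 3) (hden n s)]
      set D := ((n : ℝ) + 1) ^ 2 + (1 + s) ^ 2 with hD
      have hD0 : 0 < D := hden n s
      have hnD : ((n : ℝ) + 1) ^ 2 ≤ D := by rw [hD]; nlinarith [sq_nonneg (1 + s)]
      calc (1 + s) ^ 2 * (2 * ((n : ℝ) + 1) ^ 4 * |((n : ℝ) + 1) ^ 2 - 3 * (1 + s) ^ 2|) * D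
          ≤ (1 + s) ^ 2 * (2 * ((n : ℝ) + 1) ^ 4 * (3 * D)) * D := by gcongr
        _ = 6 * (((n : ℝ) + 1) ^ 2 * (1 + s) ^ 2) * D ^ 2 * ((n : ℝ) + 1) ^ 2 := by ring
        _ ≤ 6 * (((n : ℝ) + 1) ^ 2 * (1 + s) ^ 2) * D ^ 2 * D := by gcongr
        _ = _ := by ring
    · exact ⟨((n : ℝ) + 1) ^ 2, fun r _ => by
        refine (integral_mono (hi r) (integrable_const _) fun x => (hgle n _).2).trans ?_
        simp⟩
    · intro r hr
      refine ⟨fun x => H * g n (‖x‖ ^ 2), (hi r).const_mul H, fun x => ?_, ?_⟩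
      · have hm : ∫ y, ‖y‖ ∂(ρ r).meas ≤ 1 + M₂ := by
          have h1 := (ρ r).sq_integral_norm_le
          have h2 := second ε hε0 hε1 ρ hρ r (Ioo_subset_Icc_self hr)
          have h2' : ∫ x, ‖x‖ ^ 2 ∂(ρ r).meas = (ρ r).m2 := rfl
          nlinarith [sq_nonneg (∫ y, ‖y‖ ∂(ρ r).meas - 1)]
        rw [← mul_assoc]
        refine mul_le_mul_of_nonneg_right ?_ (hg0 _ _)
        have hbr := hb r hr x (ρ r)
        rw [← mul_div_assoc, div_le_iff₀ (by positivity)]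
        calc ‖b r x (ρ r)‖ * ‖x‖ ≤ C * (1 + ‖x‖ + (1 + M₂)) * ‖x‖ := by
              gcongr; exact hbr.trans (by gcongr)
          _ ≤ H * (1 + ‖x‖ ^ 2) := by
            rw [hH]
            have : (1 + ‖x‖ + (1 + M₂)) * ‖x‖ ≤ 2 * (2 + M₂) * (1 + ‖x‖ ^ 2) := by
              nlinarith [sq_nonneg (‖x‖ - 1), mul_nonneg hM₂0 (sq_nonneg (‖x‖ - 1)),
                mul_nonneg hM₂0 (sq_nonneg ‖x‖), sq_nonneg ‖x‖]
            nlinarith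
      · rw [integral_const_mul]
    · rw [hM₄]
      gcongr
      have : ∫ x, g n (‖x‖ ^ 2) ∂μ₀.meas ≤ ∫ _, (1 + R ^ 2) ^ 2 ∂μ₀.meas := by
        refine integral_mono_of_nonneg (.of_forall fun x => hg0 _ _) (integrable_const _) ?_
        filter_upwards [hae] with x hx
        refine (hgle n _).1.trans ?_
        gcongr
      simpa using this
  have hlim : ∀ s : ℝ, Tendsto (fun n => g n s) atTop (𝓝 ((1 + s) ^ 2)) := by
    intro s
    have h1 : Tendsto (fun n : ℕ => (1 + s) ^ 2 / ((n : ℝ) + 1) ^ 2) atTop (𝓝 0) :=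
      Tendsto.div_atTop tendsto_const_nhds
        ((tendsto_pow_atTop two_ne_zero).comp
          (tendsto_natCast_atTop_atTop.atTop_add tendsto_const_nhds))
    have h2 := (tendsto_const_nhds (x := (1 + s) ^ 2)).div (h1.const_add 1) (by norm_num)
    simp only [add_zero, div_one] at h2
    refine h2.congr fun n => ?_
    simp only [g, Pi.div_apply]
    have : ((n : ℝ) + 1) ≠ 0 := by positivity
    have := (hden n s).ne'
    field_simp
  -- The truncations converge pointwise to (1+s)² as n → ∞, so Fatou gives finiteness and the bound
  -- together.
  have hfatou : ∫⁻ x, ENNReal.ofReal ((1 + ‖x‖ ^ 2) ^ 2) ∂(ρ t).meas ≤ ENNReal.ofReal M₄ := by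
    have h1 : ∀ x : Eucl d, ENNReal.ofReal ((1 + ‖x‖ ^ 2) ^ 2) =
        liminf (fun n => ENNReal.ofReal (g n (‖x‖ ^ 2))) atTop := fun x =>
      ((ENNReal.tendsto_ofReal (hlim (‖x‖ ^ 2))).liminf_eq).symm
    simp_rw [h1]
    refine (lintegral_liminf_le fun n =>
      ((contDiff_radial (hgc n)).continuous.measurable.ennreal_ofReal)).trans ?_
    refine liminf_le_of_le ?_ fun b hb => ?_
    · isBoundedDefault
    · obtain ⟨n, hn⟩ := hb.exists
      refine hn.trans ?_
      rw [← ofReal_integral_eq_lintegral_ofReal]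
      · exact ENNReal.ofReal_le_ofReal (hbound n)
      · exact (integrable_const (((n : ℝ) + 1) ^ 2)).mono'
          (contDiff_radial (hgc n)).continuous.aestronglyMeasurable
          (.of_forall fun x => by rw [Real.norm_of_nonneg (hg0 _ _)]; exact (hgle n _).2)
      · exact .of_forall fun x => hg0 _ _
  have hM₄0 : 0 ≤ M₄ := by positivity
  have h4 : ∫⁻ x, ENNReal.ofReal (‖x‖ ^ 4) ∂(ρ t).meas ≤ ENNReal.ofReal M₄ := by
    refine le_trans (lintegral_mono fun x => ENNReal.ofReal_le_ofReal ?_) hfatou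
    nlinarith [sq_nonneg ‖x‖]
  have h4i : Integrable (fun x => ‖x‖ ^ 4) (ρ t).meas := by
    refine ⟨by fun_prop, ?_⟩
    rw [hasFiniteIntegral_iff_ofReal (.of_forall fun x => by positivity)]
    exact h4.trans_lt ENNReal.ofReal_lt_top
  refine ⟨h4i, le_trans ?_ (le_max_right _ _)⟩
  rw [← ofReal_integral_eq_lintegral_ofReal h4i (.of_forall fun x => by positivity)] at h4
  exact (ENNReal.ofReal_le_ofReal_iff hM₄0).1 h4

end Moments

/-! ### A right-slope criterion and estimates for mollified Lipschitz functions. -/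

section Mollification

variable {d : ℕ}

/-- Used for s ↦ ∫ψ_s dρ_s, where both the function and the measure move and no derivative is
available; bounded right slopes of a continuous function suffice. -/
lemma abs_sub_le_of_right_slope {A : ℝ → ℝ} {a b c : ℝ} (hab : a ≤ b)
    (hA : ContinuousOn A (Icc a b))
    (h : ∀ t ∈ Ioo a b, ∀ κ > 0, ∀ᶠ z in 𝓝[>] t, |A z - A t| ≤ (c + κ) * (z - t)) :
    |A b - A a| ≤ c * (b - a) := by
  rcases hab.eq_or_lt with rfl | hab
  · simp
  have key : ∀ a' ∈ Ioo a b, |A b - A a'| ≤ c * (b - a') := by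
    intro a' ha'
    refine image_le_of_liminf_slope_right_le_deriv_boundary (a := a') (b := b)
      (f := fun s => |A s - A a'|) (B := fun s => c * (s - a')) (B' := fun _ => c)
      ((hA.mono (Icc_subset_Icc_left ha'.1.le)).sub continuousOn_const).abs (by simp)
      (by fun_prop) (fun x _ => ?_) (fun x hx r hr => ?_) (right_mem_Icc.2 ha'.2.le)
    · simpa using (((hasDerivAt_id x).sub_const a').const_mul c).hasDerivWithinAt
    · have hx' : x ∈ Ioo a b := ⟨ha'.1.trans_le hx.1, hx.2⟩
      refine Eventually.frequently ?_
      filter_upwards [h x hx' ((r - c) / 2) (by linarith), self_mem_nhdsWithin] with z hz hxz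
      have hzx : 0 < z - x := sub_pos.2 hxz
      rw [slope_def_field, div_lt_iff₀ hzx]
      have h1 : |A z - A a'| - |A x - A a'| ≤ |A z - A x| := by
        have := abs_sub_abs_le_abs_sub (A z - A a') (A x - A a')
        simpa using this
      nlinarith
  have hne : (𝓝[Ioo a b] a).NeBot := by
    rw [← mem_closure_iff_nhdsWithin_neBot, closure_Ioo hab.ne]; exact left_mem_Icc.2 hab.le
  have hAa : Tendsto A (𝓝[Ioo a b] a) (𝓝 (A a)) :=
    (hA a (left_mem_Icc.2 hab.le)).mono Ioo_subset_Icc_self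
  have hE : Tendsto (fun a' => c * (b - a')) (𝓝[Ioo a b] a) (𝓝 (c * (b - a))) :=
    (Continuous.tendsto (by fun_prop) a).mono_left nhdsWithin_le_nhds
  exact le_of_tendsto_of_tendsto (tendsto_const_nhds.sub hAa).abs hE
    (eventually_nhdsWithin_of_forall key)

/-- Mollification of `w` by a normalized bump function. -/
def mollify (η : ContDiffBump (0 : Eucl d)) (w : Eucl d → ℝ) (x : Eucl d) : ℝ :=
  ∫ z, η.normed volume z * w (x - z)

variable {η : ContDiffBump (0 : Eucl d)} {w : Eucl d → ℝ} {K : ℝ}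

lemma mollify_eq_convolution (η : ContDiffBump (0 : Eucl d)) (w : Eucl d → ℝ) :
    mollify η w = MeasureTheory.convolution (η.normed volume) w
      (ContinuousLinearMap.lsmul ℝ ℝ) volume := by
  funext x; rfl

lemma contDiff_mollify (hw : Continuous w) : ContDiff ℝ ∞ (mollify η w) := by
  rw [mollify_eq_convolution]
  exact η.hasCompactSupport_normed.contDiff_convolution_left _ η.contDiff_normed
    hw.locallyIntegrable

lemma hasCompactSupport_mollify (hw : HasCompactSupport w) :
    HasCompactSupport (mollify η w) := by
  rw [mollify_eq_convolution]
  exact η.hasCompactSupport_normed.convolution _ hw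

lemma integrable_bump_mul {f : Eucl d → ℝ} (hf : Continuous f) :
    Integrable (fun z => η.normed volume z * f z) :=
  (η.continuous_normed.mul hf).integrable_of_hasCompactSupport
    (η.hasCompactSupport_normed.mul_right)

/-- The normalized bump is a probability density carried by the ball of radius `η.rOut`. -/
lemma abs_integral_bump_mul_le {f : Eucl d → ℝ} {B : ℝ} (hB : ∀ z, ‖z‖ ≤ η.rOut → |f z| ≤ B) :
    |∫ z, η.normed volume z * f z| ≤ B := by
  have h1 : ∀ z, ‖η.normed volume z * f z‖ ≤ η.normed volume z * B := by
    intro z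
    rw [norm_mul, Real.norm_of_nonneg (η.nonneg_normed z)]
    by_cases hz : ‖z‖ ≤ η.rOut
    · exact mul_le_mul_of_nonneg_left (hB z hz) (η.nonneg_normed z)
    · have : η.normed volume z = 0 := by
        have h := η.support_normed_eq (μ := volume)
        by_contra h0
        have hz' : z ∈ Function.support (η.normed volume) := h0
        rw [h] at hz'
        exact hz (by simpa using (mem_ball_zero_iff.1 hz').le)
      simp [this]
  refine (norm_integral_le_of_norm_le (η.integrable_normed.mul_const B)
    (.of_forall h1)).trans (le_of_eq ?_)
  rw [integral_mul_const, η.integral_normed, one_mul]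

lemma mollify_sub_mollify {w' : Eucl d → ℝ} (hw : Continuous w) (hw' : Continuous w')
    (x y : Eucl d) : mollify η w x - mollify η w' y =
      ∫ z, η.normed volume z * (w (x - z) - w' (y - z)) := by
  unfold mollify
  rw [← integral_sub (integrable_bump_mul (f := fun z => w (x - z)) (by fun_prop))
    (integrable_bump_mul (f := fun z => w' (y - z)) (by fun_prop))]
  simp_rw [mul_sub]

lemma abs_mollify_sub_mollify_le {w' : Eucl d → ℝ} (hw : Continuous w) (hw' : Continuous w')
    {x y : Eucl d} {B : ℝ} (hB : ∀ z, ‖z‖ ≤ η.rOut → |w (x - z) - w' (y - z)| ≤ B) :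
    |mollify η w x - mollify η w' y| ≤ B := by
  rw [mollify_sub_mollify hw hw']
  exact abs_integral_bump_mul_le hB

lemma continuous_of_lipschitz {F : Type*} [NormedAddCommGroup F] {f : Eucl d → F}
    (hf : ∀ x y, ‖f x - f y‖ ≤ K * ‖x - y‖) : Continuous f :=
  (LipschitzWith.of_dist_le_mul (K := K.toNNReal) fun x y => by
    rw [dist_eq_norm, dist_eq_norm]
    exact (hf x y).trans (mul_le_mul_of_nonneg_right (Real.le_coe_toNNReal K)
      (norm_nonneg _))).continuous

lemma abs_mollify_sub_le (hw : ∀ x y, |w x - w y| ≤ K * ‖x - y‖) (hK : 0 ≤ K) (x : Eucl d) :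
    |mollify η w x - w x| ≤ K * η.rOut := by
  have hc : Continuous w := continuous_of_lipschitz hw
  have : w x = ∫ z, η.normed volume z * w x := by
    rw [integral_mul_const, η.integral_normed, one_mul]
  have e : mollify η w x - w x = mollify η w x - ∫ z, η.normed volume z * w x := by rw [← this]
  rw [e]
  unfold mollify
  rw [← integral_sub (integrable_bump_mul (f := fun z => w (x - z)) (by fun_prop))
    (integrable_bump_mul continuous_const)]
  simp_rw [← mul_sub]
  refine abs_integral_bump_mul_le fun z hz => (hw _ _).trans ?_
  simp only [sub_sub_cancel_left, norm_neg]
  gcongr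

lemma mollify_lipschitz (hw : ∀ x y, |w x - w y| ≤ K * ‖x - y‖) (x y : Eucl d) :
    |mollify η w x - mollify η w y| ≤ K * ‖x - y‖ := by
  have hc : Continuous w := continuous_of_lipschitz hw
  refine abs_mollify_sub_mollify_le hc hc fun z _ => (hw _ _).trans (le_of_eq ?_)
  simp

/-- The constant that controls second derivatives of mollifications. -/
def bumpConst (η : ContDiffBump (0 : Eucl d)) : ℝ := ∫ z, ‖fderiv ℝ (η.normed volume) z‖

lemma bumpConst_nonneg (η : ContDiffBump (0 : Eucl d)) : 0 ≤ bumpConst η :=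
  integral_nonneg fun _ => norm_nonneg _

/-- The derivative falls on the bump, and the increment of w costs K‖x − y‖. Hence second
derivatives are bounded although w is merely Lipschitz, at a price depending on η. -/
lemma fderiv_mollify_lipschitz (hw : ∀ x y, |w x - w y| ≤ K * ‖x - y‖) (x y : Eucl d) :
    ‖fderiv ℝ (mollify η w) x - fderiv ℝ (mollify η w) y‖ ≤ bumpConst η * K * ‖x - y‖ := by
  have hc : Continuous w := continuous_of_lipschitz hw
  have hη : ContDiff ℝ 1 (η.normed volume) := η.contDiff_normed
  have hcont : Continuous (fderiv ℝ (η.normed volume)) := hη.continuous_fderiv one_ne_zero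
  have hcs : HasCompactSupport (fderiv ℝ (η.normed volume)) :=
    η.hasCompactSupport_normed.fderiv ℝ
  have hd : ∀ x, fderiv ℝ (mollify η w) x =
      ∫ z, (w (x - z)) • fderiv ℝ (η.normed volume) z := by
    intro x
    rw [mollify_eq_convolution, (η.hasCompactSupport_normed.hasFDerivAt_convolution_left
      (ContinuousLinearMap.lsmul ℝ ℝ) hη hc.locallyIntegrable x).fderiv]
    refine integral_congr_ae (.of_forall fun z => ?_)
    ext y
    simp [ContinuousLinearMap.precompL, mul_comm]
  have hi : ∀ x, Integrable (fun z => (w (x - z)) • fderiv ℝ (η.normed volume) z) := fun x =>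
    ((hc.comp (continuous_const.sub continuous_id)).smul hcont).integrable_of_hasCompactSupport hcs.smul_left
  rw [hd, hd, ← integral_sub (hi x) (hi y)]
  have hni : Integrable (fun z => ‖fderiv ℝ (η.normed volume) z‖) :=
    (hcont.integrable_of_hasCompactSupport hcs).norm
  refine (norm_integral_le_of_norm_le
    (g := fun z => ‖fderiv ℝ (η.normed volume) z‖ * (K * ‖x - y‖)) (hni.mul_const _)
    (.of_forall fun z => ?_)).trans (le_of_eq ?_)
  · rw [← sub_smul, norm_smul, mul_comm]
    gcongr
    simpa using hw (x - z) (y - z)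
  · rw [integral_mul_const, bumpConst, mul_assoc]

lemma norm_fderiv_mollify_le (hw : ∀ x y, |w x - w y| ≤ K * ‖x - y‖) (hK : 0 ≤ K) (x : Eucl d) :
    ‖fderiv ℝ (mollify η w) x‖ ≤ K := by
  have h := norm_fderiv_le_of_lipschitz ℝ (x₀ := x) (f := mollify η w) (C := K.toNNReal)
    (LipschitzWith.of_dist_le_mul fun x y => by
      rw [Real.dist_eq, dist_eq_norm, Real.coe_toNNReal _ hK]
      exact mollify_lipschitz hw x y)
  rwa [Real.coe_toNNReal _ hK] at h

lemma abs_laplacian_mollify_le (hw : ∀ x y, |w x - w y| ≤ K * ‖x - y‖) (hK : 0 ≤ K)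
    (x : Eucl d) : |Δ (mollify η w) x| ≤ d * (bumpConst η * K) := by
  refine (abs_laplacian_le _ x).trans (mul_le_mul_of_nonneg_left ?_ (Nat.cast_nonneg _))
  have hB : 0 ≤ bumpConst η * K := mul_nonneg (bumpConst_nonneg η) hK
  have h := norm_fderiv_le_of_lipschitz ℝ (x₀ := x) (f := fderiv ℝ (mollify η w))
    (C := (bumpConst η * K).toNNReal)
    (LipschitzWith.of_dist_le_mul fun x y => by
      rw [dist_eq_norm, dist_eq_norm, Real.coe_toNNReal _ hB]
      exact fderiv_mollify_lipschitz hw x y)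
  rwa [Real.coe_toNNReal _ hB] at h

lemma abs_mollify_taylor_le (hw : ∀ x y, |w x - w y| ≤ K * ‖x - y‖) (hK : 0 ≤ K)
    (x k : Eucl d) :
    |mollify η w (x + k) - mollify η w x - fderiv ℝ (mollify η w) x k| ≤
      bumpConst η * K * ‖k‖ ^ 2 := by
  have hc : Continuous w := continuous_of_lipschitz hw
  have hB : 0 ≤ bumpConst η * K := mul_nonneg (bumpConst_nonneg η) hK
  have h := (convex_closedBall x ‖k‖).norm_image_sub_le_of_norm_fderiv_le' (𝕜 := ℝ)
    (f := mollify η w) (φ := fderiv ℝ (mollify η w) x) (C := bumpConst η * K * ‖k‖)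
    (x := x) (y := x + k)
    (fun z _ => (contDiff_mollify hc).differentiable (by simp) z) (fun z hz => by
      refine (fderiv_mollify_lipschitz hw z x).trans ?_
      gcongr
      simpa [dist_eq_norm] using hz)
    (by simp) (by simp)
  simp only [add_sub_cancel_left, Real.norm_eq_abs] at h
  calc _ ≤ _ := h
    _ = _ := by ring

end Mollification

/-! ### Backward transport of test functions along the flow. -/

section Duality

variable {d : ℕ} {T L C : ℝ} {v : ℝ → Eucl d → Eucl d}

/-- On a ball of radius R, continuity in time at the points of a finite net extends by the Lipschitz
bound. Outside it, linear growth gives at most 4C|x| ≤ κ|x|², which is why the weight is quadratic.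
-/
lemma IsLipField.exists_time_modulus (hv : IsLipField T L C v) {t : ℝ} (ht : t ∈ Ioo 0 T) {κ : ℝ}
    (hκ : 0 < κ) : ∀ᶠ s in 𝓝 t, s ∈ Ioo 0 T ∧ ∀ x, ‖v s x - v t x‖ ≤ κ * (1 + ‖x‖ ^ 2) := by
  have hL := hv.L_nonneg
  have hC := hv.C_nonneg
  set R := max 1 (4 * C / κ) with hR
  have hR1 : 1 ≤ R := le_max_left _ _
  have hRC : 4 * C ≤ κ * R := by
    have : 4 * C / κ ≤ R := le_max_right _ _
    rw [div_le_iff₀ hκ] at this; linarith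
  set r := κ / (4 * (L + 1)) with hr
  have hr0 : 0 < r := by positivity
  obtain ⟨N, -, hNf, hN⟩ := (isCompact_closedBall (0 : Eucl d) R).finite_cover_balls hr0
  have hnet : ∀ᶠ s in 𝓝 t, ∀ y ∈ N, ‖v s y - v t y‖ ≤ κ / 2 := by
    rw [eventually_all_finite hNf]
    intro y _
    have hc : ContinuousAt (fun s => v s y) t := (hv.time y t ht).continuousAt (Ioo_mem_nhds ht.1 ht.2)
    filter_upwards [hc.eventually (Metric.closedBall_mem_nhds _ (half_pos hκ))] with s hs
    simpa [dist_eq_norm] using hs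
  filter_upwards [Ioo_mem_nhds ht.1 ht.2, hnet] with s hs hsN
  refine ⟨hs, fun x => ?_⟩
  by_cases hx : ‖x‖ ≤ R
  · have hxb := hN (mem_closedBall_zero_iff.2 hx)
    simp only [mem_iUnion, Metric.mem_ball, dist_eq_norm] at hxb
    obtain ⟨y, hyN, hy⟩ := hxb
    have h1 := hv.lip s hs x y
    have h2 := hv.lip t ht y x
    have h3 := hsN y hyN
    rw [norm_sub_rev y x] at h2
    have h4 : L * ‖x - y‖ ≤ κ / 4 := by
      have : (L + 1) * ‖x - y‖ ≤ (L + 1) * r := by gcongr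
      have h5 : (L + 1) * r = κ / 4 := by rw [hr]; field_simp
      nlinarith [norm_nonneg (x - y)]
    calc ‖v s x - v t x‖ = ‖(v s x - v s y) + (v s y - v t y) + (v t y - v t x)‖ := by
          congr 1; abel
      _ ≤ ‖v s x - v s y‖ + ‖v s y - v t y‖ + ‖v t y - v t x‖ := norm_add₃_le
      _ ≤ κ := by linarith
      _ ≤ _ := by nlinarith [sq_nonneg ‖x‖]
  · have hx' := not_le.1 hx
    have h1 := hv.growth s hs x
    have h2 := hv.growth t ht x
    have h3 := norm_sub_le (v s x) (v t x)
    have h4 : 4 * C * ‖x‖ ≤ κ * ‖x‖ ^ 2 := by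
      calc 4 * C * ‖x‖ ≤ κ * R * ‖x‖ := by gcongr
        _ ≤ κ * ‖x‖ * ‖x‖ := by gcongr
        _ = _ := by ring
    have h5 : C * 1 ≤ C * ‖x‖ := by gcongr; linarith
    nlinarith

variable {ε K δ M : ℝ} {μ₀ : P2 d} {ρ : ℝ → P2 d} {φ : Eucl d → ℝ}

lemma P2.integral_one_add_sq_le {μ : P2 d} (h : μ.m2 ≤ M) :
    ∫ x, (1 + ‖x‖ ^ 2) ∂μ.meas ≤ 1 + M := by
  rw [integral_add (integrable_const 1) μ.integrable_norm_sq]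
  simpa [P2.m2] using h

lemma P2.abs_integral_le_of_le_sq {μ : P2 d} (h : μ.m2 ≤ M) {f : Eucl d → ℝ} {B₁ B₂ : ℝ}
    (hB₂ : 0 ≤ B₂) (hf : ∀ x, |f x| ≤ B₁ + B₂ * (1 + ‖x‖ ^ 2)) :
    |∫ x, f x ∂μ.meas| ≤ B₁ + B₂ * (1 + M) := by
  have hi : Integrable (fun x : Eucl d => 1 + ‖x‖ ^ 2) μ.meas :=
    (integrable_const 1).add μ.integrable_norm_sq
  refine (norm_integral_le_of_norm_le (f := f) (g := fun x => B₁ + B₂ * (1 + ‖x‖ ^ 2))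
    ((integrable_const B₁).add (hi.const_mul B₂)) (.of_forall hf)).trans ?_
  rw [integral_add (integrable_const B₁) (hi.const_mul B₂), integral_const_mul]
  have := P2.integral_one_add_sq_le h
  simp only [integral_const, probReal_univ, smul_eq_mul, one_mul]
  gcongr

/-- The value at time `s` of the backward transport of `φ` given at time `t`. -/
def transport (T : ℝ) (v : ℝ → Eucl d → Eucl d) (φ : Eucl d → ℝ) (t s : ℝ) (x : Eucl d) : ℝ :=
  φ (flow T v s t x)

lemma transport_lipschitz (hv : IsLipField T L C v) (hK : 0 ≤ K)
    (hφ : ∀ x y, |φ x - φ y| ≤ K * ‖x - y‖) {t s : ℝ} (hs : 0 ≤ s) (hst : s ≤ t) (ht : t ≤ T)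
    (x y : Eucl d) :
    |transport T v φ t s x - transport T v φ t s y| ≤ K * Real.exp (L * T) * ‖x - y‖ := by
  refine (hφ _ _).trans ?_
  rw [mul_assoc]
  exact mul_le_mul_of_nonneg_left (hv.flow_lipschitz hs ⟨hst, ht⟩ x y) hK

lemma transport_flow (hv : IsLipField T L C v) {t s r : ℝ} (hs : 0 ≤ s) (hsr : s ≤ r)
    (hrt : r ≤ t) (ht : t ≤ T) (x : Eucl d) :
    transport T v φ t r (flow T v s r x) = transport T v φ t s x := by
  unfold transport
  rw [hv.flow_flow hs hsr hrt ht]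

lemma hasCompactSupport_transport (hv : IsLipField T L C v) {R : ℝ}
    (hφ : ∀ x, R < ‖x‖ → φ x = 0) {t s : ℝ} (hs : 0 ≤ s) (hst : s ≤ t) (ht : t ≤ T) :
    HasCompactSupport (transport T v φ t s) := by
  refine HasCompactSupport.intro
    (isCompact_closedBall (0 : Eucl d) (Real.exp (C * T) * (1 + R))) fun x hx => ?_
  refine hφ _ ?_
  have h := hv.flow_growth_backward hs ⟨hst, ht⟩ x
  have hx' : Real.exp (C * T) * (1 + R) < ‖x‖ := by simpa using hx
  have := Real.exp_pos (C * T)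
  by_contra hle
  have : Real.exp (C * T) * (1 + ‖flow T v s t x‖) ≤ Real.exp (C * T) * (1 + R) := by
    gcongr; exact not_lt.1 hle
  linarith

/-- Constancy along trajectories turns a change of time into the displacement of a trajectory, to
which the Lipschitz bound in space applies. -/
lemma abs_transport_sub_le (hv : IsLipField T L C v) (hK : 0 ≤ K)
    (hφ : ∀ x y, |φ x - φ y| ≤ K * ‖x - y‖) {t s r : ℝ} (hs : 0 ≤ s) (hst : s ≤ t) (hr : 0 ≤ r)
    (hrt : r ≤ t) (ht : t ≤ T) (x : Eucl d) :
    |transport T v φ t s x - transport T v φ t r x| ≤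
      K * Real.exp (L * T) * (C * Real.exp (C * T) * (1 + ‖x‖)) * |s - r| := by
  wlog hsr : s ≤ r generalizing s r with H
  · rw [abs_sub_comm, abs_sub_comm s r]
    exact H hr hrt hs hst (le_of_not_ge hsr)
  rw [← transport_flow hv hs hsr hrt ht, abs_sub_comm s r, abs_of_nonneg (sub_nonneg.2 hsr)]
  refine (transport_lipschitz hv hK hφ hr hrt ht _ _).trans ?_
  rw [mul_assoc (K * Real.exp (L * T))]
  exact mul_le_mul_of_nonneg_left (hv.norm_flow_sub_le hs ⟨hsr, hrt.trans ht⟩ x) (by positivity)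

/-- First order expansion of the flow started near `x`. -/
lemma norm_flow_sub_sub_le (hv : IsLipField T L C v) {t h κ : ℝ} (ht : t ∈ Ioo 0 T) (hh : 0 ≤ h)
    (hh1 : h ≤ 1) (htT : t + h ≤ T) (hδ1 : δ ≤ 1) {x z : Eucl d} (hz : ‖z‖ ≤ δ)
    (hκ : ∀ s ∈ Ioo t (t + h), ‖v s x - v t x‖ ≤ κ * (1 + ‖x‖ ^ 2)) :
    ‖flow T v t (t + h) (x - h • v t x - z) - (x - z)‖ ≤
      h * (L * ((C * Real.exp (C * T) * (2 + C) + C) * h * (1 + ‖x‖) + δ) +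
        κ * (1 + ‖x‖ ^ 2)) := by
  have hL := hv.L_nonneg
  have hC := hv.C_nonneg
  set V := v t x with hV
  set p := x - h • V - z with hp
  have hVn : ‖V‖ ≤ C * (1 + ‖x‖) := hv.growth t ht x
  have hpx : ‖p - x‖ ≤ h * (C * (1 + ‖x‖)) + δ := by
    have : p - x = -(h • V) - z := by rw [hp]; abel
    rw [this]
    refine (norm_sub_le _ _).trans ?_
    rw [norm_neg, norm_smul, Real.norm_of_nonneg hh]
    gcongr
  have hpn : 1 + ‖p‖ ≤ (2 + C) * (1 + ‖x‖) := by
    have h1 := norm_le_norm_add_norm_sub' p x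
    have h2 : h * (C * (1 + ‖x‖)) ≤ 1 * (C * (1 + ‖x‖)) := by gcongr
    have := norm_nonneg x
    nlinarith
  have ht' : t ∈ Icc 0 T := Ioo_subset_Icc_self ht
  have htr := hv.flow_trajectory ht' p
  -- Subtract the straight motion (r − t)V from the trajectory of p. The remaining velocity splits
  -- into an L-Lipschitz space error and a time error controlled by κ.
  have key := norm_image_sub_le_of_interior_const (a := t) (b := t + h)
    (f := fun r => flow T v t r p - (r - t) • V) (f' := fun r => v r (flow T v t r p) - V)
    (C := L * ((C * Real.exp (C * T) * (2 + C) + C) * h * (1 + ‖x‖) + δ) + κ * (1 + ‖x‖ ^ 2))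
    ((htr.2.1.mono (Icc_subset_Icc_right htT)).sub (by fun_prop)) ?_ ?_ (t + h)
    (right_mem_Icc.2 (by linarith))
  · simp only [hv.flow_self ht', sub_self, zero_smul, sub_zero, add_sub_cancel_left] at key
    have e : flow T v t (t + h) p - (x - z) = flow T v t (t + h) p - h • V - p := by
      rw [hp]; abel
    rw [e]
    linarith
  · intro r hr
    have h1 := htr.2.2 r ⟨hr.1, hr.2.trans_le htT⟩
    have h2 : HasDerivAt (fun r : ℝ => (r - t) • V) V r := by
      simpa using ((hasDerivAt_id r).sub_const t).smul_const V
    exact h1.sub h2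
  · intro r hr
    have hr0 : r ∈ Ioo 0 T := ⟨ht.1.trans hr.1, hr.2.trans_le htT⟩
    have h1 := hv.norm_flow_sub_le ht'.1 (⟨hr.1.le, hr0.2.le⟩ : r ∈ Icc t T) p
    have h2 : ‖flow T v t r p - x‖ ≤
        (C * Real.exp (C * T) * (2 + C) + C) * h * (1 + ‖x‖) + δ := by
      have h3 : ‖flow T v t r p - p‖ ≤ C * Real.exp (C * T) * ((2 + C) * (1 + ‖x‖)) * h := by
        refine h1.trans ?_
        have : r - t ≤ h := by linarith [hr.2]
        have : 0 ≤ r - t := by linarith [hr.1]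
        gcongr
      have h4 : ‖flow T v t r p - x‖ ≤ ‖flow T v t r p - p‖ + ‖p - x‖ :=
        norm_sub_le_norm_sub_add_norm_sub _ _ _
      linarith
    calc ‖v r (flow T v t r p) - V‖ ≤ ‖v r (flow T v t r p) - v r x‖ + ‖v r x - V‖ :=
          norm_sub_le_norm_sub_add_norm_sub _ _ _
      _ ≤ L * ‖flow T v t r p - x‖ + κ * (1 + ‖x‖ ^ 2) :=
          add_le_add (hv.lip r hr0 _ _) (hκ r hr)
      _ ≤ _ := by gcongr

end Duality

/-! ### The duality estimate for weak solutions. -/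

section Duality

variable {d : ℕ} {T L C : ℝ} {v : ℝ → Eucl d → Eucl d} {ε K M : ℝ} {μ₀ : P2 d} {ρ : ℝ → P2 d}
  {φ : Eucl d → ℝ} {η : ContDiffBump (0 : Eucl d)}

lemma abs_integral_le_of_forall {α : Type*} [MeasurableSpace α] {μ : Measure α}
    [IsProbabilityMeasure μ] {f : α → ℝ} {B : ℝ} (h : ∀ x, |f x| ≤ B) : |∫ x, f x ∂μ| ≤ B := by
  simpa using norm_integral_le_of_norm_le_const (μ := μ) (f := f) (.of_forall h)

/-- A discrete form of ∂ₜψ + v·∇ψ ≈ 0 for the mollified transport ψ. Mollification does not commute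
with v, and this costs h·L·`η.rOut`, the only part that is not o(h) apart from the modulus κ. -/
lemma abs_mollify_transport_expansion_le (hv : IsLipField T L C v) (hK : 0 ≤ K)
    (hφ : ∀ x y, |φ x - φ y| ≤ K * ‖x - y‖) (hη : η.rOut ≤ 1) {t t₁ h κ : ℝ} (ht : t ∈ Ioo 0 T)
    (hh : 0 ≤ h) (hh1 : h ≤ 1) (hht : t + h ≤ t₁) (ht₁ : t₁ ≤ T) {x : Eucl d}
    (hκ : ∀ s ∈ Ioo t (t + h), ‖v s x - v t x‖ ≤ κ * (1 + ‖x‖ ^ 2)) :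
    |mollify η (transport T v φ t₁ (t + h)) x - mollify η (transport T v φ t₁ t) x +
        h * fderiv ℝ (mollify η (transport T v φ t₁ t)) x (v t x)| ≤
      h * (K * Real.exp (L * T) * (L * η.rOut)) +
      h * (K * Real.exp (L * T) * (2 * L * (C * Real.exp (C * T) * (2 + C) + C) * h + κ +
        2 * bumpConst η * C ^ 2 * h)) * (1 + ‖x‖ ^ 2) := by
  set K' := K * Real.exp (L * T) with hK'
  have hK'0 : 0 ≤ K' := by positivity
  have hL := hv.L_nonneg
  have hC := hv.C_nonneg
  have hb := bumpConst_nonneg η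
  set C₃ := C * Real.exp (C * T) * (2 + C) + C with hC₃
  have hC₃0 : 0 ≤ C₃ := by positivity
  have htt₁ : t ≤ t₁ := by linarith
  have hlip0 := transport_lipschitz hv hK hφ ht.1.le htt₁ ht₁
  have hlip1 := transport_lipschitz hv hK hφ (by linarith [ht.1] : 0 ≤ t + h) hht ht₁
  have hc0 : Continuous (transport T v φ t₁ t) := continuous_of_lipschitz hlip0
  have hc1 : Continuous (transport T v φ t₁ (t + h)) := continuous_of_lipschitz hlip1
  have hVn : ‖v t x‖ ≤ C * (1 + ‖x‖) := hv.growth t ht x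
  have hx := norm_nonneg x
  -- The value of the transport at time t in x − hv − z equals its value at time t+h in the image of
  -- that point under the flow, which is close to x − z. Only Lipschitz regularity of the transport
  -- enters here; a Taylor expansion is needed only after mollifying.
  have a1 : |mollify η (transport T v φ t₁ t) (x - h • v t x) -
      mollify η (transport T v φ t₁ (t + h)) x| ≤
      K' * (h * (L * (C₃ * h * (1 + ‖x‖) + η.rOut) + κ * (1 + ‖x‖ ^ 2))) := by
    refine abs_mollify_sub_mollify_le hc0 hc1 fun z hz => ?_
    rw [← transport_flow hv ht.1.le (by linarith : t ≤ t + h) hht ht₁]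
    refine (hlip1 _ _).trans (mul_le_mul_of_nonneg_left ?_ hK'0)
    exact norm_flow_sub_sub_le hv ht hh hh1 (hht.trans ht₁) hη hz hκ
  have a2 := abs_mollify_taylor_le (η := η) hlip0 hK'0 x (-(h • v t x))
  rw [← sub_eq_add_neg, map_neg, map_smul, norm_neg, norm_smul, Real.norm_of_nonneg hh,
    smul_eq_mul] at a2
  have a3 : bumpConst η * K' * (h * ‖v t x‖) ^ 2 ≤
      bumpConst η * K' * (h * (C * (1 + ‖x‖))) ^ 2 := by gcongr
  have q1 : 1 + ‖x‖ ≤ 2 * (1 + ‖x‖ ^ 2) := by nlinarith [sq_nonneg (‖x‖ - 1)]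
  have q2 : (1 + ‖x‖) ^ 2 ≤ 2 * (1 + ‖x‖ ^ 2) := by nlinarith [sq_nonneg (‖x‖ - 1)]
  have b1 : K' * (h * (L * (C₃ * h * (1 + ‖x‖)))) ≤
      K' * (h * (L * (C₃ * h * (2 * (1 + ‖x‖ ^ 2))))) := by gcongr
  have b2 : bumpConst η * K' * (h * (C * (1 + ‖x‖))) ^ 2 ≤
      bumpConst η * K' * h ^ 2 * C ^ 2 * (2 * (1 + ‖x‖ ^ 2)) := by
    calc _ = bumpConst η * K' * h ^ 2 * C ^ 2 * (1 + ‖x‖) ^ 2 := by ring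
      _ ≤ _ := by gcongr
  rw [abs_le] at a1 a2 ⊢
  constructor <;> nlinarith

/-- A weak solution with small viscosity is close, against Lipschitz test functions, to the
transport of its initial datum along the flow. -/
lemma abs_integral_sub_integral_flow_le (hv : IsLipField T L C v) (hε : 0 ≤ ε)
    (hρ : IsWeakSolution T ε (fun t x _ => v t x) μ₀ ρ) (hM : ∀ t ∈ Icc 0 T, (ρ t).m2 ≤ M)
    (hK : 0 ≤ K) (hφ : ∀ x y, |φ x - φ y| ≤ K * ‖x - y‖) {R : ℝ} (hφR : ∀ x, R < ‖x‖ → φ x = 0)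
    (hη : η.rOut ≤ 1) {t₁ : ℝ} (ht₁ : t₁ ∈ Icc 0 T) :
    |∫ x, φ x ∂(ρ t₁).meas - ∫ x, φ (flow T v 0 t₁ x) ∂μ₀.meas| ≤
      K * Real.exp (L * T) * (2 * η.rOut + T * (L * η.rOut + ε * (d * bumpConst η))) := by
  set K' := K * Real.exp (L * T) with hK'
  have hK'0 : 0 ≤ K' := by positivity
  have hL := hv.L_nonneg
  have hC := hv.C_nonneg
  have hb := bumpConst_nonneg η
  have hη0 := η.rOut_pos
  have hT : 0 ≤ T := ht₁.1.trans ht₁.2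
  have hM0 : 0 ≤ M := (ρ t₁).m2_nonneg.trans (hM t₁ ht₁)
  have hlip : ∀ s ∈ Icc 0 t₁, ∀ x y,
      |transport T v φ t₁ s x - transport T v φ t₁ s y| ≤ K' * ‖x - y‖ := fun s hs =>
    transport_lipschitz hv hK hφ hs.1 hs.2 ht₁.2
  have hcont : ∀ s ∈ Icc 0 t₁, Continuous (transport T v φ t₁ s) := fun s hs =>
    continuous_of_lipschitz (hlip s hs)
  have hcs : ∀ s ∈ Icc 0 t₁, HasCompactSupport (mollify η (transport T v φ t₁ s)) := fun s hs =>
    hasCompactSupport_mollify (hasCompactSupport_transport hv hφR hs.1 hs.2 ht₁.2)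
  have hcd : ∀ s ∈ Icc 0 t₁, ContDiff ℝ ∞ (mollify η (transport T v φ t₁ s)) := fun s hs =>
    contDiff_mollify (hcont s hs)
  have hmlip : ∀ s ∈ Icc 0 t₁, ∀ x y, |mollify η (transport T v φ t₁ s) x -
      mollify η (transport T v φ t₁ s) y| ≤ K' * ‖x - y‖ := fun s hs =>
    mollify_lipschitz (hlip s hs)
  have h_integrable : ∀ s ∈ Icc 0 t₁, ∀ r, Integrable (mollify η (transport T v φ t₁ s)) (ρ r).meas :=
    fun s hs r => (QuadLip.of_lipschitz hK'0 (hmlip s hs)).integrable hK'0 _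
  -- A interpolates between the two integrals to be compared: up to mollification, A(t₁) = ∫φ
  -- dρ_{t₁} and A(0) = ∫φ∘flow dμ₀.
  set A : ℝ → ℝ := fun s => ∫ x, mollify η (transport T v φ t₁ s) x ∂(ρ s).meas with hA
  have hsub : Icc 0 t₁ ⊆ Icc 0 T := Icc_subset_Icc_right ht₁.2
  -- continuity of `A`
  have hAc : ContinuousOn A (Icc 0 t₁) := by
    intro s hs
    rw [ContinuousWithinAt, tendsto_iff_norm_sub_tendsto_zero]
    have hlim : Tendsto (fun r => K' * (C * Real.exp (C * T)) * 3 * (1 + M) * |r - s| +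
        K' * W2 (ρ r) (ρ s)) (𝓝[Icc 0 t₁] s) (𝓝 0) := by
      have c1 : Tendsto (fun r => K' * (C * Real.exp (C * T)) * 3 * (1 + M) * |r - s|)
          (𝓝[Icc 0 t₁] s) (𝓝 0) := by
        have : Continuous fun r => K' * (C * Real.exp (C * T)) * 3 * (1 + M) * |r - s| := by
          fun_prop
        simpa using (this.tendsto s).mono_left (nhdsWithin_le_nhds (s := Icc 0 t₁))
      have c2 := ((hρ.continuous s (hsub hs)).mono_left (nhdsWithin_mono s hsub)).const_mul K'
      simpa using c1.add c2
    refine squeeze_zero' (.of_forall fun _ => norm_nonneg _) ?_ hlim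
    filter_upwards [self_mem_nhdsWithin] with r hr
    have e : A r - A s = (∫ x, (mollify η (transport T v φ t₁ r) x -
        mollify η (transport T v φ t₁ s) x) ∂(ρ r).meas) +
        (∫ x, mollify η (transport T v φ t₁ s) x ∂(ρ r).meas -
          ∫ x, mollify η (transport T v φ t₁ s) x ∂(ρ s).meas) := by
      rw [integral_sub (h_integrable r hr r) (h_integrable s hs r)]; simp only [hA]; ring
    rw [e]
    refine (norm_add_le _ _).trans (add_le_add ?_
      (norm_integral_sub_le_of_lipschitz hK'0 (hmlip s hs) _ _))
    have := P2.abs_integral_le_of_le_sq (hM r (hsub hr)) (B₁ := 0)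
      (B₂ := K' * (C * Real.exp (C * T)) * 3 * |r - s|)
      (f := fun x => mollify η (transport T v φ t₁ r) x - mollify η (transport T v φ t₁ s) x)
      (by positivity) (fun x => ?_)
    · rw [Real.norm_eq_abs]
      calc _ ≤ _ := this
        _ = _ := by ring
    · refine abs_mollify_sub_mollify_le (hcont r hr) (hcont s hs) fun z hz => ?_
      refine (abs_transport_sub_le hv hK hφ hr.1 hr.2 hs.1 hs.2 ht₁.2 (x - z)).trans ?_
      have h1 : 1 + ‖x - z‖ ≤ 3 * (1 + ‖x‖ ^ 2) := by
        have := norm_sub_le x z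
        nlinarith [sq_nonneg (‖x‖ - 1)]
      calc K' * (C * Real.exp (C * T) * (1 + ‖x - z‖)) * |r - s|
          ≤ K' * (C * Real.exp (C * T) * (3 * (1 + ‖x‖ ^ 2))) * |r - s| := by gcongr
        _ = _ := by ring
  -- right slopes of `A`
  have hslope : ∀ t ∈ Ioo 0 t₁, ∀ κ > 0, ∀ᶠ z in 𝓝[>] t,
      |A z - A t| ≤ (K' * (L * η.rOut + ε * (d * bumpConst η)) + κ) * (z - t) := by
    intro t ht κ hκ
    have htT : t ∈ Ioo 0 T := ⟨ht.1, ht.2.trans_le ht₁.2⟩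
    have htt : t ∈ Icc 0 t₁ := Ioo_subset_Icc_self ht
    set ψ := mollify η (transport T v φ t₁ t) with hψ
    set f : Eucl d → ℝ := fun x => inner ℝ (v t x) (∇ ψ x) with hf
    -- This regularity makes ∫f dρ_z continuous in z, which allows the drift term at time t+h to be
    -- replaced by the one at time t.
    have hfq : QuadLip (L * K' + C * (bumpConst η * K')) f := by
      intro x y
      have e : f x - f y = inner ℝ (v t x - v t y) (∇ ψ x) + inner ℝ (v t y) (∇ ψ x - ∇ ψ y) := by
        simp only [hf, inner_sub_left, inner_sub_right]; ring
      have g1 : ‖∇ ψ x‖ ≤ K' := by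
        rw [norm_gradient_eq]; exact norm_fderiv_mollify_le (hlip t htt) hK'0 x
      have g2 : ‖∇ ψ x - ∇ ψ y‖ ≤ bumpConst η * K' * ‖x - y‖ := by
        unfold gradient
        rw [← map_sub, LinearIsometryEquiv.norm_map]
        exact fderiv_mollify_lipschitz (hlip t htt) x y
      rw [e]
      refine (norm_add_le _ _).trans ?_
      have h1 := (norm_inner_le_norm (𝕜 := ℝ) (v t x - v t y) (∇ ψ x)).trans
        (mul_le_mul (hv.lip t htT x y) g1 (norm_nonneg _) (by positivity))
      have h2 := (norm_inner_le_norm (𝕜 := ℝ) (v t y) (∇ ψ x - ∇ ψ y)).trans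
        (mul_le_mul (hv.growth t htT y) g2 (norm_nonneg _) (by positivity))
      have hx := norm_nonneg x
      have hy := norm_nonneg y
      have hxy := norm_nonneg (x - y)
      have p1 : 0 ≤ L * K' * ‖x - y‖ := by positivity
      have p2 : 0 ≤ C * (bumpConst η * K') * ‖x - y‖ := by positivity
      nlinarith [mul_nonneg p1 hx, mul_nonneg p1 hy, mul_nonneg p2 hx, mul_nonneg p2 hy]
    have hfK : 0 ≤ L * K' + C * (bumpConst η * K') := by positivity
    have hder := hρ.equation ψ (hcd t htt) (hcs t htt) t htT
    set D := ∫ x, (inner ℝ (v t x) (∇ ψ x) + ε * Δ ψ x) ∂(ρ t).meas with hD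
    have hfi : Integrable f (ρ t).meas := hfq.integrable hfK _
    have hDf : |D - ∫ x, f x ∂(ρ t).meas| ≤ K' * (ε * (d * bumpConst η)) := by
      have hlap : ∀ x, |ε * Δ ψ x| ≤ K' * (ε * (d * bumpConst η)) := fun x => by
        rw [abs_mul, abs_of_nonneg hε]
        have := abs_laplacian_mollify_le (η := η) (hlip t htt) hK'0 x
        calc _ ≤ ε * (d * (bumpConst η * K')) := by gcongr
          _ = _ := by ring
      have hli : Integrable (fun x => ε * Δ ψ x) (ρ t).meas := by
        refine (integrable_const (K' * (ε * (d * bumpConst η)))).mono' ?_ (.of_forall hlap)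
        refine (Continuous.aestronglyMeasurable ?_)
        refine continuous_const.mul ?_
        rw [InnerProductSpace.laplacian_eq_iteratedFDeriv_orthonormalBasis ψ
          (EuclideanSpace.basisFun (Fin d) ℝ)]
        have h2 : Continuous (iteratedFDeriv ℝ 2 ψ) :=
          (hcd t htt).continuous_iteratedFDeriv (by norm_cast)
        exact continuous_finsetSum _ fun i _ => by fun_prop
      rw [hD, integral_add hfi hli, add_sub_cancel_left]
      exact abs_integral_le_of_forall hlap
    -- the three error terms
    have hright : Tendsto (fun z => ∫ x, f x ∂(ρ z).meas) (𝓝[>] t)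
        (𝓝 (∫ x, f x ∂(ρ t).meas)) := by
      have h1 := hfq.tendsto_integral hfK hρ.continuous (hsub htt)
      rw [(nhdsWithin_eq_nhds.2 (Icc_mem_nhds htT.1 htT.2))] at h1
      exact h1.mono_left nhdsWithin_le_nhds
    set κ' := κ / (4 * (K' * (1 + M) + 1)) with hκ'
    have hκ'0 : 0 < κ' := by positivity
    have hκ'1 : K' * (1 + M) * κ' ≤ κ / 4 := by
      have : (K' * (1 + M) + 1) * κ' = κ / 4 := by rw [hκ']; field_simp
      nlinarith
    have hmod := hv.exists_time_modulus htT hκ'0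
    obtain ⟨r, hr0, hr⟩ := Metric.eventually_nhds_iff.1 hmod
    set N := K' * (2 * L * (C * Real.exp (C * T) * (2 + C) + C) + 2 * bumpConst η * C ^ 2) *
      (1 + M) with hN
    have hN0 : 0 ≤ N := by positivity
    have hsmall : ∀ᶠ z in 𝓝[>] t, N * (z - t) ≤ κ / 4 := by
      have : Tendsto (fun z => N * (z - t)) (𝓝[>] t) (𝓝 0) := by
        have h : Continuous fun z => N * (z - t) := by fun_prop
        simpa using (h.tendsto t).mono_left (nhdsWithin_le_nhds (s := Ioi t))
      exact this.eventually (ge_mem_nhds (by positivity))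
    have hI2 : ∀ᶠ z in 𝓝[>] t, |∫ x, ψ x ∂(ρ z).meas - ∫ x, ψ x ∂(ρ t).meas - (z - t) * D| ≤
        κ / 4 * (z - t) := by
      have h1 := (hasDerivAt_iff_isLittleO.1 hder).def (by positivity : 0 < κ / 4)
      filter_upwards [h1.filter_mono nhdsWithin_le_nhds, self_mem_nhdsWithin] with z hz hzt
      rw [Real.norm_eq_abs, Real.norm_of_nonneg (sub_nonneg.2 (le_of_lt hzt)), smul_eq_mul] at hz
      exact hz
    have hI3 : ∀ᶠ z in 𝓝[>] t, |∫ x, f x ∂(ρ z).meas - ∫ x, f x ∂(ρ t).meas| ≤ κ / 4 := by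
      filter_upwards [hright.eventually (Metric.closedBall_mem_nhds _
        (by positivity : 0 < κ / 4))] with z hz
      simpa [Real.dist_eq] using hz
    filter_upwards [hsmall, hI2, hI3, self_mem_nhdsWithin,
      Ioo_mem_nhdsGT (lt_min ht.2 (lt_add_of_pos_right t (lt_min hr0 one_pos)) :
        t < min t₁ (t + min r 1))] with z hz1 hz2 hz3 hzt hzI
    obtain ⟨h, rfl⟩ : ∃ h, z = t + h := ⟨z - t, by ring⟩
    have hzt' : t < t + h := hzt
    have hh : 0 < h := by linarith
    have hzmin := hzI.2
    rw [lt_min_iff] at hzmin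
    have hhr : h < min r 1 := by linarith [hzmin.2]
    rw [lt_min_iff] at hhr
    have hzm : t + h ∈ Icc 0 t₁ := ⟨by linarith [ht.1], hzmin.1.le⟩
    simp only [add_sub_cancel_left] at hz1 hz2 hz3 ⊢
    -- The increment of A is the change of ψ along the frozen measure ρ_{t+h}, plus the change of ρ
    -- tested with the frozen ψ. The drift terms ±h∫f cancel up to `hI3`, leaving the viscous term
    -- `hDf`. The allowance κ is split in quarters: two here, one for `hI2` and one for `hI3`.
    have hI1 : |∫ x, (mollify η (transport T v φ t₁ (t + h)) x - ψ x + h * f x)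
        ∂(ρ (t + h)).meas| ≤ h * (K' * (L * η.rOut)) + (h * (κ / 4) + h * (κ / 4)) := by
      refine (P2.abs_integral_le_of_le_sq (hM (t + h) (hsub hzm))
        (B₁ := h * (K' * (L * η.rOut)))
        (B₂ := h * (K' * (2 * L * (C * Real.exp (C * T) * (2 + C) + C) * h + κ' +
        2 * bumpConst η * C ^ 2 * h))) (by positivity) fun x => ?_).trans ?_
      · have h1 := abs_mollify_transport_expansion_le (η := η) (x := x) hv hK hφ hη htT hh.le
          hhr.2.le hzm.2 ht₁.2 (κ := κ') (fun s hs => (hr (by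
            rw [Real.dist_eq, abs_of_pos (by linarith [hs.1])]; linarith [hs.2, hhr.1])).2 x)
        simp only [hf, inner_gradient]
        exact h1
      · have e : h * (K' * (2 * L * (C * Real.exp (C * T) * (2 + C) + C) * h + κ' +
          2 * bumpConst η * C ^ 2 * h)) * (1 + M) = h * (N * h) + h * (K' * (1 + M) * κ') := by
          rw [hN]; ring
        rw [e]
        gcongr
    have i1 := h_integrable (t + h) hzm (t + h)
    have i2 : Integrable ψ (ρ (t + h)).meas := h_integrable t htt (t + h)
    have i3 : Integrable f (ρ (t + h)).meas := hfq.integrable hfK _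
    rw [integral_add (by exact i1.sub i2) (i3.const_mul h), integral_sub i1 i2,
      integral_const_mul] at hI1
    have e1 : A (t + h) = ∫ x, mollify η (transport T v φ t₁ (t + h)) x ∂(ρ (t + h)).meas := rfl
    have e2 : A t = ∫ x, ψ x ∂(ρ t).meas := rfl
    rw [← e1] at hI1
    rw [← e2] at hz2
    set a := A (t + h)
    set p := ∫ x, ψ x ∂(ρ (t + h)).meas
    set q := ∫ x, f x ∂(ρ (t + h)).meas
    set q' := ∫ x, f x ∂(ρ t).meas
    have hz3' : |h * q - h * q'| ≤ h * (κ / 4) := by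
      rw [← mul_sub, abs_mul, abs_of_pos hh]; gcongr
    have hDf' : |h * D - h * q'| ≤ h * (K' * (ε * (d * bumpConst η))) := by
      rw [← mul_sub, abs_mul, abs_of_pos hh]; gcongr
    rw [abs_le] at *
    constructor <;> linarith
  have hmain := abs_sub_le_of_right_slope ht₁.1 hAc hslope
  -- Removing the mollification at either end costs K'·`η.rOut`, whence the 2 in the statement.
  have hend : |A t₁ - ∫ x, φ x ∂(ρ t₁).meas| ≤ K' * η.rOut := by
    have htt : t₁ ∈ Icc 0 t₁ := ⟨ht₁.1, le_rfl⟩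
    have e : transport T v φ t₁ t₁ = φ := by
      funext x; unfold transport; rw [hv.flow_self ht₁]
    have hφK : ∀ x y, |φ x - φ y| ≤ K' * ‖x - y‖ := by
      have := hlip t₁ htt; rwa [e] at this
    have h1 := h_integrable t₁ htt t₁
    have h2 : Integrable φ (ρ t₁).meas := (QuadLip.of_lipschitz hK'0 hφK).integrable hK'0 _
    simp only [hA]
    rw [← integral_sub h1 h2, e]
    exact abs_integral_le_of_forall fun x => abs_mollify_sub_le hφK hK'0 x
  have hstart : |A 0 - ∫ x, φ (flow T v 0 t₁ x) ∂μ₀.meas| ≤ K' * η.rOut := by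
    have htt : (0 : ℝ) ∈ Icc 0 t₁ := ⟨le_rfl, ht₁.1⟩
    have h1 := h_integrable 0 htt 0
    have h2 : Integrable (transport T v φ t₁ 0) (ρ 0).meas :=
      (QuadLip.of_lipschitz hK'0 (hlip 0 htt)).integrable hK'0 _
    rw [← hρ.initial]
    show |A 0 - ∫ x, transport T v φ t₁ 0 x ∂(ρ 0).meas| ≤ _
    simp only [hA]
    rw [← integral_sub h1 h2]
    exact abs_integral_le_of_forall fun x => abs_mollify_sub_le (hlip 0 htt) hK'0 x
  have hTt : K' * (L * η.rOut + ε * (d * bumpConst η)) * (t₁ - 0) ≤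
      K' * (L * η.rOut + ε * (d * bumpConst η)) * T := by
    have := ht₁.2
    gcongr
    linarith
  rw [abs_le] at *
  constructor <;> linarith

end Duality

/-! ### From finitely many test functions to a coupling. -/

section Cells

variable {d : ℕ}

/-- A Lipschitz bump equal to one on the ball of radius `r` and supported in the ball of radius
`2 r`. -/
def hat (r : ℝ) (c x : Eucl d) : ℝ := max 0 (min 1 (2 - ‖x - c‖ / r))

lemma hat_lipschitz {r : ℝ} (hr : 0 < r) (c x y : Eucl d) :
    |hat r c x - hat r c y| ≤ 1 / r * ‖x - y‖ := by
  have h0 : 0 ≤ 1 / r * ‖x - y‖ := by positivity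
  refine (abs_max_sub_max_le_max _ _ _ _).trans (max_le (by simpa using h0) ?_)
  refine (abs_min_sub_min_le_max _ _ _ _).trans (max_le (by simpa using h0) ?_)
  rw [sub_sub_sub_cancel_left, ← sub_div, abs_div, abs_of_pos hr, div_mul_eq_mul_div, one_mul]
  gcongr
  have h := abs_norm_sub_norm_le (y - c) (x - c)
  rw [sub_sub_sub_cancel_right, norm_sub_rev y x] at h
  exact h

/-- Let f_i be the maximum of the first i hats around a finite net, and take the differences f_{i+1}
− f_i. They are nonnegative, telescope to a function equal to 1 on the ball, and vanish wherever the
new hat does. As a difference of two 1/r-Lipschitz functions each is 2/r-Lipschitz. -/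
lemma exists_cells {R r : ℝ} (hR : 0 ≤ R) (hr : 0 < r) : ∃ (N : ℕ) (χ : ℕ → Eucl d → ℝ),
    (∀ i x, 0 ≤ χ i x) ∧ (∀ x, ∑ i ∈ Finset.range N, χ i x ≤ 1) ∧
    (∀ x, ‖x‖ ≤ R → ∑ i ∈ Finset.range N, χ i x = 1) ∧
    (∀ i x y, |χ i x - χ i y| ≤ 2 / r * ‖x - y‖) ∧
    (∀ i x y, χ i x ≠ 0 → χ i y ≠ 0 → ‖x - y‖ ≤ 4 * r) ∧
    (∀ i x, R + 2 * r < ‖x‖ → χ i x = 0) := by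
  obtain ⟨S, hSR, hSf, hS⟩ := (isCompact_closedBall (0 : Eucl d) R).finite_cover_balls hr
  set l := hSf.toFinset.toList with hl
  -- The default centre 0 also lies in the ball of radius R, so the support bound holds for every
  -- index and not only for those in the net.
  set c : ℕ → Eucl d := fun i => l.getD i 0 with hc
  have hcR : ∀ i, ‖c i‖ ≤ R := by
    intro i
    by_cases hi : i < l.length
    · have : c i ∈ l := by simp only [hc]; rw [List.getD_eq_getElem _ _ hi]; exact List.getElem_mem hi
      have h2 : c i ∈ S := by simpa [hl] using this
      simpa using hSR h2
    · simp only [hc]; rw [List.getD_eq_default _ _ (not_lt.1 hi)]; simpa using hR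
  let f : ℕ → Eucl d → ℝ := fun n => Nat.rec (fun _ => 0) (fun i g x => max (g x) (hat r (c i) x)) n
  have f0 : ∀ x, f 0 x = 0 := fun x => rfl
  have fs : ∀ i x, f (i + 1) x = max (f i x) (hat r (c i) x) := fun i x => rfl
  have hhat1 : ∀ c x : Eucl d, hat r c x ≤ 1 := fun c x => max_le zero_le_one (min_le_left _ _)
  have hf1 : ∀ i x, f i x ≤ 1 := by
    intro i; induction i with
    | zero => intro x; rw [f0]; norm_num
    | succ i ih => intro x; rw [fs]; exact max_le (ih x) (hhat1 _ _)
  have hf0 : ∀ i x, 0 ≤ f i x := by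
    intro i; induction i with
    | zero => intro x; rw [f0]
    | succ i ih => intro x; rw [fs]; exact le_max_of_le_left (ih x)
  have hfl : ∀ i x y, |f i x - f i y| ≤ 1 / r * ‖x - y‖ := by
    intro i; induction i with
    | zero => intro x y; rw [f0, f0, sub_zero, abs_zero]; positivity
    | succ i ih =>
      intro x y; rw [fs, fs]
      exact (abs_max_sub_max_le_max _ _ _ _).trans (max_le (ih x y) (hat_lipschitz hr _ _ _))
  have hne : ∀ i x, f (i + 1) x - f i x ≠ 0 → ‖x - c i‖ ≤ 2 * r := by
    intro i x h
    by_contra hlt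
    have hlt := not_le.1 hlt
    apply h
    have : hat r (c i) x = 0 := by
      have h2 : 2 < ‖x - c i‖ / r := by rwa [lt_div_iff₀ hr]
      exact max_eq_left ((min_le_right _ _).trans (by linarith))
    rw [fs, this, max_eq_left (hf0 i x), sub_self]
  have hsum : ∀ x, ∑ i ∈ Finset.range l.length, (f (i + 1) x - f i x) = f l.length x := fun x => by
    rw [Finset.sum_range_sub (fun i => f i x), f0, sub_zero]
  have hmono : ∀ x, Monotone fun i => f i x := fun x =>
    monotone_nat_of_le_succ fun i => by rw [fs]; exact le_max_left _ _
  refine ⟨l.length, fun i x => f (i + 1) x - f i x, fun i x => sub_nonneg.2 (hmono x (Nat.le_succ i)),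
    fun x => by rw [hsum]; exact hf1 _ _, fun x hx => ?_, fun i x y => ?_, fun i x y hx hy => ?_,
    fun i x hx => ?_⟩
  · rw [hsum]
    refine le_antisymm (hf1 _ _) ?_
    have hxb := hS (mem_closedBall_zero_iff.2 hx)
    simp only [mem_iUnion, Metric.mem_ball, dist_eq_norm] at hxb
    obtain ⟨y, hyS, hy⟩ := hxb
    have hyl : y ∈ l := by simpa [hl] using hyS
    obtain ⟨i, hi, rfl⟩ := List.mem_iff_getElem.1 hyl
    refine le_trans ?_ (hmono x (Nat.succ_le_of_lt hi))
    have hci : c i = l[i] := List.getD_eq_getElem _ _ hi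
    have h1 : hat r (c i) x = 1 := by
      have : ‖x - c i‖ / r ≤ 1 := by rw [div_le_one hr, hci]; exact hy.le
      unfold hat
      rw [min_eq_left (by linarith), max_eq_right zero_le_one]
    show 1 ≤ f (i + 1) x
    rw [fs, h1]
    exact le_max_right _ _
  · have e : (f (i + 1) x - f i x) - (f (i + 1) y - f i y) =
      (f (i + 1) x - f (i + 1) y) - (f i x - f i y) := by ring
    rw [e]
    have h1 := hfl (i + 1) x y
    have h2 := hfl i x y
    calc _ ≤ _ := abs_sub _ _
      _ ≤ 1 / r * ‖x - y‖ + 1 / r * ‖x - y‖ := add_le_add h1 h2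
      _ = _ := by ring
  · have h1 := hne i x hx
    have h2 := hne i y hy
    have h3 := norm_sub_le_norm_sub_add_norm_sub x (c i) y
    rw [norm_sub_rev (c i) y] at h3
    linarith
  · by_contra h
    have h1 := hne i x h
    have h2 := norm_le_norm_add_norm_sub' x (c i)
    linarith [hcR i]

lemma map_fst_withDensity {ρ m : Measure (Eucl d)} [IsProbabilityMeasure ρ]
    [IsProbabilityMeasure m] {D : Eucl d × Eucl d → ℝ≥0∞} (hD : Measurable D)
    (h : ∀ᵐ x ∂ρ, ∫⁻ y, D (x, y) ∂m = 1) :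
    ((ρ.prod m).withDensity D).map Prod.fst = ρ := by
  ext s hs
  rw [Measure.map_apply measurable_fst hs, withDensity_apply _ (measurable_fst hs),
    ← Set.prod_univ, ← Measure.prod_restrict, Measure.restrict_univ,
    lintegral_prod _ hD.aemeasurable]
  rw [lintegral_congr_ae (ae_restrict_of_ae h)]
  simp

lemma map_snd_withDensity {ρ m : Measure (Eucl d)} [IsProbabilityMeasure ρ]
    [IsProbabilityMeasure m] {D : Eucl d × Eucl d → ℝ≥0∞} (hD : Measurable D)
    (h : ∀ᵐ y ∂m, ∫⁻ x, D (x, y) ∂ρ = 1) :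
    ((ρ.prod m).withDensity D).map Prod.snd = m := by
  ext s hs
  rw [Measure.map_apply measurable_snd hs, withDensity_apply _ (measurable_snd hs),
    ← Set.univ_prod, ← Measure.prod_restrict, Measure.restrict_univ,
    lintegral_prod_symm _ hD.aemeasurable]
  rw [lintegral_congr_ae (ae_restrict_of_ae h)]
  simp

/-- A coupling of `ρ` and `m` that matches the cells `χ i` with their pullbacks by `X`. -/
lemma exists_coupling_of_cells {ρ m : Measure (Eucl d)} [IsProbabilityMeasure ρ]
    [IsProbabilityMeasure m] {N : ℕ} {χ : ℕ → Eucl d → ℝ} {X : Eucl d → Eucl d} {R r M s : ℝ}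
    (hs : 0 < s) (hχc : ∀ i, Continuous (χ i)) (hχ0 : ∀ i x, 0 ≤ χ i x)
    (hχ1 : ∀ x, ∑ i ∈ Finset.range N, χ i x ≤ 1)
    (hχR : ∀ x, ‖x‖ ≤ R → ∑ i ∈ Finset.range N, χ i x = 1)
    (hχd : ∀ i x y, χ i x ≠ 0 → χ i y ≠ 0 → ‖x - y‖ ≤ 4 * r)
    (hX : Measurable X) (hXR : ∀ᵐ y ∂m, ‖X y‖ ≤ R)
    (h4 : Integrable (fun x => ‖x‖ ^ 4) ρ) (hM : ∫ x, ‖x‖ ^ 4 ∂ρ ≤ M) {Λ : ℝ}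
    (hΛ : ∑ i ∈ Finset.range N, |∫ x, χ i x ∂ρ - ∫ y, χ i (X y) ∂m| ≤ Λ) :
    ∃ γ : Measure (Eucl d × Eucl d), γ.map Prod.fst = ρ ∧ γ.map Prod.snd = m ∧
      ∫⁻ p, ENNReal.ofReal (‖p.1 - X p.2‖ ^ 2) ∂γ ≤
        ENNReal.ofReal (16 * r ^ 2 + 2 * R ^ 2 * Λ + s * M + Λ / s) := by
  have hχi1 : ∀ i ∈ Finset.range N, ∀ x, χ i x ≤ 1 := fun i hi x =>
    (Finset.single_le_sum (f := fun i => χ i x) (fun j _ => hχ0 j x) hi).trans (hχ1 x)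
  set a : ℕ → ℝ := fun i => ∫ x, χ i x ∂ρ with ha
  set b : ℕ → ℝ := fun i => ∫ y, χ i (X y) ∂m with hb
  have ha0 : ∀ i, 0 ≤ a i := fun i => integral_nonneg fun x => hχ0 i x
  have hb0 : ∀ i, 0 ≤ b i := fun i => integral_nonneg fun x => hχ0 i _
  have iχ : ∀ i ∈ Finset.range N, Integrable (χ i) ρ := fun i hi =>
    (integrable_const (1 : ℝ)).mono' (hχc i).aestronglyMeasurable (.of_forall fun x => by
      rw [Real.norm_of_nonneg (hχ0 i x)]; exact hχi1 i hi x)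
  have iχX : ∀ i ∈ Finset.range N, Integrable (fun y => χ i (X y)) m := fun i hi =>
    (integrable_const (1 : ℝ)).mono' ((hχc i).measurable.comp hX).aestronglyMeasurable
      (.of_forall fun x => by rw [Real.norm_of_nonneg (hχ0 i _)]; exact hχi1 i hi _)
  -- With this factor the product of the two cells carries mass min(a_i, b_i), the most that both
  -- marginals allow. If one cell is empty, division by zero gives 0, as wanted.
  set k : ℕ → ℝ := fun i => min (a i) (b i) / (a i * b i) with hk
  have hk0 : ∀ i, 0 ≤ k i := fun i =>
    div_nonneg (le_min (ha0 i) (hb0 i)) (mul_nonneg (ha0 i) (hb0 i))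
  have hkb : ∀ i, k i * b i ≤ 1 := fun i => by
    by_cases hA : a i = 0
    · simp [hk, hA]
    by_cases hB : b i = 0
    · simp [hB]
    have hA' : 0 < a i := lt_of_le_of_ne (ha0 i) (Ne.symm hA)
    have : k i * b i = min (a i) (b i) / a i := by simp only [hk]; field_simp
    rw [this, div_le_one hA']
    exact min_le_left _ _
  have hka : ∀ i, k i * a i ≤ 1 := fun i => by
    by_cases hA : a i = 0
    · simp [hA]
    by_cases hB : b i = 0
    · simp [hk, hB]
    have hB' : 0 < b i := lt_of_le_of_ne (hb0 i) (Ne.symm hB)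
    have : k i * a i = min (a i) (b i) / b i := by simp only [hk]; field_simp
    rw [this, div_le_one hB']
    exact min_le_right _ _
  have hkab : ∀ i, k i * a i * b i = min (a i) (b i) := fun i => by
    by_cases hA : a i = 0
    · simp [hA, hb0 i]
    by_cases hB : b i = 0
    · simp [hB, ha0 i]
    simp only [hk]; field_simp
  -- p and q are the densities of what the cells leave uncoupled on each side; both have total mass
  -- l.
  set p : Eucl d → ℝ := fun x => 1 - ∑ i ∈ Finset.range N, k i * b i * χ i x with hp
  set q : Eucl d → ℝ := fun y => 1 - ∑ i ∈ Finset.range N, k i * a i * χ i (X y) with hq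
  have hp0 : ∀ x, 0 ≤ p x := fun x => by
    have : ∑ i ∈ Finset.range N, k i * b i * χ i x ≤ ∑ i ∈ Finset.range N, χ i x :=
      Finset.sum_le_sum fun i _ => mul_le_of_le_one_left (hχ0 i x) (hkb i)
    simp only [hp]; linarith [hχ1 x]
  have hq0 : ∀ x, 0 ≤ q x := fun x => by
    have : ∑ i ∈ Finset.range N, k i * a i * χ i (X x) ≤ ∑ i ∈ Finset.range N, χ i (X x) :=
      Finset.sum_le_sum fun i _ => mul_le_of_le_one_left (hχ0 i _) (hka i)
    simp only [hq]; linarith [hχ1 (X x)]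
  have hp1 : ∀ x, p x ≤ 1 := fun x => by
    have : 0 ≤ ∑ i ∈ Finset.range N, k i * b i * χ i x :=
      Finset.sum_nonneg fun i _ => mul_nonneg (mul_nonneg (hk0 i) (hb0 i)) (hχ0 i x)
    simp only [hp]; linarith
  have hpc : Continuous p := by fun_prop
  have hqm : Measurable q := by
    have : ∀ i, Measurable fun y => χ i (X y) := fun i => (hχc i).measurable.comp hX
    fun_prop
  set l : ℝ := 1 - ∑ i ∈ Finset.range N, min (a i) (b i) with hl
  have isum : Integrable (fun x => ∑ i ∈ Finset.range N, k i * b i * χ i x) ρ :=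
    integrable_finsetSum _ fun i hi => (iχ i hi).const_mul _
  have isumX : Integrable (fun y => ∑ i ∈ Finset.range N, k i * a i * χ i (X y)) m :=
    integrable_finsetSum _ fun i hi => (iχX i hi).const_mul _
  have ip : Integrable p ρ := (integrable_const 1).sub isum
  have iq : Integrable q m := (integrable_const 1).sub isumX
  have hpI : ∫ x, p x ∂ρ = l := by
    simp only [hp]
    rw [integral_sub (integrable_const 1) isum,
      integral_finsetSum _ fun i hi => (iχ i hi).const_mul _]
    simp only [integral_const, probReal_univ, smul_eq_mul, mul_one, integral_const_mul, hl]
    congr 1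
    refine Finset.sum_congr rfl fun i _ => ?_
    rw [← hkab i]; simp only [ha]; ring
  have hqI : ∫ y, q y ∂m = l := by
    simp only [hq]
    rw [integral_sub (integrable_const 1) isumX,
      integral_finsetSum _ fun i hi => (iχX i hi).const_mul _]
    simp only [integral_const, probReal_univ, smul_eq_mul, mul_one, integral_const_mul, hl]
    congr 1
    refine Finset.sum_congr rfl fun i _ => ?_
    rw [← hkab i]
  have hl0 : 0 ≤ l := hpI ▸ integral_nonneg hp0
  have hsumb : ∑ i ∈ Finset.range N, b i = 1 := by
    simp only [hb]
    rw [← integral_finsetSum _ iχX, integral_congr_ae (g := fun _ => (1 : ℝ))]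
    · simp
    · filter_upwards [hXR] with y hy using hχR _ hy
  -- The b_i sum to 1 because X takes values in the ball almost surely, so l = Σ(b_i − min(a_i,
  -- b_i)).
  have hlΛ : l ≤ Λ := by
    refine le_trans ?_ hΛ
    rw [hl, ← hsumb, ← Finset.sum_sub_distrib]
    refine Finset.sum_le_sum fun i _ => ?_
    rcases min_cases (a i) (b i) with h | h
    · rw [h.1, abs_sub_comm]; exact le_abs_self _
    · rw [h.1, sub_self]; exact abs_nonneg _
  -- When l = 0 the factor l⁻¹ is 0, but then the leftover density vanishes almost everywhere, so
  -- the marginals are still correct.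
  have hpl : ∀ᵐ x ∂ρ, l⁻¹ * p x * l = p x := by
    by_cases h : l = 0
    · have : p =ᵐ[ρ] 0 := (integral_eq_zero_iff_of_nonneg hp0 ip).1 (hpI.trans h)
      filter_upwards [this] with x hx
      simp [hx]
    · exact .of_forall fun x => by field_simp
  have hql : ∀ᵐ y ∂m, l⁻¹ * q y * l = q y := by
    by_cases h : l = 0
    · have : q =ᵐ[m] 0 := (integral_eq_zero_iff_of_nonneg hq0 iq).1 (hqI.trans h)
      filter_upwards [this] with x hx
      simp [hx]
    · exact .of_forall fun x => by field_simp
  -- Density of the plan with respect to the product: cell to cell, and the leftovers by their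
  -- normalized product.
  set D : Eucl d × Eucl d → ℝ := fun z =>
    ∑ i ∈ Finset.range N, k i * (χ i z.1 * χ i (X z.2)) + l⁻¹ * (p z.1 * q z.2) with hD
  have hD0 : ∀ z, 0 ≤ D z := fun z => add_nonneg
    (Finset.sum_nonneg fun i _ => mul_nonneg (hk0 i) (mul_nonneg (hχ0 _ _) (hχ0 _ _)))
    (mul_nonneg (inv_nonneg.2 hl0) (mul_nonneg (hp0 _) (hq0 _)))
  have hDm : Measurable D := by
    have h1 : ∀ i, Measurable fun y => χ i (X y) := fun i => (hχc i).measurable.comp hX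
    have h2 : ∀ i, Measurable (χ i) := fun i => (hχc i).measurable
    have h3 : Measurable p := hpc.measurable
    refine (Finset.measurable_sum _ fun i _ => ?_).add (measurable_const.mul
      ((h3.comp measurable_fst).mul (hqm.comp measurable_snd)))
    exact measurable_const.mul (((h2 i).comp measurable_fst).mul ((h1 i).comp measurable_snd))
  have hDE : Measurable fun z => ENNReal.ofReal (D z) := hDm.ennreal_ofReal
  refine ⟨(ρ.prod m).withDensity fun z => ENNReal.ofReal (D z), map_fst_withDensity hDE ?_,
    map_snd_withDensity hDE ?_, ?_⟩
  · filter_upwards [hpl] with x hx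
    have i1 : Integrable (fun y => ∑ i ∈ Finset.range N, k i * (χ i x * χ i (X y))) m :=
      integrable_finsetSum _ fun i hi => ((iχX i hi).const_mul _).const_mul _
    have i2 : Integrable (fun y => l⁻¹ * (p x * q y)) m := (iq.const_mul _).const_mul _
    rw [← ofReal_integral_eq_lintegral_ofReal (by exact i1.add i2) (.of_forall fun y => hD0 (x, y))]
    simp only [hD]
    rw [integral_add i1 i2, integral_finsetSum _ fun i hi => ((iχX i hi).const_mul _).const_mul _]
    simp only [integral_const_mul, hqI]
    rw [← mul_assoc, hx]
    have : ∑ i ∈ Finset.range N, k i * (χ i x * ∫ y, χ i (X y) ∂m) = 1 - p x := by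
      simp only [hp, sub_sub_cancel]
      exact Finset.sum_congr rfl fun i _ => by simp only [hb]; ring
    rw [this]; simp
  · filter_upwards [hql] with y hy
    have i1 : Integrable (fun x => ∑ i ∈ Finset.range N, k i * (χ i x * χ i (X y))) ρ :=
      integrable_finsetSum _ fun i hi => ((iχ i hi).mul_const _).const_mul _
    have i2 : Integrable (fun x => l⁻¹ * (p x * q y)) ρ := (ip.mul_const _).const_mul _
    rw [← ofReal_integral_eq_lintegral_ofReal (by exact i1.add i2) (.of_forall fun x => hD0 (x, y))]
    simp only [hD]
    rw [integral_add i1 i2, integral_finsetSum _ fun i hi => ((iχ i hi).mul_const _).const_mul _]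
    simp only [integral_const_mul, integral_mul_const, hpI]
    rw [show l⁻¹ * (l * q y) = l⁻¹ * q y * l by ring, hy]
    have : ∑ i ∈ Finset.range N, k i * ((∫ x, χ i x ∂ρ) * χ i (X y)) = 1 - q y := by
      simp only [hq, sub_sub_cancel]
      exact Finset.sum_congr rfl fun i _ => by simp only [ha]; ring
    rw [this]; simp
  · have h2 : Integrable (fun x => ‖x‖ ^ 2) ρ := by
      refine ((integrable_const (1 : ℝ)).add h4).mono' (by fun_prop) (.of_forall fun x => ?_)
      rw [Real.norm_of_nonneg (by positivity)]
      simp only [Pi.add_apply]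
      nlinarith [sq_nonneg (‖x‖ ^ 2 - 1), sq_nonneg (‖x‖ ^ 2)]
    have i3 : Integrable (fun x => (2 * ‖x‖ ^ 2 + 2 * R ^ 2) * p x) ρ :=
      ((h2.const_mul 2).add (integrable_const _)).mono'
        ((by fun_prop : Continuous fun x => (2 * ‖x‖ ^ 2 + 2 * R ^ 2) * p x).aestronglyMeasurable)
        (.of_forall fun x => by
          rw [Real.norm_of_nonneg (mul_nonneg (by positivity) (hp0 x))]
          exact mul_le_of_le_one_right (by positivity) (hp1 x))
    set B : Eucl d × Eucl d → ℝ := fun z =>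
      16 * r ^ 2 * ∑ i ∈ Finset.range N, k i * (χ i z.1 * χ i (X z.2)) +
        l⁻¹ * ((2 * ‖z.1‖ ^ 2 + 2 * R ^ 2) * p z.1 * q z.2) with hB
    have hle : ∀ᵐ z ∂(ρ.prod m), D z * ‖z.1 - X z.2‖ ^ 2 ≤ B z := by
      have hae : ∀ᵐ z ∂(ρ.prod m), ‖X z.2‖ ≤ R :=
        Measure.quasiMeasurePreserving_snd.ae hXR
      filter_upwards [hae] with z hz
      simp only [hD, hB]
      rw [add_mul]
      refine add_le_add ?_ ?_
      · rw [Finset.sum_mul, Finset.mul_sum]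
        refine Finset.sum_le_sum fun i _ => ?_
        by_cases h : χ i z.1 = 0
        · simp [h]
        by_cases h' : χ i (X z.2) = 0
        · simp [h']
        have h1 := hχd i _ _ h h'
        have h3 : ‖z.1 - X z.2‖ ^ 2 ≤ 16 * r ^ 2 := by nlinarith [norm_nonneg (z.1 - X z.2)]
        rw [mul_comm]
        exact mul_le_mul_of_nonneg_right h3 (mul_nonneg (hk0 i) (mul_nonneg (hχ0 _ _) (hχ0 _ _)))
      · have h1 := norm_sub_le z.1 (X z.2)
        have h3 : ‖z.1 - X z.2‖ ^ 2 ≤ 2 * ‖z.1‖ ^ 2 + 2 * R ^ 2 := by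
          nlinarith [norm_nonneg (z.1 - X z.2), sq_nonneg (‖z.1‖ - ‖X z.2‖), norm_nonneg (X z.2)]
        have h5 : 0 ≤ l⁻¹ * (p z.1 * q z.2) :=
          mul_nonneg (inv_nonneg.2 hl0) (mul_nonneg (hp0 _) (hq0 _))
        calc _ ≤ l⁻¹ * (p z.1 * q z.2) * (2 * ‖z.1‖ ^ 2 + 2 * R ^ 2) := by gcongr
          _ = _ := by ring
    have iB1 : Integrable (fun z : Eucl d × Eucl d =>
        ∑ i ∈ Finset.range N, k i * (χ i z.1 * χ i (X z.2))) (ρ.prod m) :=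
      integrable_finsetSum _ fun i hi => ((iχ i hi).mul_prod (iχX i hi)).const_mul _
    have iB2 : Integrable (fun z : Eucl d × Eucl d =>
        (2 * ‖z.1‖ ^ 2 + 2 * R ^ 2) * p z.1 * q z.2) (ρ.prod m) := i3.mul_prod iq
    have iB : Integrable B (ρ.prod m) := (iB1.const_mul _).add (iB2.const_mul _)
    have hIB : ∫ z, B z ∂(ρ.prod m) ≤ 16 * r ^ 2 + 2 * R ^ 2 * Λ + s * M + Λ / s := by
      simp only [hB]
      rw [integral_add (iB1.const_mul _) (iB2.const_mul _), integral_const_mul, integral_const_mul,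
        integral_finsetSum _ fun i hi => ((iχ i hi).mul_prod (iχX i hi)).const_mul _,
        integral_prod_mul (fun x => (2 * ‖x‖ ^ 2 + 2 * R ^ 2) * p x) q, hqI]
      have e1 : ∑ i ∈ Finset.range N, ∫ z : Eucl d × Eucl d, k i * (χ i z.1 * χ i (X z.2))
          ∂(ρ.prod m) = 1 - l := by
        rw [hl, sub_sub_cancel]
        refine Finset.sum_congr rfl fun i _ => ?_
        rw [integral_const_mul, integral_prod_mul (χ i) (fun y => χ i (X y)), ← hkab i, mul_assoc]
      rw [e1]
      set Q := ∫ x, (2 * ‖x‖ ^ 2 + 2 * R ^ 2) * p x ∂ρ with hQ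
      have hQ0 : 0 ≤ Q := integral_nonneg fun x => mul_nonneg (by positivity) (hp0 x)
      have hQl : l⁻¹ * (Q * l) ≤ Q := by
        by_cases h : l = 0
        · simp [h, hQ0]
        · rw [show l⁻¹ * (Q * l) = Q by field_simp]
      have hQle : Q ≤ s * M + l / s + 2 * R ^ 2 * l := by
        have : Q ≤ ∫ x, (s * ‖x‖ ^ 4 + (1 / s + 2 * R ^ 2) * p x) ∂ρ := by
          refine integral_mono i3 ((h4.const_mul s).add (ip.const_mul _)) fun x => ?_
          show (2 * ‖x‖ ^ 2 + 2 * R ^ 2) * p x ≤ s * ‖x‖ ^ 4 + (1 / s + 2 * R ^ 2) * p x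
          -- Young's inequality with parameter s trades the second moment of the leftover for s
          -- times the fourth moment plus its mass over s; p ≤ 1 gives p² ≤ p.
          have h5 : 2 * ‖x‖ ^ 2 * p x ≤ s * ‖x‖ ^ 4 + 1 / s * p x := by
            have h6 : 2 * ‖x‖ ^ 2 * p x ≤ s * ‖x‖ ^ 4 + 1 / s * p x ^ 2 := by
              have h7 : 0 ≤ 1 / s * (s * ‖x‖ ^ 2 - p x) ^ 2 := by positivity
              have h8 : 1 / s * (s * ‖x‖ ^ 2 - p x) ^ 2 =
                s * ‖x‖ ^ 4 + 1 / s * p x ^ 2 - 2 * ‖x‖ ^ 2 * p x := by field_simp; ring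
              linarith
            have h9 : 1 / s * p x ^ 2 ≤ 1 / s * p x := by
              have := hp0 x
              have := hp1 x
              gcongr
              nlinarith
            linarith
          linarith
        rw [integral_add (h4.const_mul s) (ip.const_mul _), integral_const_mul, integral_const_mul,
          hpI] at this
        have h5 : s * ∫ x, ‖x‖ ^ 4 ∂ρ ≤ s * M := by gcongr
        calc Q ≤ _ := this
          _ ≤ s * M + (1 / s + 2 * R ^ 2) * l := by linarith
          _ = _ := by ring
      have h5 : 16 * r ^ 2 * (1 - l) ≤ 16 * r ^ 2 := by nlinarith [sq_nonneg r]
      have h6 : l / s ≤ Λ / s := by gcongr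
      have h7 : 2 * R ^ 2 * l ≤ 2 * R ^ 2 * Λ := by gcongr
      linarith
    rw [lintegral_withDensity_eq_lintegral_mul _ hDE (by fun_prop)]
    refine le_trans ?_ (ENNReal.ofReal_le_ofReal hIB)
    rw [ofReal_integral_eq_lintegral_ofReal iB (by
      filter_upwards [hle] with z hz
      exact (mul_nonneg (hD0 z) (by positivity)).trans hz)]
    refine lintegral_mono_ae ?_
    filter_upwards [hle] with z hz
    rw [Pi.mul_apply, ← ENNReal.ofReal_mul (hD0 z)]
    exact ENNReal.ofReal_le_ofReal hz

/-- Closeness against finitely many Lipschitz test functions yields a coupling of small quadratic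
cost. -/
lemma exists_coupling_of_test (d : ℕ) {R M κ : ℝ} (hR : 0 ≤ R) (hM : 0 ≤ M) (hκ : 0 < κ) :
    ∃ K R' ζ : ℝ, 0 ≤ K ∧ 0 < ζ ∧ ∀ (ρ m : Measure (Eucl d)) [IsProbabilityMeasure ρ]
      [IsProbabilityMeasure m] (X : Eucl d → Eucl d), Measurable X → (∀ᵐ y ∂m, ‖X y‖ ≤ R) →
      Integrable (fun x => ‖x‖ ^ 4) ρ → ∫ x, ‖x‖ ^ 4 ∂ρ ≤ M →
      (∀ φ : Eucl d → ℝ, (∀ x y, |φ x - φ y| ≤ K * ‖x - y‖) → (∀ x, R' < ‖x‖ → φ x = 0) →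
        |∫ x, φ x ∂ρ - ∫ y, φ (X y) ∂m| ≤ ζ) →
      ∃ γ : Measure (Eucl d × Eucl d), γ.map Prod.fst = ρ ∧ γ.map Prod.snd = m ∧
        ∫⁻ p, ENNReal.ofReal (‖p.1 - X p.2‖ ^ 2) ∂γ ≤ ENNReal.ofReal κ := by
  -- Each of 16r², sM and the terms in Λ is to be at most κ/4. The number N of cells depends only on
  -- d, R and r, so the resulting K, R', ζ are uniform over all ρ, m and X.
  set r := √κ / 8 with hr
  have hr0 : 0 < r := by positivity
  have hr2 : 16 * r ^ 2 = κ / 4 := by rw [hr, div_pow, Real.sq_sqrt hκ.le]; ring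
  obtain ⟨N, χ, h0, h1, hRR, hlip, hd, hsupp⟩ := exists_cells (d := d) hR hr0
  set s := κ / (4 * (M + 1)) with hs
  have hs0 : 0 < s := by positivity
  have hsM : s * M ≤ κ / 4 := by
    have : s * (M + 1) = κ / 4 := by rw [hs]; field_simp
    nlinarith
  set ζ := κ / (4 * ((N + 1) * (2 * R ^ 2 + 1 / s))) with hζ
  have hζ0 : 0 < ζ := by positivity
  refine ⟨2 / r, R + 2 * r, ζ, by positivity, hζ0, ?_⟩
  intro ρ m _ _ X hX hXR h4 h4M htest
  obtain ⟨γ, g1, g2, g3⟩ := exists_coupling_of_cells (ρ := ρ) (m := m) (N := N) (χ := χ) (Λ := N * ζ)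
    (r := r) (s := s) hs0 (fun i => continuous_of_lipschitz (hlip i)) h0 h1 hRR hd hX hXR h4 h4M (by
      refine (Finset.sum_le_card_nsmul _ _ ζ fun i _ => htest _ (hlip i) (hsupp i)).trans ?_
      simp)
  refine ⟨γ, g1, g2, g3.trans (ENNReal.ofReal_le_ofReal ?_)⟩
  have : (2 * R ^ 2 + 1 / s) * (N * ζ) ≤ κ / 4 := by
    have e : (2 * R ^ 2 + 1 / s) * ((N + 1) * ζ) = κ / 4 := by rw [hζ]; field_simp
    have : 0 ≤ (2 * R ^ 2 + 1 / s) * ζ := by positivity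
    nlinarith
  have e2 : 2 * R ^ 2 * (N * ζ) + N * ζ / s = (2 * R ^ 2 + 1 / s) * (N * ζ) := by ring
  linarith

end Cells

/-! ### Representation by the flow and uniform `W2` convergence. -/

section Convergence

variable {d : ℕ} {T : ℝ}

lemma exists_bump (d : ℕ) {δ : ℝ} (hδ : 0 < δ) : ∃ η : ContDiffBump (0 : Eucl d), η.rOut = δ :=
  ⟨⟨δ / 2, δ, by positivity, by linarith⟩, rfl⟩

/-- Indicators of compact sets are limits of the functions max(0, 1 − (n+1)dist(·,S)); inner
regularity then reaches all measurable sets. -/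
lemma measure_eq_of_lipschitz_test {ρ ν : Measure (Eucl d)} [IsProbabilityMeasure ρ]
    [IsProbabilityMeasure ν]
    (h : ∀ (φ : Eucl d → ℝ) (K R : ℝ), 0 ≤ K → (∀ x y, |φ x - φ y| ≤ K * ‖x - y‖) →
      (∀ x, R < ‖x‖ → φ x = 0) → ∫ x, φ x ∂ρ = ∫ x, φ x ∂ν) : ρ = ν := by
  have hcpt : ∀ S : Set (Eucl d), IsCompact S → ρ S = ν S := by
    intro S hS
    rcases S.eq_empty_or_nonempty with rfl | hne
    · simp
    obtain ⟨R, hR⟩ := hS.isBounded.exists_norm_le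
    let φ : ℕ → Eucl d → ℝ := fun n x => max 0 (1 - (n + 1) * Metric.infDist x S)
    have hφl : ∀ (n : ℕ) (x y : Eucl d), |φ n x - φ n y| ≤ ((n : ℝ) + 1) * ‖x - y‖ := by
      intro n x y
      have h0 : 0 ≤ ((n : ℝ) + 1) * ‖x - y‖ := by positivity
      refine (abs_max_sub_max_le_max _ _ _ _).trans (max_le (by simpa using h0) ?_)
      rw [sub_sub_sub_cancel_left, ← mul_sub, abs_mul, abs_of_pos (by positivity : 0 < (n : ℝ) + 1)]
      gcongr
      have := (Metric.lipschitz_infDist_pt S).dist_le_mul y x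
      rw [Real.dist_eq] at this
      simpa [dist_eq_norm, norm_sub_rev] using this
    have hφ0 : ∀ n x, 0 ≤ φ n x ∧ φ n x ≤ 1 := fun n x => by
      refine ⟨le_max_left _ _, max_le zero_le_one ?_⟩
      have : 0 ≤ ((n : ℝ) + 1) * Metric.infDist x S := mul_nonneg (by positivity) Metric.infDist_nonneg
      linarith
    have hφR : ∀ n x, R + 1 < ‖x‖ → φ n x = 0 := by
      intro n x hx
      refine max_eq_left ?_
      have h1 : 1 ≤ Metric.infDist x S := by
        rw [Metric.le_infDist hne]
        intro y hy
        have := hR y hy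
        have h2 := norm_sub_norm_le x y
        rw [dist_eq_norm]; linarith
      nlinarith [Nat.cast_nonneg (α := ℝ) n]
    have hlim : ∀ x, Tendsto (fun n => φ n x) atTop (𝓝 (S.indicator (fun _ => (1 : ℝ)) x)) := by
      intro x
      by_cases hx : x ∈ S
      · rw [indicator_of_mem hx]
        refine tendsto_const_nhds.congr fun n => ?_
        simp [φ, Metric.infDist_zero_of_mem hx]
      · rw [indicator_of_notMem hx]
        have hpos : 0 < Metric.infDist x S := (hS.isClosed.notMem_iff_infDist_pos hne).1 hx
        refine tendsto_const_nhds.congr' ?_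
        obtain ⟨N, hN⟩ := exists_nat_ge (1 / Metric.infDist x S)
        filter_upwards [eventually_ge_atTop N] with n hn
        refine (max_eq_left ?_).symm
        rw [div_le_iff₀ hpos] at hN
        have : (N : ℝ) ≤ n := by exact_mod_cast hn
        nlinarith
    have hconv : ∀ (μ : Measure (Eucl d)) [IsProbabilityMeasure μ],
        Tendsto (fun n => ∫ x, φ n x ∂μ) atTop (𝓝 (μ.real S)) := by
      intro μ _
      have := tendsto_integral_of_dominated_convergence (μ := μ) (F := φ)
        (f := S.indicator fun _ => (1 : ℝ)) (fun _ => (1 : ℝ))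
        (fun n => (continuous_of_lipschitz (hφl n)).aestronglyMeasurable) (integrable_const _)
        (fun n => .of_forall fun x => by rw [Real.norm_of_nonneg (hφ0 n x).1]; exact (hφ0 n x).2)
        (.of_forall hlim)
      rwa [integral_indicator_const _ hS.measurableSet, smul_eq_mul, mul_one] at this
    have h1 := hconv ρ
    have h2 := hconv ν
    simp_rw [fun n => h (φ n) (n + 1) (R + 1) (by positivity) (hφl n) (hφR n)] at h1
    have := tendsto_nhds_unique h1 h2
    exact (measureReal_eq_measureReal_iff).1 this
  ext s hs
  rw [hs.measure_eq_iSup_isCompact_of_ne_top (measure_ne_top ρ s),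
    hs.measure_eq_iSup_isCompact_of_ne_top (measure_ne_top ν s)]
  refine iSup_congr fun K => iSup_congr fun _ => iSup_congr fun hK => hcpt K hK

/-- Without viscosity the duality error is O(δ), and the mollification radius δ may go to 0. The
blow-up of `bumpConst` is harmless because it is multiplied by ε = 0. -/
lemma meas_eq_map_flow {L C M : ℝ} {v : ℝ → Eucl d → Eucl d} {μ₀ : P2 d} {ρ : ℝ → P2 d}
    (hv : IsLipField T L C v) (hρ : IsWeakSolution T 0 (fun t x _ => v t x) μ₀ ρ)
    (hM : ∀ t ∈ Icc 0 T, (ρ t).m2 ≤ M) {t : ℝ} (ht : t ∈ Icc 0 T) :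
    (ρ t).meas = μ₀.meas.map (flow T v 0 t) := by
  have hc := hv.continuous_flow le_rfl ht
  have := Measure.isProbabilityMeasure_map (μ := μ₀.meas) hc.aemeasurable
  refine measure_eq_of_lipschitz_test fun φ K R hK hφ hφR => ?_
  rw [integral_map hc.aemeasurable (continuous_of_lipschitz hφ).aestronglyMeasurable]
  rw [← sub_eq_zero, ← abs_nonpos_iff]
  have hlim : Tendsto (fun δ => K * Real.exp (L * T) * (2 * δ + T * (L * δ))) (𝓝[>] 0) (𝓝 0) := by
    have : Continuous fun δ => K * Real.exp (L * T) * (2 * δ + T * (L * δ)) := by fun_prop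
    simpa using (this.tendsto 0).mono_left (nhdsWithin_le_nhds (s := Ioi 0))
  refine ge_of_tendsto hlim ?_
  filter_upwards [Ioc_mem_nhdsGT (zero_lt_one' ℝ)] with δ hδ
  obtain ⟨η, hη⟩ := exists_bump d hδ.1
  have h := abs_integral_sub_integral_flow_le (η := η) hv le_rfl hρ hM hK hφ hφR
    (by rw [hη]; exact hδ.2) ht
  rw [hη] at h
  simpa using h

/-- Pushing γ forward by (x,y) ↦ (x, Z y) gives a plan between ρ and ν, and |x − Zy|² ≤ 2|x − Xy|² +
2|Xy − Zy|². No triangle inequality for `W2` is needed. -/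
lemma W2_sq_le_of_coupling {ρ ν μ₀ : P2 d} {X Z : Eucl d → Eucl d} (hX : Measurable X)
    (hZ : Measurable Z) {γ : Measure (Eucl d × Eucl d)} (h1 : γ.map Prod.fst = ρ.meas)
    (h2 : γ.map Prod.snd = μ₀.meas) {κ S : ℝ} (hκ : 0 ≤ κ)
    (hcost : ∫⁻ p, ENNReal.ofReal (‖p.1 - X p.2‖ ^ 2) ∂γ ≤ ENNReal.ofReal κ)
    (hν : ν.meas = μ₀.meas.map Z) (hS : ∀ᵐ y ∂μ₀.meas, ‖X y - Z y‖ ≤ S) :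
    W2 ρ ν ^ 2 ≤ 2 * κ + 2 * S ^ 2 := by
  have hm : Measurable fun p : Eucl d × Eucl d => (p.1, Z p.2) := by fun_prop
  have hγ : γ.map (fun p => (p.1, Z p.2)) ∈ couplings ρ ν := by
    constructor
    · rw [Measure.map_map measurable_fst hm]; exact h1
    · rw [Measure.map_map measurable_snd hm, hν, ← h2, Measure.map_map hZ measurable_snd]; rfl
  have hprob : IsProbabilityMeasure γ := by
    have h : IsProbabilityMeasure (γ.map Prod.fst) := by rw [h1]; infer_instance
    exact (Measure.isProbabilityMeasure_map_iff measurable_fst.aemeasurable).1 h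
  refine (W2_sq_le hγ).trans ?_
  have hS' : ∀ᵐ p ∂γ, ‖X p.2 - Z p.2‖ ≤ S := by
    rw [← h2] at hS
    exact ae_of_ae_map measurable_snd.aemeasurable hS
  rw [← ENNReal.ofReal_le_ofReal_iff (by positivity), ← coupling_lintegral_eq hγ,
    lintegral_map (by fun_prop) hm]
  calc ∫⁻ p, ‖p.1 - Z p.2‖ₑ ^ 2 ∂γ
      ≤ ∫⁻ p, (ENNReal.ofReal 2 * ENNReal.ofReal (‖p.1 - X p.2‖ ^ 2) + ENNReal.ofReal (2 * S ^ 2)) ∂γ := by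
        refine lintegral_mono_ae ?_
        filter_upwards [hS'] with p hp
        rw [← ofReal_norm, ← ENNReal.ofReal_pow (norm_nonneg _),
          ← ENNReal.ofReal_mul (by norm_num), ← ENNReal.ofReal_add (by positivity) (by positivity)]
        refine ENNReal.ofReal_le_ofReal ?_
        have h3 := norm_sub_le_norm_sub_add_norm_sub p.1 (X p.2) (Z p.2)
        have h4 := norm_nonneg (p.1 - Z p.2)
        have h5 := norm_nonneg (X p.2 - Z p.2)
        nlinarith [sq_nonneg (‖p.1 - X p.2‖ - ‖X p.2 - Z p.2‖), norm_nonneg (p.1 - X p.2)]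
    _ = ENNReal.ofReal 2 * ∫⁻ p, ENNReal.ofReal (‖p.1 - X p.2‖ ^ 2) ∂γ + ENNReal.ofReal (2 * S ^ 2) := by
        rw [lintegral_add_right _ measurable_const, lintegral_const_mul _ (by fun_prop)]
        simp
    _ ≤ ENNReal.ofReal 2 * ENNReal.ofReal κ + ENNReal.ofReal (2 * S ^ 2) := by gcongr
    _ = ENNReal.ofReal (2 * κ + 2 * S ^ 2) := by
        rw [ENNReal.ofReal_add (by positivity) (by positivity), ← ENNReal.ofReal_mul (by norm_num)]

lemma isLipField_of_solution {L C M ε : ℝ} {b : ℝ → Eucl d → P2 d → Eucl d}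
    (hL : 0 ≤ L) (hC : 0 ≤ C) (hM : 0 ≤ M)
    (hb_time : ∀ (x : Eucl d) (μ : P2 d), ContinuousOn (fun t => b t x μ) (Ioo 0 T))
    (hb_lip : ∀ t ∈ Ioo 0 T, ∀ (μ ν : P2 d) (x y : Eucl d),
      ‖b t x μ - b t y ν‖ ≤ L * (W2 μ ν + ‖x - y‖))
    (hb : ∀ t ∈ Ioo 0 T, ∀ (x : Eucl d) (μ : P2 d),
      ‖b t x μ‖ ≤ C * (1 + ‖x‖ + ∫ y, ‖y‖ ∂μ.meas))
    {μ₀ : P2 d} {ρ : ℝ → P2 d} (hρ : IsWeakSolution T ε b μ₀ ρ)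
    (hρM : ∀ t ∈ Icc 0 T, (ρ t).m2 ≤ M) :
    IsLipField T L (C * (2 + M)) (fun t x => b t x (ρ t)) where
  L_nonneg := hL
  C_nonneg := by positivity
  time := by
    intro x t ht
    rw [ContinuousWithinAt, tendsto_iff_norm_sub_tendsto_zero]
    have h1 : Tendsto (fun s => L * W2 (ρ s) (ρ t) + ‖b s x (ρ t) - b t x (ρ t)‖)
        (𝓝[Ioo 0 T] t) (𝓝 0) := by
      have a1 := ((hρ.continuous t (Ioo_subset_Icc_self ht)).mono_left
        (nhdsWithin_mono t Ioo_subset_Icc_self)).const_mul L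
      have a2 := tendsto_iff_norm_sub_tendsto_zero.1 (hb_time x (ρ t) t ht)
      simpa using a1.add a2
    refine squeeze_zero' (.of_forall fun _ => norm_nonneg _) ?_ h1
    filter_upwards [self_mem_nhdsWithin] with s hs
    refine (norm_sub_le_norm_sub_add_norm_sub _ (b s x (ρ t)) _).trans ?_
    gcongr
    simpa using hb_lip s hs (ρ s) (ρ t) x x
  lip := fun t ht x y => by
    have h := hb_lip t ht (ρ t) (ρ t) x y
    -- Read off from continuity of the curve at t, evaluated at t itself.
    have h0 : W2 (ρ t) (ρ t) = 0 := by
      have h2 := hρ.continuous t (Ioo_subset_Icc_self ht)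
      have h3 := h2.mono_left (pure_le_nhdsWithin (Ioo_subset_Icc_self ht))
      exact tendsto_nhds_unique (tendsto_pure_nhds _ _) h3
    rwa [h0, zero_add] at h
  growth := fun t ht x => by
    refine (hb t ht x (ρ t)).trans ?_
    have hm : ∫ y, ‖y‖ ∂(ρ t).meas ≤ 1 + M := by
      have h1 := (ρ t).sq_integral_norm_le
      have h2 := hρM t (Ioo_subset_Icc_self ht)
      have h2' : ∫ x, ‖x‖ ^ 2 ∂(ρ t).meas = (ρ t).m2 := rfl
      nlinarith [sq_nonneg (∫ y, ‖y‖ ∂(ρ t).meas - 1)]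
    rw [mul_assoc]
    refine mul_le_mul_of_nonneg_left ?_ hC
    nlinarith [norm_nonneg x, mul_nonneg hM (norm_nonneg x)]

lemma W2_le_sqrt_of_sq_le {ρ ν : P2 d} {κ S : ℝ} (hS : 0 ≤ S) (hκ : 0 ≤ κ)
    (h : W2 ρ ν ^ 2 ≤ 2 * κ + 2 * S ^ 2) : W2 ρ ν ≤ √(2 * κ) + 2 * S := by
  refine abs_le_of_sq_le_sq' (a := W2 ρ ν) ?_ (by positivity) |>.2
  have h1 := Real.sq_sqrt (by positivity : 0 ≤ 2 * κ)
  have h2 := Real.sqrt_nonneg (2 * κ)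
  nlinarith [mul_nonneg h2 hS, sq_nonneg S]

/-- Comparison of the flows of two solutions whose fields depend on the solution. -/
lemma norm_flow_sub_flow_le {L C₁ C₂ R κ : ℝ} (hT : 0 ≤ T) {b : ℝ → Eucl d → P2 d → Eucl d}
    (hb_lip : ∀ t ∈ Ioo 0 T, ∀ (μ ν : P2 d) (x y : Eucl d),
      ‖b t x μ - b t y ν‖ ≤ L * (W2 μ ν + ‖x - y‖))
    {ρ ν : ℝ → P2 d} (hρ : IsLipField T L C₁ (fun t x => b t x (ρ t)))
    (hν : IsLipField T L C₂ (fun t x => b t x (ν t))) (hκ : 0 ≤ κ)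
    (hW : ∀ t ∈ Icc 0 T, ∀ S, 0 ≤ S → (∀ y, ‖y‖ ≤ R →
      ‖flow T (fun t x => b t x (ρ t)) 0 t y - flow T (fun t x => b t x (ν t)) 0 t y‖ ≤ S) →
      W2 (ρ t) (ν t) ≤ κ + 2 * S) :
    ∀ t ∈ Icc 0 T, ∀ y, ‖y‖ ≤ R →
      ‖flow T (fun t x => b t x (ρ t)) 0 t y - flow T (fun t x => b t x (ν t)) 0 t y‖ ≤
        2 * (L * κ * T) * Real.exp ((6 * L + 1) * T) := by
  set X := flow T (fun t x => b t x (ρ t)) 0 with hX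
  set Z := flow T (fun t x => b t x (ν t)) 0 with hZ
  have hL := hρ.L_nonneg
  -- If the flows differ by at most S = Be^{ls}, the velocities differ by at most L(κ + 2S + S).
  -- Since 3L·S = (B/2)·6L·e^{ls}, this rate produces the factor 1/2 of the self-improvement.
  set l := 6 * L + 1 with hl
  have hl0 : 0 < l := by positivity
  have h00 : (0 : ℝ) ∈ Icc 0 T := ⟨le_rfl, hT⟩
  intro t ht y hy
  have key := le_two_mul_of_self_improving (ι := Icc 0 T × {y : Eucl d // ‖y‖ ≤ R})
    (f := fun i => Real.exp (-(l * i.1)) * ‖X i.1 i.2 - Z i.1 i.2‖) (q := L * κ * T) ?_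
    (by positivity) ?_ (⟨t, ht⟩, ⟨y, hy⟩)
  · simp only at key
    rw [Real.exp_neg, inv_mul_le_iff₀ (Real.exp_pos _)] at key
    refine key.trans ?_
    rw [mul_comm]
    have := ht.2
    gcongr
  · refine ⟨(Real.exp (C₁ * T) + Real.exp (C₂ * T)) * (1 + R), fun i => ?_⟩
    have h1 := hρ.flow_growth le_rfl i.1.2 i.2
    have h2 := hν.flow_growth le_rfl i.1.2 i.2
    have h3 := norm_sub_le (X i.1 i.2) (Z i.1 i.2)
    have h4 : Real.exp (-(l * i.1)) ≤ 1 := Real.exp_le_one_iff.2 (by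
      have := i.1.2.1; nlinarith)
    have hi := i.2.2
    have h5 : Real.exp (C₁ * T) * (1 + ‖(i.2 : Eucl d)‖) ≤ Real.exp (C₁ * T) * (1 + R) := by gcongr
    have h6 : Real.exp (C₂ * T) * (1 + ‖(i.2 : Eucl d)‖) ≤ Real.exp (C₂ * T) * (1 + R) := by gcongr
    refine (mul_le_of_le_one_left (norm_nonneg _) h4).trans ?_
    change 1 + ‖X i.1 i.2‖ ≤ _ at h1
    change 1 + ‖Z i.1 i.2‖ ≤ _ at h2
    linarith
  · intro B hB hBi i
    have hBs : ∀ s ∈ Icc 0 T, ∀ y, ‖y‖ ≤ R → ‖X s y - Z s y‖ ≤ B * Real.exp (l * s) := by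
      intro s hs y hy
      have := hBi (⟨s, hs⟩, ⟨y, hy⟩)
      simp only at this
      rw [Real.exp_neg, inv_mul_le_iff₀ (Real.exp_pos _)] at this
      linarith
    have tX := hρ.flow_trajectory h00 (i.2 : Eucl d)
    have tZ := hν.flow_trajectory h00 (i.2 : Eucl d)
    have h := norm_image_sub_le_of_interior (f := fun s => X s i.2 - Z s i.2)
      (f' := fun s => b s (X s i.2) (ρ s) - b s (Z s i.2) (ν s))
      (B := fun s => L * κ * s + B / 2 * Real.exp (l * s))
      (B' := fun s => L * κ + B / 2 * (Real.exp (l * s) * l))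
      (tX.2.1.sub tZ.2.1) (fun s hs => (tX.2.2 s hs).sub (tZ.2.2 s hs)) (fun s => by
        have h1 : HasDerivAt (fun r => B / 2 * Real.exp (l * r))
            (B / 2 * (Real.exp (l * s) * l)) s := by
          simpa using (((hasDerivAt_id s).const_mul l).exp).const_mul (B / 2)
        have h2 : HasDerivAt (fun r => L * κ * r) (L * κ) s := by
          simpa using (hasDerivAt_id s).const_mul (L * κ)
        exact h2.add h1) (fun s hs => by
        have hs' := Ioo_subset_Icc_self hs
        have h1 := hb_lip s hs (ρ s) (ν s) (X s i.2) (Z s i.2)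
        have h2 := hW s hs' (B * Real.exp (l * s)) (by positivity) (hBs s hs')
        have h3 := hBs s hs' i.2 i.2.2
        refine h1.trans ?_
        calc L * (W2 (ρ s) (ν s) + ‖X s i.2 - Z s i.2‖)
            ≤ L * ((κ + 2 * (B * Real.exp (l * s))) + B * Real.exp (l * s)) := by gcongr
          _ = L * κ + B / 2 * (Real.exp (l * s) * (6 * L)) := by ring
          _ ≤ _ := by
            gcongr
            rw [hl]; linarith) i.1 i.1.2
    have e0 : X 0 (i.2 : Eucl d) - Z 0 (i.2 : Eucl d) = 0 := by
      rw [hX, hZ, hρ.flow_self h00, hν.flow_self h00, sub_self]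
    rw [e0, sub_zero] at h
    simp only [mul_zero, Real.exp_zero, mul_one, zero_add] at h
    rw [Real.exp_neg, inv_mul_le_iff₀ (Real.exp_pos _)]
    have h1 : 1 ≤ Real.exp (l * i.1) := Real.one_le_exp (by have := i.1.2.1; positivity)
    have h2 : L * κ * (i.1 : ℝ) ≤ L * κ * T := by
      have := i.1.2.2
      gcongr
    have h3 : L * κ * T ≤ Real.exp (l * i.1) * (L * κ * T) :=
      le_mul_of_one_le_left (by positivity) h1
    calc _ ≤ _ := h
      _ ≤ _ := by nlinarith

/-- Uniform convergence in `W₂` as the viscosity vanishes. -/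
theorem eventually_forall_W2_le (hT : 0 ≤ T) {L C M : ℝ} (hL : 0 ≤ L) (hC : 0 ≤ C) (hM : 0 ≤ M)
    {b : ℝ → Eucl d → P2 d → Eucl d}
    (hb_time : ∀ (x : Eucl d) (μ : P2 d), ContinuousOn (fun t => b t x μ) (Ioo 0 T))
    (hb_lip : ∀ t ∈ Ioo 0 T, ∀ (μ ν : P2 d) (x y : Eucl d),
      ‖b t x μ - b t y ν‖ ≤ L * (W2 μ ν + ‖x - y‖))
    (hb : ∀ t ∈ Ioo 0 T, ∀ (x : Eucl d) (μ : P2 d),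
      ‖b t x μ‖ ≤ C * (1 + ‖x‖ + ∫ y, ‖y‖ ∂μ.meas))
    {μ₀ : P2 d} (hμ₀ : ∃ K : Set (Eucl d), IsCompact K ∧ μ₀.meas Kᶜ = 0)
    (hmom : ∀ ε, 0 ≤ ε → ε ≤ 1 → ∀ ρ, IsWeakSolution T ε b μ₀ ρ → ∀ t ∈ Icc 0 T,
      (ρ t).m2 ≤ M ∧ Integrable (fun x => ‖x‖ ^ 4) (ρ t).meas ∧ ∫ x, ‖x‖ ^ 4 ∂(ρ t).meas ≤ M)
    {μ : ℝ → P2 d} (hμ : IsWeakSolution T 0 b μ₀ μ) {μe : ℝ → ℝ → P2 d}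
    (hμe : ∀ ε > 0, IsWeakSolution T ε b μ₀ (μe ε)) {κ : ℝ} (hκ : 0 < κ) :
    ∀ᶠ ε in 𝓝[>] 0, ∀ t ∈ Icc 0 T, W2 (μe ε t) (μ t) ≤ κ := by
  obtain ⟨S₀, hS₀, hS₀0⟩ := hμ₀
  obtain ⟨R₀', hR₀'⟩ := hS₀.isBounded.exists_norm_le
  set R₀ := max R₀' 0 with hR₀
  have hae : ∀ᵐ x ∂μ₀.meas, ‖x‖ ≤ R₀ := by
    refine measure_mono_null (fun x hx => ?_) hS₀0
    exact fun hxK => hx ((hR₀' x hxK).trans (le_max_left _ _))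
  have hR₀0 : 0 ≤ R₀ := le_max_right _ _
  set C₁ := C * (2 + M) with hC₁
  set R := Real.exp (C₁ * T) * (1 + R₀) with hR
  have hRnn : 0 ≤ R := by positivity
  -- E is the amplification of the initial error by the loop between `W2` and the flows; starting
  -- from κ/E ends exactly at κ.
  set E := 1 + 4 * (L * T) * Real.exp ((6 * L + 1) * T) with hE
  have hE0 : 0 < E := by positivity
  set κ₀ := (κ / E) ^ 2 / 2 with hκ₀
  have hκ₀0 : 0 < κ₀ := by positivity
  have hsq : √(2 * κ₀) = κ / E := by
    rw [hκ₀, mul_div_cancel₀ _ two_ne_zero, Real.sqrt_sq (by positivity)]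
  -- The order of choices matters: first the test class K and tolerance ζ, then the mollification
  -- radius δ, and only then ε, since `bumpConst η` depends on δ.
  obtain ⟨K, R', ζ, hK, hζ, hcoup⟩ := exists_coupling_of_test d hRnn hM hκ₀0
  have hvμ := isLipField_of_solution hL hC hM hb_time hb_lip hb hμ
    fun t ht => (hmom 0 le_rfl zero_le_one μ hμ t ht).1
  set P := K * Real.exp (L * T) with hP
  have hP0 : 0 ≤ P := by positivity
  obtain ⟨δ, hδ0, hδ1, hδ⟩ : ∃ δ : ℝ, 0 < δ ∧ δ ≤ 1 ∧ P * (2 * δ + T * (L * δ)) ≤ ζ / 2 := by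
    have hlim : Tendsto (fun δ => P * (2 * δ + T * (L * δ))) (𝓝[>] 0) (𝓝 0) := by
      have : Continuous fun δ => P * (2 * δ + T * (L * δ)) := by fun_prop
      simpa using (this.tendsto 0).mono_left (nhdsWithin_le_nhds (s := Ioi 0))
    obtain ⟨δ, h1, h2⟩ := ((hlim.eventually (ge_mem_nhds (half_pos hζ))).and
      (Ioc_mem_nhdsGT (zero_lt_one' ℝ))).exists
    exact ⟨δ, h2.1, h2.2, h1⟩
  obtain ⟨η, hη⟩ := exists_bump d hδ0
  have hεlim : ∀ᶠ ε in 𝓝[>] (0 : ℝ), P * (T * (ε * (d * bumpConst η))) ≤ ζ / 2 := by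
    have hlim : Tendsto (fun ε => P * (T * (ε * (d * bumpConst η)))) (𝓝[>] 0) (𝓝 0) := by
      have : Continuous fun ε => P * (T * (ε * (d * bumpConst η))) := by fun_prop
      simpa using (this.tendsto 0).mono_left (nhdsWithin_le_nhds (s := Ioi 0))
    exact hlim.eventually (ge_mem_nhds (half_pos hζ))
  filter_upwards [hεlim, Ioc_mem_nhdsGT (zero_lt_one' ℝ)] with ε hε hε01
  have hsol := hμe ε hε01.1
  have hmε := hmom ε hε01.1.le hε01.2 (μe ε) hsol
  have hvε := isLipField_of_solution hL hC hM hb_time hb_lip hb hsol fun t ht => (hmε t ht).1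
  set X := flow T (fun t x => b t x (μe ε t)) 0 with hX
  set Z := flow T (fun t x => b t x (μ t)) 0 with hZ
  -- The same curve, read as a solution of the linear equation with frozen measure argument.
  have hlinε : IsWeakSolution T ε (fun t x _ => b t x (μe ε t)) μ₀ (μe ε) :=
    ⟨hsol.continuous, hsol.initial, hsol.equation⟩
  have hlin : IsWeakSolution T 0 (fun t x _ => b t x (μ t)) μ₀ μ :=
    ⟨hμ.continuous, hμ.initial, hμ.equation⟩
  have hW : ∀ t ∈ Icc 0 T, ∀ S, 0 ≤ S → (∀ y, ‖y‖ ≤ R₀ → ‖X t y - Z t y‖ ≤ S) →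
      W2 (μe ε t) (μ t) ≤ κ / E + 2 * S := by
    intro t ht S hS hXZ
    have hXm : Measurable (X t) := (hvε.continuous_flow le_rfl ht).measurable
    have hZm : Measurable (Z t) := (hvμ.continuous_flow le_rfl ht).measurable
    obtain ⟨γ, g1, g2, g3⟩ := hcoup (μe ε t).meas μ₀.meas (X t) hXm (by
      filter_upwards [hae] with y hy
      have h1 := hvε.flow_growth le_rfl ht y
      have h2 : Real.exp (C₁ * T) * (1 + ‖y‖) ≤ R := by rw [hR]; gcongr
      change 1 + ‖X t y‖ ≤ _ at h1
      linarith) (hmε t ht).2.1 (hmε t ht).2.2 (fun φ hφ hφR => by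
      refine (abs_integral_sub_integral_flow_le (η := η) hvε hε01.1.le hlinε
        (fun t ht => (hmε t ht).1) hK hφ hφR (by rw [hη]; exact hδ1) ht).trans ?_
      rw [hη]
      have e : K * Real.exp (L * T) * (2 * δ + T * (L * δ + ε * (d * bumpConst η))) =
          P * (2 * δ + T * (L * δ)) + P * (T * (ε * (d * bumpConst η))) := by rw [hP]; ring
      rw [e]; linarith)
    have hsqle := W2_sq_le_of_coupling hXm hZm g1 g2 hκ₀0.le g3
      (meas_eq_map_flow hvμ hlin
        (fun t ht => (hmom 0 le_rfl zero_le_one μ hμ t ht).1) ht) (S := S) (by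
        filter_upwards [hae] with y hy using hXZ y hy)
    have := W2_le_sqrt_of_sq_le hS hκ₀0.le hsqle
    rwa [hsq] at this
  have hflow := norm_flow_sub_flow_le (R := R₀) hT hb_lip hvε hvμ
    (by positivity : 0 ≤ κ / E) hW
  intro t ht
  have h := hW t ht (2 * (L * (κ / E) * T) * Real.exp ((6 * L + 1) * T)) (by positivity)
    (hflow t ht)
  refine h.trans (le_of_eq ?_)
  rw [show κ / E + 2 * (2 * (L * (κ / E) * T) * Real.exp ((6 * L + 1) * T)) = κ / E * E by
    rw [hE]; ring]
  field_simp

end Convergence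

/-! ### Quadratic costs at a fixed time. -/

variable {d : ℕ} {T : ℝ}

/-- The quadratic cost at a fixed time, with feedback `v`. -/
def quadCost (Q R S Qb : Eucl d →L[ℝ] Eucl d) (v : Eucl d → Eucl d) (ν : P2 d) (x : Eucl d) : ℝ :=
  (1 / 2) * (inner ℝ x (Q x) + inner ℝ (v x) (R (v x)) +
    inner ℝ (x - S (barycenter ν)) (Qb (x - S (barycenter ν))))

lemma QuadraticCost.running_eq (c : QuadraticCost d T) (t : ℝ) (ν : P2 d) (v : Eucl d → Eucl d)
    (x : Eucl d) :
    c.running t x ν (v x) = quadCost (c.Q t) (c.R t) (c.S t) (c.Qbar t) v ν x := rfl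

lemma QuadraticCost.final_eq (c : QuadraticCost d T) (ν : P2 d) (x : Eucl d) :
    c.final x ν = quadCost c.QT 0 c.ST c.QbarT 0 ν x := by
  simp [QuadraticCost.final, quadCost]

lemma abs_inner_apply_le (A : Eucl d →L[ℝ] Eucl d) (x : Eucl d) :
    |inner ℝ x (A x)| ≤ ‖A‖ * ‖x‖ ^ 2 := by
  refine (abs_real_inner_le_norm _ _).trans ?_
  have := mul_le_mul_of_nonneg_left (A.le_opNorm x) (norm_nonneg x)
  linarith

lemma abs_inner_apply_sub_le (A : Eucl d →L[ℝ] Eucl d) (x y : Eucl d) :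
    |inner ℝ x (A x) - inner ℝ y (A y)| ≤ ‖A‖ * (‖x‖ + ‖y‖) * ‖x - y‖ := by
  have h : inner ℝ x (A x) - inner ℝ y (A y) = inner ℝ (x - y) (A x) + inner ℝ y (A (x - y)) := by
    simp [inner_sub_left, inner_sub_right]
  rw [h]
  refine (abs_add_le _ _).trans ?_
  have h1 := (abs_real_inner_le_norm (x - y) (A x)).trans
    (mul_le_mul_of_nonneg_left (A.le_opNorm x) (norm_nonneg _))
  have h2 := (abs_real_inner_le_norm y (A (x - y))).trans
    (mul_le_mul_of_nonneg_left (A.le_opNorm (x - y)) (norm_nonneg _))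
  linarith

lemma QuadLip.quadratic_form (A : Eucl d →L[ℝ] Eucl d) {v : Eucl d → Eucl d} {l k : ℝ}
    (hk : 0 ≤ k) (hl : ∀ x y, ‖v x - v y‖ ≤ l * ‖x - y‖)
    (hv : ∀ x, ‖v x‖ ≤ k * (1 + ‖x‖)) :
    QuadLip (2 * ‖A‖ * k * l) (fun x => inner ℝ (v x) (A (v x))) := fun x y => by
  refine (abs_inner_apply_sub_le A _ _).trans ?_
  calc ‖A‖ * (‖v x‖ + ‖v y‖) * ‖v x - v y‖
      ≤ ‖A‖ * (2 * k * (1 + ‖x‖ + ‖y‖)) * (l * ‖x - y‖) := by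
        gcongr
        · nlinarith [hv x, hv y, norm_nonneg x, norm_nonneg y, mul_nonneg hk (norm_nonneg x),
            mul_nonneg hk (norm_nonneg y)]
        · exact hl x y
    _ = _ := by ring

lemma QuadLip.add {K K' : ℝ} {f g : Eucl d → ℝ} (hf : QuadLip K f) (hg : QuadLip K' g) :
    QuadLip (K + K') (fun x => f x + g x) := fun x y => by
  rw [add_sub_add_comm, add_mul, add_mul]
  exact (norm_add_le _ _).trans (add_le_add (hf x y) (hg x y))

lemma QuadLip.const_mul {K : ℝ} {f : Eucl d → ℝ} (hf : QuadLip K f) (a : ℝ) :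
    QuadLip (|a| * K) (fun x => a * f x) := fun x y => by
  rw [← mul_sub, norm_mul, Real.norm_eq_abs, mul_assoc, mul_assoc, ← mul_assoc K]
  exact mul_le_mul_of_nonneg_left (hf x y) (abs_nonneg _)

lemma exists_quadLip_quadCost (Q R S Qb : Eucl d →L[ℝ] Eucl d) {v : Eucl d → Eucl d} {l k : ℝ}
    (hl : ∀ x y, ‖v x - v y‖ ≤ l * ‖x - y‖) (hv : ∀ x, ‖v x‖ ≤ k * (1 + ‖x‖)) (ν : P2 d) :
    ∃ K, 0 ≤ K ∧ QuadLip K (quadCost Q R S Qb v ν) := by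
  have hk : 0 ≤ k := by simpa using (norm_nonneg _).trans (hv 0)
  have hl' : ∀ x y, ‖v x - v y‖ ≤ |l| * ‖x - y‖ := fun x y =>
    (hl x y).trans (mul_le_mul_of_nonneg_right (le_abs_self l) (norm_nonneg _))
  have h1 : QuadLip _ (fun x : Eucl d => inner ℝ x (Q x)) :=
    QuadLip.quadratic_form Q (v := fun x => x) (l := 1) (k := 1) zero_le_one (by simp)
      (fun x => by linarith)
  have h2 := QuadLip.quadratic_form R hk hl' hv
  have h3 := QuadLip.quadratic_form Qb (v := fun x => x - S (barycenter ν)) (l := 1)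
    (k := 1 + ‖S (barycenter ν)‖) (by positivity) (by simp) (fun x => by
      have := norm_sub_le x (S (barycenter ν))
      nlinarith [norm_nonneg x, norm_nonneg (S (barycenter ν)),
        mul_nonneg (norm_nonneg x) (norm_nonneg (S (barycenter ν)))])
  exact ⟨_, by positivity, ((h1.add h2).add h3).const_mul (1 / 2)⟩

lemma norm_barycenter_sub_le (μ ν : P2 d) : ‖barycenter μ - barycenter ν‖ ≤ W2 μ ν := by
  simpa [barycenter] using
    norm_integral_sub_le_of_lipschitz (f := fun x : Eucl d => x) zero_le_one (by simp) μ ν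

lemma norm_barycenter_sq_le (ν : P2 d) : ‖barycenter ν‖ ^ 2 ≤ ν.m2 :=
  (pow_le_pow_left₀ (norm_nonneg _) (norm_integral_le_integral_norm _) 2).trans
    ν.sq_integral_norm_le

/-- Only the barycenter term changes with ν, and its variation is at most ‖S‖ W₂; the constant
depends on ν₀ alone. -/
lemma exists_abs_quadCost_sub_le (Q R S Qb : Eucl d →L[ℝ] Eucl d) (v : Eucl d → Eucl d)
    (ν₀ : P2 d) : ∃ K, 0 ≤ K ∧ ∀ ν x, |quadCost Q R S Qb v ν x - quadCost Q R S Qb v ν₀ x| ≤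
      K * (1 + W2 ν ν₀) * W2 ν ν₀ * (1 + ‖x‖ ^ 2) := by
  refine ⟨1 / 2 * ‖Qb‖ * (2 + 2 * ‖S (barycenter ν₀)‖ + ‖S‖) * ‖S‖, by positivity, fun ν x => ?_⟩
  have hW := W2_nonneg ν ν₀
  set w := S (barycenter ν₀) with hw
  set w' := S (barycenter ν) with hw'
  have hd : ‖w' - w‖ ≤ ‖S‖ * W2 ν ν₀ := by
    rw [hw, hw', ← map_sub]
    exact (S.le_opNorm _).trans
      (mul_le_mul_of_nonneg_left (norm_barycenter_sub_le ν ν₀) (norm_nonneg _))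
  have he : quadCost Q R S Qb v ν x - quadCost Q R S Qb v ν₀ x =
      1 / 2 * (inner ℝ (x - w') (Qb (x - w')) - inner ℝ (x - w) (Qb (x - w))) := by
    simp only [quadCost, ← hw, ← hw']; ring
  rw [he, abs_mul, abs_of_pos (by norm_num : (0 : ℝ) < 1 / 2)]
  have h := abs_inner_apply_sub_le Qb (x - w') (x - w)
  have e1 : ‖(x - w') - (x - w)‖ = ‖w' - w‖ := by rw [← norm_neg]; congr 1; abel
  rw [e1] at h
  have h1 : ‖x - w'‖ + ‖x - w‖ ≤ (2 + 2 * ‖w‖ + ‖S‖) * (1 + W2 ν ν₀) * (1 + ‖x‖ ^ 2) := by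
    have a1 := norm_sub_le x w
    have a2 := norm_sub_le x w'
    have a3 : ‖w'‖ ≤ ‖w‖ + ‖w' - w‖ := by
      simpa using norm_add_le w (w' - w)
    have a4 : 2 * ‖x‖ ≤ 1 + ‖x‖ ^ 2 := by nlinarith [sq_nonneg (‖x‖ - 1)]
    have b0 := norm_nonneg S
    have b1 := norm_nonneg w
    have c1 : (1 : ℝ) ≤ 1 + ‖x‖ ^ 2 := by nlinarith [sq_nonneg ‖x‖]
    calc ‖x - w'‖ + ‖x - w‖ ≤ (1 + ‖x‖ ^ 2) + (2 * ‖w‖ + ‖S‖ * W2 ν ν₀) * 1 := by linarith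
      _ ≤ (1 + ‖x‖ ^ 2) + (2 * ‖w‖ + ‖S‖ * W2 ν ν₀) * (1 + ‖x‖ ^ 2) := by gcongr
      _ = (1 + 2 * ‖w‖ + ‖S‖ * W2 ν ν₀) * (1 + ‖x‖ ^ 2) := by ring
      _ ≤ _ := by
        gcongr
        nlinarith [mul_nonneg b0 hW, mul_nonneg b1 hW]
  calc 1 / 2 * |inner ℝ (x - w') (Qb (x - w')) - inner ℝ (x - w) (Qb (x - w))|
      ≤ 1 / 2 * (‖Qb‖ * (‖x - w'‖ + ‖x - w‖) * ‖w' - w‖) := by gcongr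
    _ ≤ 1 / 2 * (‖Qb‖ * ((2 + 2 * ‖w‖ + ‖S‖) * (1 + W2 ν ν₀) * (1 + ‖x‖ ^ 2)) *
        (‖S‖ * W2 ν ν₀)) := by gcongr
    _ = _ := by ring

/-- Change first the measure inside the integrand, then the measure of integration. Both errors are
bounded by continuous functions of W₂(ν_i, ν₀) vanishing at 0. -/
lemma tendsto_integral_quadCost {ι : Type*} {F : Filter ι} {ν : ι → P2 d} {ν₀ : P2 d}
    (hν : Tendsto (fun i => W2 (ν i) ν₀) F (𝓝 0)) (Q R S Qb : Eucl d →L[ℝ] Eucl d)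
    {v : Eucl d → Eucl d} {l k : ℝ} (hl : ∀ x y, ‖v x - v y‖ ≤ l * ‖x - y‖)
    (hv : ∀ x, ‖v x‖ ≤ k * (1 + ‖x‖)) :
    Tendsto (fun i => ∫ x, quadCost Q R S Qb v (ν i) x ∂(ν i).meas) F
      (𝓝 (∫ x, quadCost Q R S Qb v ν₀ x ∂ν₀.meas)) := by
  obtain ⟨K, hK, hKq⟩ := exists_quadLip_quadCost Q R S Qb hl hv ν₀
  obtain ⟨K', hK', hKd⟩ := exists_abs_quadCost_sub_le Q R S Qb v ν₀
  rw [tendsto_iff_norm_sub_tendsto_zero]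
  set m := ν₀.m2
  have hlim : Continuous fun w : ℝ => K' * (1 + w) * w * (1 + (2 * m + 2 * w ^ 2)) +
      K * √(3 * (1 + (2 * m + 2 * w ^ 2) + m)) * w := by fun_prop
  have hlim0 := (hlim.tendsto 0).comp hν
  rw [mul_zero, mul_zero, zero_mul, add_zero] at hlim0
  refine squeeze_zero (fun _ => norm_nonneg _) (fun i => ?_) hlim0
  have hW := W2_nonneg (ν i) ν₀
  have hm := (ν i).m2_le ν₀
  obtain ⟨K₁, hK₁, hq⟩ := exists_quadLip_quadCost Q R S Qb hl hv (ν i)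
  have e : (∫ x, quadCost Q R S Qb v (ν i) x ∂(ν i).meas) - ∫ x, quadCost Q R S Qb v ν₀ x ∂ν₀.meas
      = (∫ x, (quadCost Q R S Qb v (ν i) x - quadCost Q R S Qb v ν₀ x) ∂(ν i).meas) +
        ((∫ x, quadCost Q R S Qb v ν₀ x ∂(ν i).meas) -
          ∫ x, quadCost Q R S Qb v ν₀ x ∂ν₀.meas) := by
    rw [integral_sub (hq.integrable hK₁ _) (hKq.integrable hK _)]; ring
  rw [e]
  refine (norm_add_le _ _).trans (add_le_add ?_ ?_)
  · simpa using P2.abs_integral_le_of_le_sq (B₁ := 0)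
      (B₂ := K' * (1 + W2 (ν i) ν₀) * W2 (ν i) ν₀) hm (by positivity)
      (by simpa using hKd (ν i))
  · refine (hKq.norm_integral_sub_le hK (ν i) ν₀).trans ?_
    dsimp only [Function.comp]
    gcongr

lemma abs_quadCost_le {Q R S Qb : Eucl d →L[ℝ] Eucl d} {B : ℝ} (hQ : ‖Q‖ ≤ B) (hR : ‖R‖ ≤ B)
    (hS : ‖S‖ ≤ B) (hQb : ‖Qb‖ ≤ B) {v : Eucl d → Eucl d} {k : ℝ}
    (hv : ∀ x, ‖v x‖ ≤ k * (1 + ‖x‖)) {ν : P2 d} {M : ℝ} (hM : ν.m2 ≤ M) (x : Eucl d) :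
    |quadCost Q R S Qb v ν x| ≤ (3 * B + B ^ 3 * M) * (1 + k ^ 2) * (1 + ‖x‖ ^ 2) := by
  have hB : 0 ≤ B := (norm_nonneg _).trans hQ
  have hM0 : 0 ≤ M := ν.m2_nonneg.trans hM
  have h1 : |inner ℝ x (Q x)| ≤ B * ‖x‖ ^ 2 :=
    (abs_inner_apply_le Q x).trans (by gcongr)
  have h2 : |inner ℝ (v x) (R (v x))| ≤ B * (k ^ 2 * (2 * (1 + ‖x‖ ^ 2))) := by
    refine (abs_inner_apply_le R (v x)).trans ?_
    calc ‖R‖ * ‖v x‖ ^ 2 ≤ B * (k * (1 + ‖x‖)) ^ 2 := by gcongr; exact hv x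
      _ = B * (k ^ 2 * (1 + ‖x‖) ^ 2) := by ring
      _ ≤ _ := by gcongr; nlinarith [sq_nonneg (‖x‖ - 1)]
  have h3 : |inner ℝ (x - S (barycenter ν)) (Qb (x - S (barycenter ν)))| ≤
      B * (2 * ‖x‖ ^ 2 + 2 * (B ^ 2 * M)) := by
    refine (abs_inner_apply_le Qb _).trans ?_
    have a : ‖S (barycenter ν)‖ ^ 2 ≤ B ^ 2 * M :=
      calc ‖S (barycenter ν)‖ ^ 2 ≤ (B * ‖barycenter ν‖) ^ 2 := by
            gcongr; exact S.le_of_opNorm_le hS _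
        _ = B ^ 2 * ‖barycenter ν‖ ^ 2 := by ring
        _ ≤ _ := by gcongr; exact (norm_barycenter_sq_le ν).trans hM
    have b : ‖x - S (barycenter ν)‖ ^ 2 ≤ 2 * ‖x‖ ^ 2 + 2 * (B ^ 2 * M) := by
      have := norm_sub_le x (S (barycenter ν))
      nlinarith [sq_nonneg (‖x‖ - ‖S (barycenter ν)‖), norm_nonneg (x - S (barycenter ν))]
    gcongr
  have h4 : |quadCost Q R S Qb v ν x| ≤ 1 / 2 * (B * ‖x‖ ^ 2 + B * (k ^ 2 * (2 * (1 + ‖x‖ ^ 2))) +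
      B * (2 * ‖x‖ ^ 2 + 2 * (B ^ 2 * M))) := by
    unfold quadCost
    rw [abs_mul, abs_of_pos (by norm_num : (0 : ℝ) < 1 / 2)]
    gcongr
    exact (abs_add_le _ _).trans (add_le_add ((abs_add_le _ _).trans (add_le_add h1 h2)) h3)
  refine h4.trans ?_
  have hx := sq_nonneg ‖x‖
  have hk := sq_nonneg k
  have p1 : 0 ≤ B * k ^ 2 * (1 + ‖x‖ ^ 2) := by positivity
  have p2 : 0 ≤ B * ‖x‖ ^ 2 := by positivity
  have p3 : 0 ≤ B ^ 3 * M * (k ^ 2 + ‖x‖ ^ 2 + k ^ 2 * ‖x‖ ^ 2) := by positivity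
  nlinarith

/-- Measurability in time of the integral of a Carathéodory integrand against a continuous
curve. -/
lemma aestronglyMeasurable_integral_curve (hT : 0 ≤ T) {ρ : ℝ → P2 d}
    (hρ : ∀ s ∈ Icc 0 T, Tendsto (fun t => W2 (ρ t) (ρ s)) (𝓝[Icc 0 T] s) (𝓝 0))
    {F : ℝ → Eucl d → ℝ}
    (hF : ∀ x, AEStronglyMeasurable (fun t => F t x) (volume.restrict (Ioo 0 T)))
    (hF' : ∀ᵐ t ∂volume.restrict (Ioo 0 T), ∃ K, 0 ≤ K ∧ QuadLip K (F t)) :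
    AEStronglyMeasurable (fun t => ∫ x, F t x ∂(ρ t).meas) (volume.restrict (Ioo 0 T)) := by
  set e := TopologicalSpace.denseSeq (Eucl d) with he
  have hgood : ∀ᵐ t ∂volume.restrict (Ioo 0 T),
      (∃ K, 0 ≤ K ∧ QuadLip K (F t)) ∧ ∀ n, F t (e n) = (hF (e n)).mk _ t :=
    hF'.and (ae_all_iff.2 fun n => (hF (e n)).ae_eq_mk)
  -- Discarding a measurable null set yields an integrand that is continuous in x for every t and
  -- measurable in t at each point of a countable dense set, hence at every x.
  obtain ⟨A, hA, hAm, hAae⟩ : ∃ A : Set ℝ, (∀ t ∈ A, (∃ K, 0 ≤ K ∧ QuadLip K (F t)) ∧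
      ∀ n, F t (e n) = (hF (e n)).mk _ t) ∧ MeasurableSet A ∧
      ∀ᵐ t ∂volume.restrict (Ioo 0 T), t ∈ A := by
    obtain ⟨A, hsub, hm, h0⟩ := exists_measurable_superset_of_null (ae_iff.1 hgood)
    refine ⟨Aᶜ, fun t ht => ?_, hm.compl, measure_mono_null (fun t ht => by simpa using ht) h0⟩
    by_contra h
    exact ht (hsub h)
  set G : ℝ → Eucl d → ℝ := fun t x => A.indicator (fun s => F s x) t with hG
  have hGq : ∀ t, ∃ K, 0 ≤ K ∧ QuadLip K (G t) := fun t => by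
    by_cases ht : t ∈ A
    · simpa [hG, ht] using (hA t ht).1
    · refine ⟨0, le_rfl, fun x y => ?_⟩
      simp [hG, ht]
  have hGc : ∀ t, Continuous (G t) := fun t => (hGq t).choose_spec.2.continuous
  have hGe : ∀ n, StronglyMeasurable fun t => G t (e n) := fun n => by
    have : (fun t => G t (e n)) = A.indicator ((hF (e n)).mk _) := by
      ext t
      by_cases ht : t ∈ A
      · simpa [hG, ht] using (hA t ht).2 n
      · simp [hG, ht]
    rw [this]
    exact (hF (e n)).stronglyMeasurable_mk.indicator hAm
  have hGm : ∀ x, StronglyMeasurable fun t => G t x := fun x => by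
    obtain ⟨y, hy, hyx⟩ := mem_closure_iff_seq_limit.1
      ((TopologicalSpace.denseRange_denseSeq (Eucl d)) x)
    choose n hn using hy
    refine stronglyMeasurable_of_tendsto atTop (f := fun j t => G t (y j)) (fun j => ?_) ?_
    · rw [← hn j]; exact hGe (n j)
    · exact tendsto_pi_nhds.2 fun t => ((hGc t).tendsto x).comp hyx
  have hGj : StronglyMeasurable (Function.uncurry fun (x : Eucl d) t => G t x) :=
    stronglyMeasurable_uncurry_of_continuous_of_stronglyMeasurable hGc hGm
  -- Decouple the two roles of time: the integral of F_t against ρ_s is continuous in s and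
  -- measurable in t, hence jointly measurable, and is then restricted to the diagonal.
  have hI : StronglyMeasurable (Function.uncurry fun (s : Icc 0 T) t => ∫ x, G t x ∂(ρ s).meas) := by
    refine stronglyMeasurable_uncurry_of_continuous_of_stronglyMeasurable (fun t => ?_) fun s => ?_
    · obtain ⟨K, hK, hq⟩ := hGq t
      have h : ContinuousOn (fun s => ∫ x, G t x ∂(ρ s).meas) (Icc 0 T) :=
        fun s hs => hq.tendsto_integral hK hρ hs
      exact continuousOn_iff_continuous_domRestrict.1 h
    · exact hGj.integral_prod_left'
  have hdiag : Measurable fun t : ℝ => (projIcc 0 T hT t, t) :=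
    continuous_projIcc.measurable.prodMk measurable_id
  refine ⟨_, hI.comp_measurable hdiag, ?_⟩
  filter_upwards [hAae, ae_restrict_mem measurableSet_Ioo] with t ht htI
  simp [hG, ht, projIcc_of_mem hT (Ioo_subset_Icc_self htI)]

lemma continuousOn_barycenter {ρ : ℝ → P2 d}
    (hρ : ∀ s ∈ Icc 0 T, Tendsto (fun t => W2 (ρ t) (ρ s)) (𝓝[Icc 0 T] s) (𝓝 0)) :
    ContinuousOn (fun t => barycenter (ρ t)) (Icc 0 T) := fun s hs => by
  rw [ContinuousWithinAt, tendsto_iff_norm_sub_tendsto_zero]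
  exact squeeze_zero (fun _ => norm_nonneg _) (fun t => norm_barycenter_sub_le _ _) (hρ s hs)

/-! ### Integrability and convergence of the cost in time. -/

namespace QuadraticCost

variable (c : QuadraticCost d T)

lemma exists_norm_le : ∃ B, ∀ t ∈ Icc 0 T, ‖c.Q t‖ ≤ B ∧ ‖c.R t‖ ≤ B ∧ ‖c.S t‖ ≤ B ∧
    ‖c.Qbar t‖ ≤ B := by
  obtain ⟨B₁, h₁⟩ := isCompact_Icc.exists_bound_of_continuousOn c.continuous_Q
  obtain ⟨B₂, h₂⟩ := isCompact_Icc.exists_bound_of_continuousOn c.continuous_R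
  obtain ⟨B₃, h₃⟩ := isCompact_Icc.exists_bound_of_continuousOn c.continuous_S
  obtain ⟨B₄, h₄⟩ := isCompact_Icc.exists_bound_of_continuousOn c.continuous_Qbar
  refine ⟨max (max B₁ B₂) (max B₃ B₄), fun t ht => ⟨?_, ?_, ?_, ?_⟩⟩
  · exact (h₁ t ht).trans (by simp)
  · exact (h₂ t ht).trans (by simp)
  · exact (h₃ t ht).trans (by simp)
  · exact (h₄ t ht).trans (by simp)

variable {u : ℝ → Eucl d → Eucl d} {ρ : ℝ → P2 d}

lemma aestronglyMeasurable_running (hu : IsControl T u)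
    (hρ : ∀ s ∈ Icc 0 T, Tendsto (fun t => W2 (ρ t) (ρ s)) (𝓝[Icc 0 T] s) (𝓝 0)) (x : Eucl d) :
    AEStronglyMeasurable (fun t => c.running t x (ρ t) (u t x)) (volume.restrict (Ioo 0 T)) := by
  have hm : ∀ {E : Type} [NormedAddCommGroup E] [SecondCountableTopology E] {f : ℝ → E},
      ContinuousOn f (Icc 0 T) → AEStronglyMeasurable f (volume.restrict (Ioo 0 T)) :=
    fun hf => (hf.mono Ioo_subset_Icc_self).aestronglyMeasurable measurableSet_Ioo
  have hap : ∀ {A : ℝ → Eucl d →L[ℝ] Eucl d} {w : ℝ → Eucl d}, ContinuousOn A (Icc 0 T) →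
      AEStronglyMeasurable w (volume.restrict (Ioo 0 T)) →
      AEStronglyMeasurable (fun t => A t (w t)) (volume.restrict (Ioo 0 T)) := fun hA hw =>
    (isBoundedBilinearMap_apply (𝕜 := ℝ) (E := Eucl d) (F := Eucl d)).continuous.comp_aestronglyMeasurable
      ((hm hA).prodMk hw)
  have hx : AEStronglyMeasurable (fun _ : ℝ => x) (volume.restrict (Ioo 0 T)) :=
    aestronglyMeasurable_const
  have hw := hx.sub (hap c.continuous_S (hm (continuousOn_barycenter hρ)))
  exact (((hx.inner (hap c.continuous_Q hx)).add
    ((hu.measurable x).inner (hap c.continuous_R (hu.measurable x)))).add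
    (hw.inner (hap c.continuous_Qbar hw))).const_mul (1 / 2)

lemma aestronglyMeasurable_integral_running (hT : 0 ≤ T) (hu : IsControl T u) {k : ℝ → ℝ}
    (hk : ∀ᵐ t ∂volume.restrict (Ioo 0 T), ∀ x, ‖u t x‖ ≤ k t * (1 + ‖x‖))
    (hρ : ∀ s ∈ Icc 0 T, Tendsto (fun t => W2 (ρ t) (ρ s)) (𝓝[Icc 0 T] s) (𝓝 0)) :
    AEStronglyMeasurable (fun t => ∫ x, c.running t x (ρ t) (u t x) ∂(ρ t).meas)
      (volume.restrict (Ioo 0 T)) := by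
  obtain ⟨l, -, hl⟩ := hu.lipschitz
  refine aestronglyMeasurable_integral_curve hT hρ (c.aestronglyMeasurable_running hu hρ) ?_
  filter_upwards [hl, hk] with t htl htk
  exact exists_quadLip_quadCost _ _ _ _ htl htk _

lemma abs_integral_running_le {B : ℝ} (hB : ∀ t ∈ Icc 0 T, ‖c.Q t‖ ≤ B ∧ ‖c.R t‖ ≤ B ∧
    ‖c.S t‖ ≤ B ∧ ‖c.Qbar t‖ ≤ B) {t : ℝ} (ht : t ∈ Icc 0 T) {v : Eucl d → Eucl d} {k : ℝ}
    (hv : ∀ x, ‖v x‖ ≤ k * (1 + ‖x‖)) {ν : P2 d} {M : ℝ} (hM : ν.m2 ≤ M) :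
    |∫ x, c.running t x ν (v x) ∂ν.meas| ≤ (3 * B + B ^ 3 * M) * (1 + k ^ 2) * (1 + M) := by
  obtain ⟨h1, h2, h3, h4⟩ := hB t ht
  have hB0 : 0 ≤ B := (norm_nonneg _).trans h1
  have hM0 : 0 ≤ M := ν.m2_nonneg.trans hM
  simpa using P2.abs_integral_le_of_le_sq (B₁ := 0) (B₂ := (3 * B + B ^ 3 * M) * (1 + k ^ 2)) hM
    (by positivity) (by simpa [c.running_eq] using abs_quadCost_le h1 h2 h3 h4 hv hM)

lemma integrable_bound {k : ℝ → ℝ} (hk : MemLp k 2 (volume.restrict (Ioo 0 T))) (a b : ℝ) :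
    Integrable (fun t => a * (1 + k t ^ 2) * b) (volume.restrict (Ioo 0 T)) :=
  (((integrable_const 1).add hk.integrable_sq).const_mul a).mul_const b

lemma isFinite (hT : 0 ≤ T) (hu : IsControl T u) {k : ℝ → ℝ}
    (hk2 : MemLp k 2 (volume.restrict (Ioo 0 T)))
    (hk : ∀ᵐ t ∂volume.restrict (Ioo 0 T), ∀ x, ‖u t x‖ ≤ k t * (1 + ‖x‖))
    (hρ : ∀ s ∈ Icc 0 T, Tendsto (fun t => W2 (ρ t) (ρ s)) (𝓝[Icc 0 T] s) (𝓝 0)) :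
    c.IsFinite ρ u where
  inner_integrable := by
    obtain ⟨l, -, hl⟩ := hu.lipschitz
    filter_upwards [hl, hk] with t htl htk
    obtain ⟨K, hK, hq⟩ := exists_quadLip_quadCost (c.Q t) (c.R t) (c.S t) (c.Qbar t) htl htk (ρ t)
    exact hq.integrable hK _
  time_integrable := by
    obtain ⟨M, hM⟩ := exists_m2_le hρ
    obtain ⟨B, hB⟩ := c.exists_norm_le
    rw [intervalIntegrable_iff_integrableOn_Ioo_of_le hT]
    refine (integrable_bound hk2 (3 * B + B ^ 3 * M) (1 + M)).mono'
      (c.aestronglyMeasurable_integral_running hT hu hk hρ) ?_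
    filter_upwards [hk, ae_restrict_mem measurableSet_Ioo] with t htk ht
    exact c.abs_integral_running_le hB (Ioo_subset_Icc_self ht) htk
      (hM t (Ioo_subset_Icc_self ht))
  final_integrable := by
    simp_rw [c.final_eq]
    obtain ⟨K, hK, hq⟩ := exists_quadLip_quadCost c.QT 0 c.ST c.QbarT (v := 0) (l := 0) (k := 0)
      (by simp) (by simp) (ρ T)
    exact hq.integrable hK _

/-- Dominated convergence in time: uniform second moments and k ∈ L² give the majorant,
`tendsto_integral_quadCost` the pointwise limit. -/
lemma tendsto_J (hT : 0 ≤ T) (hu : IsControl T u) {k : ℝ → ℝ}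
    (hk2 : MemLp k 2 (volume.restrict (Ioo 0 T)))
    (hk : ∀ᵐ t ∂volume.restrict (Ioo 0 T), ∀ x, ‖u t x‖ ≤ k t * (1 + ‖x‖))
    {ι : Type*} {F : Filter ι} [F.IsCountablyGenerated] {ν : ι → ℝ → P2 d} {M : ℝ}
    (hνc : ∀ᶠ i in F, ∀ s ∈ Icc 0 T,
      Tendsto (fun t => W2 (ν i t) (ν i s)) (𝓝[Icc 0 T] s) (𝓝 0))
    (hM : ∀ᶠ i in F, ∀ t ∈ Icc 0 T, (ν i t).m2 ≤ M)
    (hν : ∀ t ∈ Icc 0 T, Tendsto (fun i => W2 (ν i t) (ρ t)) F (𝓝 0)) :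
    Tendsto (fun i => c.J (ν i) u) F (𝓝 (c.J ρ u)) := by
  obtain ⟨l, -, hl⟩ := hu.lipschitz
  obtain ⟨B, hB⟩ := c.exists_norm_le
  refine Tendsto.add ?_ ?_
  · simp_rw [intervalIntegral.integral_of_le hT, integral_Ioc_eq_integral_Ioo]
    refine tendsto_integral_filter_of_dominated_convergence
      (fun t => (3 * B + B ^ 3 * M) * (1 + k t ^ 2) * (1 + M)) ?_ ?_
      (integrable_bound hk2 _ _) ?_
    · filter_upwards [hνc] with i hi
      exact c.aestronglyMeasurable_integral_running hT hu hk hi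
    · filter_upwards [hM] with i hi
      filter_upwards [hk, ae_restrict_mem measurableSet_Ioo] with t htk ht
      exact c.abs_integral_running_le hB (Ioo_subset_Icc_self ht) htk
        (hi t (Ioo_subset_Icc_self ht))
    · filter_upwards [hl, hk, ae_restrict_mem measurableSet_Ioo] with t htl htk ht
      exact tendsto_integral_quadCost (hν t (Ioo_subset_Icc_self ht)) _ _ _ _ htl htk
  · simp_rw [c.final_eq]
    exact tendsto_integral_quadCost (hν T (right_mem_Icc.2 hT)) _ _ _ _ (l := 0) (k := 0)
      (by simp) (by simp)

end QuadraticCost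

end VanishingViscosity

end

theorem lemma2 {d : ℕ} {T : ℝ} (hT : 0 < T)
    (b : ℝ → Eucl d → P2 d → Eucl d)
    (hb_time : ∀ (x : Eucl d) (μ : P2 d), ContinuousOn (fun t => b t x μ) (Ioo 0 T))
    (hb_lip : ∃ L : ℝ, ∀ t ∈ Ioo 0 T, ∀ (μ ν : P2 d) (x y : Eucl d),
      ‖b t x μ - b t y ν‖ ≤ L * (W2 μ ν + ‖x - y‖))
    (hb_growth : ∃ C : ℝ, ∀ t ∈ Ioo 0 T, ∀ (x : Eucl d) (μ : P2 d),
      ‖b t x μ‖ ≤ C * (1 + ‖x‖ + ∫ y, ‖y‖ ∂μ.meas))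
    (u : ℝ → Eucl d → Eucl d) (hu : IsControl T u)
    (hu_growth : ∃ k : ℝ → ℝ, MemLp k 2 (volume.restrict (Ioo 0 T)) ∧
      ∀ᵐ t ∂volume.restrict (Ioo 0 T), ∀ x, ‖u t x‖ ≤ k t * (1 + ‖x‖))
    (c : QuadraticCost d T)
    (μ₀ : P2 d) (hμ₀ : μ₀.IsCompactAC)
    (μ : ℝ → P2 d) (hμ : IsWeakSolution T 0 b μ₀ μ)
    (μe : ℝ → ℝ → P2 d) (hμe : ∀ ε > 0, IsWeakSolution T ε b μ₀ (μe ε)) :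
    Tendsto (fun ε => ⨆ t ∈ Icc 0 T, ENNReal.ofReal (W2 (μe ε t) (μ t))) (𝓝[>] 0) (𝓝 0) ∧
    TendstoUniformlyOn (fun ε t => barycenter (μe ε t)) (fun t => barycenter (μ t))
      (𝓝[>] 0) (Icc 0 T) ∧
    c.IsFinite μ u ∧ (∀ ε > 0, c.IsFinite (μe ε) u) ∧
    Tendsto (fun ε => c.J (μe ε) u) (𝓝[>] 0) (𝓝 (c.J μ u)) := by
  obtain ⟨L, hL⟩ := hb_lip
  obtain ⟨C, hC⟩ := hb_growth
  obtain ⟨k, hk2, hk⟩ := hu_growth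
  -- The given constants may be negative; absolute values restore the sign that later estimates
  -- need.
  have hL' : ∀ t ∈ Ioo 0 T, ∀ (μ ν : P2 d) (x y : Eucl d),
      ‖b t x μ - b t y ν‖ ≤ |L| * (W2 μ ν + ‖x - y‖) := fun t ht μ ν x y =>
    (hL t ht μ ν x y).trans (mul_le_mul_of_nonneg_right (le_abs_self L)
      (add_nonneg (W2_nonneg μ ν) (norm_nonneg _)))
  have hC' : ∀ t ∈ Ioo 0 T, ∀ (x : Eucl d) (μ : P2 d),
      ‖b t x μ‖ ≤ |C| * (1 + ‖x‖ + ∫ y, ‖y‖ ∂μ.meas) := fun t ht x μ =>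
    (hC t ht x μ).trans (mul_le_mul_of_nonneg_right (le_abs_self C)
      (add_nonneg (by positivity) (integral_nonneg fun y => norm_nonneg y)))
  obtain ⟨M, hM, hmom⟩ := exists_uniform_moments (abs_nonneg C) hC' hμ₀.2
  have hW : ∀ κ > 0, ∀ᶠ ε in 𝓝[>] 0, ∀ t ∈ Icc 0 T, W2 (μe ε t) (μ t) ≤ κ := fun κ hκ =>
    eventually_forall_W2_le hT.le (abs_nonneg L) (abs_nonneg C) hM hb_time hL' hC' hμ₀.2 hmom
      hμ hμe hκ
  refine ⟨?_, ?_, c.isFinite hT.le hu hk2 hk hμ.continuous,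
    fun ε hε => c.isFinite hT.le hu hk2 hk (hμe ε hε).continuous,
    c.tendsto_J (M := M) hT.le hu hk2 hk ?_ ?_ ?_⟩
  · rw [ENNReal.tendsto_nhds_zero]
    intro κ hκ
    rcases eq_or_ne κ ⊤ with rfl | hκt
    · simp
    filter_upwards [hW κ.toReal (ENNReal.toReal_pos hκ.ne' hκt)] with ε hε
    exact iSup₂_le fun t ht => ENNReal.ofReal_le_of_le_toReal (hε t ht)
  · rw [Metric.tendstoUniformlyOn_iff]
    intro κ hκ
    filter_upwards [hW (κ / 2) (half_pos hκ)] with ε hε t ht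
    rw [dist_comm, dist_eq_norm]
    linarith [norm_barycenter_sub_le (μe ε t) (μ t), hε t ht]
  · filter_upwards [self_mem_nhdsWithin] with ε hε using (hμe ε hε).continuous
  · filter_upwards [Ioc_mem_nhdsGT zero_lt_one] with ε hε t ht
    exact (hmom ε hε.1.le hε.2 _ (hμe ε hε.1) t ht).1
  · intro t ht
    rw [Metric.tendsto_nhds]
    intro κ hκ
    filter_upwards [hW (κ / 2) (half_pos hκ)] with ε hε
    rw [Real.dist_0_eq_abs, abs_of_nonneg (W2_nonneg _ _)]
    linarith [hε t ht]
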